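/- Let $\mathbb{H}$ be the quaternions, $Sp(1)\subset\mathbb{H}$ the unit quaternions, and $U(1)=Sp(1)\cap\mathbb{C}$. Let $(m,n)=(3,8)$ or $(m,n)=(2,7)$, and let $W=(w_{l\alpha})$ be an integral $m\times(m+1)$ matrix with columns $W_1,\dots,W_{m+1}$. Group the coordinates of $\boldsymbol u\in\mathbb{H}^n$ into $m+1$ pairs $(a_\alpha,b_\alpha)$, $1\le\alpha\le m+1$: for $n=8$ the pairs are $(u_1,u_2),(u_3,u_4),(u_5,u_6),(u_7,u_8)$; for $n=7$ they are $(u_2,u_3),(u_4,u_5),(u_6,u_7)$, with $u_1$ a single coordinate. The torus $T^m_W=U(1)^m$ acts on $\mathbb{H}^n$: the element $(e^{it_1},\dots,e^{it_m})$ rotates the pair $(a_\alpha,b_\alpha)$ by $\begin{pmatrix}\cos\omega_\alpha&\sin\omega_\alpha\\-\sin\omega_\alpha&\cos\omega_\alpha\end{pmatrix}$, $\omega_\alpha=\sum_l w_{l\alpha}t_l$, and fixes $u_1$ when $n=7$; write $A(\tau)$ for the action of $\tau\in T^m_W$. Let $N(W)$ be the set of all $\boldsymbol u$ in the unit sphere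 of $\mathbb{H}^n$ at which the moment maps of $Sp(1)$ (acting by left multiplication) and of $T^m_W$ vanish: $$\sum_{\beta=1}^n\overline{u}_\beta\,\sigma\,u_\beta=0\ \ (\sigma=i,j,k),\qquad \sum_{\alpha=1}^{m+1} w_{l\alpha}\,(\overline{a}_\alpha b_\alpha-\overline{b}_\alpha a_\alpha)=0\ \ (1\le l\le m).$$ The group $G=T^m_W\times Sp(1)$ acts on $N(W)$ by $(\tau,\lambda)\cdot\boldsymbol u=A(\tau)\lambda\boldsymbol u$, and $\tilde G=G\times U(1)$ acts by $(\tau,\lambda,\rho)\cdot\boldsymbol u=A(\tau)\lambda\boldsymbol u\rho$. Put $$\mathcal{M}^7(W)=N(W)/G,\qquad \mathcal{Z}^6(W)=N(W)/\tilde G ,$$ the 3-Sasakian orbifold and the twistor space over the self-dual Einstein orbifold $\mathcal{O}^4(W)$. The isotropy group of a point of one of these quotients is the stabilizer of a representative in $N(W)$ modulo the subgroup acting trivially on $N(W)$. The group $Sp(1)$ acts on $\mathcal{M}^7(W)$ by $[\boldsymbol u]\cdot p=[\boldsymbol u p]$; this action factors through $SO(3)$ and is generated by the three characteristic vector fields of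 the 3-Sasakian structure. Call $W$ admissible if all its $m\times m$ minors are nonzero and, for every choice of signs, the determinant with rows $W_1\pm W_2,\dots,W_1\pm W_{m+1}$ is nonzero. **Theorem.** For every admissible $\Theta\in M_{3\times4}(\mathbb{Z})$ (case $n=8$, from $Gr_4(\mathbb{R}^8)$) and every admissible $\Omega\in M_{2\times3}(\mathbb{Z})$ (case $n=7$, from $Gr_4(\mathbb{R}^7)$): 1. there is no homeomorphism $\mathcal{Z}^6(\Theta)\to\mathcal{Z}^6(\Omega)$ under which corresponding points have isomorphic isotropy groups; in particular, $\mathcal{Z}^6(\Theta)$ and $\mathcal{Z}^6(\Omega)$ are not isomorphic as orbifolds; 2. there is no homeomorphism $f:\mathcal{M}^7(\Theta)\to\mathcal{M}^7(\Omega)$ under which corresponding points have isomorphic isotropy groups and which, for some $q\in Sp(1)$, satisfies $f(x\cdot p)=f(x)\cdot(q^{-1}pq)$ for all $x\in\mathcal{M}^7(\Theta)$ and $p\in Sp(1)$; in particular, $\mathcal{M}^7(\Theta)$ and $\mathcal{M}^7(\Omega)$ are not isomorphic as 3-Sasakian orbifolds. -/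

import Mathlib

open scoped Quaternion

noncomputable section

namespace SDE

/-- The group `Sp(1)` of unit quaternions. -/
abbrev Sp1 : Type := unitary ℍ[ℝ]

/-- The inclusion `U(1) ⊂ Sp(1)` coming from `ℂ ⊂ ℍ`. -/
def circleToSp1 : Circle →* Sp1 where
  toFun ρ := ⟨((ρ : ℂ) : ℍ[ℝ]), by
    have h : (ρ : ℂ).re * (ρ : ℂ).re + (ρ : ℂ).im * (ρ : ℂ).im = 1 := by
      have := Circle.normSq_coe ρ
      rwa [Complex.normSq_apply] at this
    rw [Unitary.mem_iff]
    constructor <;> ext <;> simp <;> linarith⟩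
  map_one' := by ext <;> simp
  map_mul' a b := by ext <;> simp

/-- The quaternionic vector space `ℍ^(e + 2k)`. A vector consists of `e` single coordinates
(fixed by the torus) and of `k` quaternionic pairs (rotated by the torus). -/
abbrev QVec (e k : ℕ) : Type := (Fin e → ℍ[ℝ]) × (Fin k → ℍ[ℝ] × ℍ[ℝ])

/-- The torus `T^m = U(1)^m`. -/
abbrev Torus (m : ℕ) : Type := Fin m → Circle

/-- For a weight matrix `W`, the unit complex number `exp (i ω_α)`, where
`ω_α = ∑ l, W l α * t_l` and `τ_l = exp (i t_l)`. -/
def rotor {m k : ℕ} (W : Matrix (Fin m) (Fin k) ℤ) (τ : Torus m) (α : Fin k) : Circle :=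
  ∏ l, τ l ^ W l α

/-- The transformation `u ↦ A(τ) λ u p`. Here `λ` multiplies each coordinate on the left,
`p` multiplies each coordinate on the right, and `A(τ)` rotates the `α`-th quaternionic pair by the
real matrix `[cos ω_α, sin ω_α; -sin ω_α, cos ω_α]`. -/
def transform {e m k : ℕ} (W : Matrix (Fin m) (Fin k) ℤ) (τ : Torus m) (lam p : Sp1)
    (u : QVec e k) : QVec e k :=
  (fun i => (lam : ℍ[ℝ]) * u.1 i * (p : ℍ[ℝ]),
   fun α =>
    ((rotor W τ α : ℂ).re • ((lam : ℍ[ℝ]) * (u.2 α).1 * (p : ℍ[ℝ]))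
        + (rotor W τ α : ℂ).im • ((lam : ℍ[ℝ]) * (u.2 α).2 * (p : ℍ[ℝ])),
     -((rotor W τ α : ℂ).im • ((lam : ℍ[ℝ]) * (u.2 α).1 * (p : ℍ[ℝ])))
        + (rotor W τ α : ℂ).re • ((lam : ℍ[ℝ]) * (u.2 α).2 * (p : ℍ[ℝ]))))

/-- The square of the Euclidean norm on `ℍ^(e + 2k)`. -/
def sqNorm {e k : ℕ} (u : QVec e k) : ℝ :=
  ∑ i, ‖u.1 i‖ ^ 2 + ∑ α, (‖(u.2 α).1‖ ^ 2 + ‖(u.2 α).2‖ ^ 2)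

/-- The quaternion unit `i`. -/
def qI : ℍ[ℝ] := ⟨0, 1, 0, 0⟩

/-- The quaternion unit `j`. -/
def qJ : ℍ[ℝ] := ⟨0, 0, 1, 0⟩

/-- The quaternion unit `k`. -/
def qK : ℍ[ℝ] := ⟨0, 0, 0, 1⟩

/-- The component `∑ ū σ u` (sum over all coordinates) of the moment map of `Sp(1)` acting by left
multiplication; the moment map itself is the triple of the components for `σ = i, j, k`. -/
def momentSp1 {e k : ℕ} (σ : ℍ[ℝ]) (u : QVec e k) : ℍ[ℝ] :=
  ∑ i, star (u.1 i) * σ * u.1 i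
    + ∑ α, (star (u.2 α).1 * σ * (u.2 α).1 + star (u.2 α).2 * σ * (u.2 α).2)

/-- The `l`-th component of the moment map of the torus acting with weight matrix `W`. -/
def momentTorus {e m k : ℕ} (W : Matrix (Fin m) (Fin k) ℤ) (u : QVec e k) (l : Fin m) : ℍ[ℝ] :=
  ∑ α, (W l α : ℝ) • (star (u.2 α).1 * (u.2 α).2 - star (u.2 α).2 * (u.2 α).1)

/-- The common zero level of the two moment maps in the unit sphere of `ℍ^(e + 2k)`. -/
def zeroLevel {m k : ℕ} (e : ℕ) (W : Matrix (Fin m) (Fin k) ℤ) : Set (QVec e k) :=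
  {u | sqNorm u = 1 ∧
    momentSp1 qI u = 0 ∧ momentSp1 qJ u = 0 ∧ momentSp1 qK u = 0 ∧
    ∀ l, momentTorus W u l = 0}

section invariance

theorem rotor_one {m k : ℕ} (W : Matrix (Fin m) (Fin k) ℤ) (α : Fin k) :
    rotor W 1 α = 1 := by
  simp [rotor]

theorem rotor_mul {m k : ℕ} (W : Matrix (Fin m) (Fin k) ℤ) (τ τ' : Torus m) (α : Fin k) :
    rotor W (τ * τ') α = rotor W τ α * rotor W τ' α := by
  simp [rotor, mul_zpow, Finset.prod_mul_distrib]

theorem transform_one {e m k : ℕ} (W : Matrix (Fin m) (Fin k) ℤ) (u : QVec e k) :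
    transform W 1 1 1 u = u := by
  simp [transform, rotor_one]

theorem transform_transform {e m k : ℕ} (W : Matrix (Fin m) (Fin k) ℤ) (τ τ' : Torus m)
    (lam lam' p p' : Sp1) (u : QVec e k) :
    transform W τ lam p (transform W τ' lam' p' u)
      = transform W (τ * τ') (lam * lam') (p' * p) u := by
  simp only [transform, rotor_mul]
  refine Prod.ext ?_ ?_
  · funext i
    simp [mul_assoc]
  · funext α
    simp only [Circle.coe_mul, Complex.mul_re, Complex.mul_im, Submonoid.coe_mul, mul_add, add_mul,
      mul_smul_comm, smul_mul_assoc, mul_neg, neg_mul, mul_assoc]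
    refine Prod.ext ?_ ?_ <;> dsimp only <;> module

theorem rotor_sq {m k : ℕ} (W : Matrix (Fin m) (Fin k) ℤ) (τ : Torus m) (α : Fin k) :
    (rotor W τ α : ℂ).re ^ 2 + (rotor W τ α : ℂ).im ^ 2 = 1 := by
  have := Circle.normSq_coe (rotor W τ α)
  rw [Complex.normSq_apply] at this
  linarith

theorem Sp1.star_mul_self (p : Sp1) : star (p : ℍ[ℝ]) * (p : ℍ[ℝ]) = 1 :=
  Unitary.star_mul_self_of_mem p.2

theorem Sp1.norm_eq_one (p : Sp1) : ‖(p : ℍ[ℝ])‖ = 1 := by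
  have h := congrArg norm (Sp1.star_mul_self p)
  rw [norm_mul, norm_star, norm_one] at h
  nlinarith [norm_nonneg (p : ℍ[ℝ])]

/-- Quadratic expressions in a pair are unchanged by a rotation of the pair. -/
theorem rotate_quadratic (c s : ℝ) (h : c ^ 2 + s ^ 2 = 1) (σ a b : ℍ[ℝ]) :
    star (c • a + s • b) * σ * (c • a + s • b) + star (-(s • a) + c • b) * σ * (-(s • a) + c • b)
      = star a * σ * a + star b * σ * b := by
  have : star (c • a + s • b) * σ * (c • a + s • b)
        + star (-(s • a) + c • b) * σ * (-(s • a) + c • b)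
      = (c ^ 2 + s ^ 2) • (star a * σ * a + star b * σ * b) := by
    simp only [star_add, star_neg, Quaternion.star_smul, mul_add, add_mul, mul_smul_comm,
      smul_mul_assoc, mul_neg, neg_mul]
    module
  rw [this, h, one_smul]

theorem rotate_symplectic (c s : ℝ) (h : c ^ 2 + s ^ 2 = 1) (a b : ℍ[ℝ]) :
    star (c • a + s • b) * (-(s • a) + c • b) - star (-(s • a) + c • b) * (c • a + s • b)
      = star a * b - star b * a := by
  have : star (c • a + s • b) * (-(s • a) + c • b) - star (-(s • a) + c • b) * (c • a + s • b)
      = (c ^ 2 + s ^ 2) • (star a * b - star b * a) := by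
    simp only [star_add, star_neg, Quaternion.star_smul, mul_add, add_mul, mul_smul_comm,
      smul_mul_assoc, mul_neg, neg_mul]
    module
  rw [this, h, one_smul]

theorem momentSp1_transform {e m k : ℕ} (W : Matrix (Fin m) (Fin k) ℤ) (τ : Torus m)
    (lam p : Sp1) (σ : ℍ[ℝ]) (u : QVec e k) :
    momentSp1 σ (transform W τ lam p u)
      = star (p : ℍ[ℝ]) * momentSp1 (star (lam : ℍ[ℝ]) * σ * lam) u * p := by
  simp only [momentSp1, transform, rotate_quadratic _ _ (rotor_sq W τ _)]
  simp only [mul_add, add_mul, Finset.mul_sum, Finset.sum_mul, star_mul, mul_assoc]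

theorem momentTorus_transform {e m k : ℕ} (W : Matrix (Fin m) (Fin k) ℤ) (τ : Torus m)
    (lam p : Sp1) (u : QVec e k) (l : Fin m) :
    momentTorus W (transform W τ lam p u) l = star (p : ℍ[ℝ]) * momentTorus W u l * p := by
  have key : ∀ a b : ℍ[ℝ], star ((lam : ℍ[ℝ]) * a * p) * ((lam : ℍ[ℝ]) * b * p)
      = star (p : ℍ[ℝ]) * (star a * b) * p := by
    intro a b
    calc star ((lam : ℍ[ℝ]) * a * p) * ((lam : ℍ[ℝ]) * b * p)
        = star (p : ℍ[ℝ]) * (star a * (star (lam : ℍ[ℝ]) * lam) * b) * p := by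
          simp only [star_mul, mul_assoc]
      _ = _ := by rw [Sp1.star_mul_self, mul_one]
  simp only [momentTorus, transform, rotate_symplectic _ _ (rotor_sq W τ _), key]
  simp only [Finset.mul_sum, Finset.sum_mul, mul_smul_comm, smul_mul_assoc, mul_sub, sub_mul]

theorem sqNorm_eq {e k : ℕ} (u : QVec e k) : ((sqNorm u : ℝ) : ℍ[ℝ]) = momentSp1 1 u := by
  have h : ∀ a : ℍ[ℝ], star a * 1 * a = ((‖a‖ ^ 2 : ℝ) : ℍ[ℝ]) := by
    intro a
    rw [mul_one, Quaternion.star_mul_self, Quaternion.normSq_eq_norm_mul_self, sq]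
  simp only [momentSp1, h, sqNorm]
  have hs : ∀ (n : ℕ) (f : Fin n → ℝ),
      ((∑ i, f i : ℝ) : ℍ[ℝ]) = ∑ i, ((f i : ℝ) : ℍ[ℝ]) := fun n f =>
    map_sum (algebraMap ℝ ℍ[ℝ]) f Finset.univ
  rw [Quaternion.coe_add, hs, hs]
  simp only [Quaternion.coe_add]

theorem sqNorm_transform {e m k : ℕ} (W : Matrix (Fin m) (Fin k) ℤ) (τ : Torus m)
    (lam p : Sp1) (u : QVec e k) : sqNorm (transform W τ lam p u) = sqNorm u := by
  apply Quaternion.coe_injective (R := ℝ)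
  rw [sqNorm_eq, momentSp1_transform, mul_one, Sp1.star_mul_self, ← sqNorm_eq,
    (Quaternion.coe_commute (sqNorm u) (star (p : ℍ[ℝ]))).symm.eq, mul_assoc,
    Sp1.star_mul_self, mul_one]

/-- If the components of the moment map along `i, j, k` vanish, then so do those along all
imaginary quaternions. -/
theorem momentSp1_eq_zero {e k : ℕ} (u : QVec e k)
    (hi : momentSp1 qI u = 0) (hj : momentSp1 qJ u = 0)
    (hk : momentSp1 qK u = 0) (σ : ℍ[ℝ]) (hσ : σ.re = 0) : momentSp1 σ u = 0 := by
  have hadd : ∀ x y : ℍ[ℝ], momentSp1 (x + y) u = momentSp1 x u + momentSp1 y u := by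
    intro x y
    simp only [momentSp1, mul_add, add_mul, Finset.sum_add_distrib]
    abel
  have hsmul : ∀ (r : ℝ) (x : ℍ[ℝ]), momentSp1 (r • x) u = r • momentSp1 x u := by
    intro r x
    simp only [momentSp1, mul_smul_comm, smul_mul_assoc, Finset.smul_sum, smul_add]
  have hdec : σ = σ.imI • qI + σ.imJ • qJ
      + σ.imK • qK := by
    have hI : qI.re = 0 ∧ qI.imI = 1 ∧ qI.imJ = 0 ∧ qI.imK = 0 := ⟨rfl, rfl, rfl, rfl⟩
    have hJ : qJ.re = 0 ∧ qJ.imI = 0 ∧ qJ.imJ = 1 ∧ qJ.imK = 0 := ⟨rfl, rfl, rfl, rfl⟩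
    have hK : qK.re = 0 ∧ qK.imI = 0 ∧ qK.imJ = 0 ∧ qK.imK = 1 := ⟨rfl, rfl, rfl, rfl⟩
    ext <;> simp [hσ, hI, hJ, hK]
  rw [hdec, hadd, hadd, hsmul, hsmul, hsmul, hi, hj, hk]
  simp

theorem re_conj (lam σ : ℍ[ℝ]) (hσ : σ.re = 0) : (star lam * σ * lam).re = 0 := by
  simp [hσ]
  ring

theorem transform_mem {e m k : ℕ} (W : Matrix (Fin m) (Fin k) ℤ) (τ : Torus m) (lam p : Sp1)
    {u : QVec e k} (hu : u ∈ zeroLevel e W) : transform W τ lam p u ∈ zeroLevel e W := by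
  obtain ⟨h1, hi, hj, hk, ht⟩ := hu
  refine ⟨by rw [sqNorm_transform, h1], ?_, ?_, ?_, fun l => ?_⟩
  · rw [momentSp1_transform, momentSp1_eq_zero u hi hj hk _ (re_conj _ _ rfl)]; simp
  · rw [momentSp1_transform, momentSp1_eq_zero u hi hj hk _ (re_conj _ _ rfl)]; simp
  · rw [momentSp1_transform, momentSp1_eq_zero u hi hj hk _ (re_conj _ _ rfl)]; simp
  · rw [momentTorus_transform, ht l]; simp

end invariance

/-- The group `G = T^m × Sp(1)`. -/
abbrev G (m : ℕ) : Type := Torus m × Sp1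

/-- The group `G̃ = T^m × Sp(1) × U(1)`. -/
abbrev GTilde (m : ℕ) : Type := Torus m × Sp1 × Circle

/-- `G` acts on the zero level by `(τ, λ) • u = A(τ) λ u`. -/
instance actionG {m k : ℕ} (e : ℕ) (W : Matrix (Fin m) (Fin k) ℤ) :
    MulAction (G m) (zeroLevel e W) where
  smul g u := ⟨transform W g.1 g.2 1 u, transform_mem W _ _ _ u.2⟩
  one_smul u := Subtype.ext (transform_one W u.1)
  mul_smul g h u := Subtype.ext <| by
    have := transform_transform W g.1 h.1 g.2 h.2 1 1 u.1
    rw [one_mul] at this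
    exact this.symm

/-- `G̃` acts on the zero level by `(τ, λ, ρ) • u = A(τ) λ u ρ`. -/
instance actionGTilde {m k : ℕ} (e : ℕ) (W : Matrix (Fin m) (Fin k) ℤ) :
    MulAction (GTilde m) (zeroLevel e W) where
  smul g u := ⟨transform W g.1 g.2.1 (circleToSp1 g.2.2) u, transform_mem W _ _ _ u.2⟩
  one_smul u := Subtype.ext <| by
    have := transform_one W u.1
    rw [← map_one circleToSp1] at this
    exact this
  mul_smul g h u := Subtype.ext <| by
    have := transform_transform W g.1 h.1 g.2.1 h.2.1 (circleToSp1 g.2.2) (circleToSp1 h.2.2) u.1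
    rw [← map_mul, mul_comm h.2.2] at this
    exact this.symm

/-- The 3-Sasakian orbifold, as the quotient of the zero level by `G`. -/
abbrev Sasakian {m k : ℕ} (e : ℕ) (W : Matrix (Fin m) (Fin k) ℤ) : Type :=
  MulAction.orbitRel.Quotient (G m) (zeroLevel e W)

/-- The twistor space, as the leaf space (the quotient) of the zero level by `G̃`. -/
abbrev Twistor {m k : ℕ} (e : ℕ) (W : Matrix (Fin m) (Fin k) ℤ) : Type :=
  MulAction.orbitRel.Quotient (GTilde m) (zeroLevel e W)

/-- The right action `[u] ↦ [u p]` of `p ∈ Sp(1)` on the 3-Sasakian orbifold. It factors through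
`SO(3) = Sp(1)/{±1}` and is the action generated by the three characteristic (Reeb) vector
fields; the quotient by `U(1) ⊂ Sp(1)` is the twistor space. -/
def Sasakian.rightMul {m k : ℕ} {e : ℕ} {W : Matrix (Fin m) (Fin k) ℤ} (p : Sp1) :
    Sasakian e W → Sasakian e W :=
  Quotient.map (fun u => ⟨transform W 1 1 p u, transform_mem W _ _ _ u.2⟩) <| by
    rintro a b ⟨g, rfl⟩
    refine ⟨g, Subtype.ext ?_⟩
    change transform W g.1 g.2 1 (transform W 1 1 p b.1)
      = transform W 1 1 p (transform W g.1 g.2 1 b.1)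
    rw [transform_transform, transform_transform]
    simp

/-- The isotropy group at `x` up to the non-effective subgroup: the stabilizer of `x` divided by the
elements that act trivially on `X`, realized as the group of transformations of `X` induced by the
stabilizer. -/
def effIsotropy (Γ : Type*) {X : Type*} [Group Γ] [MulAction Γ X] (x : X) :
    Subgroup (Equiv.Perm X) :=
  (MulAction.stabilizer Γ x).map (MulAction.toPermHom Γ X)

/-- A homeomorphism between two quotients `X/Γ` and `Y/Γ'` respects the orbifold isotropy if
corresponding points have isomorphic (effective) isotropy groups. -/
def RespectsIsotropy {Γ Γ' X Y : Type*} [Group Γ] [Group Γ'] [MulAction Γ X] [MulAction Γ' Y]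
    [TopologicalSpace X] [TopologicalSpace Y]
    (f : MulAction.orbitRel.Quotient Γ X ≃ₜ MulAction.orbitRel.Quotient Γ' Y) : Prop :=
  ∀ (x : X) (y : Y), f (Quotient.mk _ x) = Quotient.mk _ y →
    Nonempty (effIsotropy Γ x ≃* effIsotropy Γ' y)

/-- Equivalence of twistor spaces as topological orbifolds: a homeomorphism that respects the
isotropy groups. Every isomorphism of (complex, contact or smooth) orbifolds induces one. -/
def TwistorEquivalent {m k m' k' : ℕ} (e : ℕ) (W : Matrix (Fin m) (Fin k) ℤ)
    (e' : ℕ) (W' : Matrix (Fin m') (Fin k') ℤ) : Prop :=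
  ∃ f : Twistor e W ≃ₜ Twistor e' W', RespectsIsotropy f

/-- Equivalence of 3-Sasakian orbifolds: a homeomorphism that respects the isotropy groups and
carries the `Sp(1)`-action of one 3-Sasakian structure to that of the other one, up to a
rotation (given by `q`) of the triple of characteristic vector fields. Every isomorphism of
3-Sasakian orbifolds induces one. -/
def SasakianEquivalent {m k m' k' : ℕ} (e : ℕ) (W : Matrix (Fin m) (Fin k) ℤ)
    (e' : ℕ) (W' : Matrix (Fin m') (Fin k') ℤ) : Prop :=
  ∃ f : Sasakian e W ≃ₜ Sasakian e' W', RespectsIsotropy f ∧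
    ∃ q : Sp1, ∀ (p : Sp1) (x : Sasakian e W),
      f (Sasakian.rightMul p x) = Sasakian.rightMul (q⁻¹ * p * q) (f x)

/-- Admissible weight matrices, of size `m × (m + 1)`: all the maximal minors (delete one column) are
nonzero, and so are all the determinants whose rows are `column 1 ± column 2`, ...,
`column 1 ± column (m + 1)`, for every choice of the signs. -/
def Admissible {m : ℕ} (W : Matrix (Fin m) (Fin (m + 1)) ℤ) : Prop :=
  (∀ α : Fin (m + 1), (W.submatrix id α.succAbove).det ≠ 0) ∧
  ∀ s : Fin m → ℤˣ, (Matrix.of fun i l : Fin m => W l 0 + (s i : ℤ) * W l i.succ).det ≠ 0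

end SDE

end

noncomputable section

namespace SDE

open Complex ComplexConjugate

/-! ### The kernel of an admissible weight matrix -/

/-! The two families are separated by the way the orders of the isotropy groups are distributed over
the orbits.

Admissibility says that the kernel of the weight matrix is spanned by a primitive integral vector
`v` with nonzero coordinates and no vanishing sum `∑ ±v_α` (`IsKernelVector`). The image of the
torus in the full torus `U(1)^(m+1)` is then the subgroup `∏ z_α ^ v_α = 1`. In the coordinates `P =
a + bi`, `Q = a - bi` of a pair, the full torus acts by `z⁻¹` on `P` and by `z` on `Q`, the left
factor acts as `SU(2)` and the right circle by scalars. An element of a stabilizer can thus be made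
diagonal (`exists_smul_diagStab`), and the rotors of a stabilizer (`torusIsotropy`) can be counted
as solutions of equations between roots of unity. No pair vanishes on the zero level (`alive`),
since its coordinates span `ℍ` over the reals and `e + m = 3`.

Case `n = 8`, with `s = ∑ |v_α| ≥ 5`: every order is less than `2s` (`ncard_torusIsotropy_lt`),
infinitely many orbits have order at least `s` (`infinite_large_isotropy`), and some order is at
most `2`. The infinite family comes from quadrilaterals with sides proportional to `|v_α|`, which
are flexible, or, if one side is too long for them to exist, from points where the long pair is
separated from the other three.

Case `n = 7`, with kernel vector `w`: quadrilaterals become triangles, which are rigid. Outside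
finitely many orbits (`finite_exceptional`) the order is at most `2`, or at most `|w_β|` for a
coordinate exceeding the sum of the other two (`isotropy_trichotomy`). In the latter situation
another point has order at least `2|w_β|`. Some point has trivial isotropy.

Suppose that a correspondence satisfies `A · |iso u| = B · |iso y|` (`not_proportional`). A point
`u` of order at most `2` gives `B ≤ 2A`. Among the infinitely many orbits of order at least `s`, one
corresponds to a point `y` that is not exceptional. If `|iso y| ≤ 2`, then `As ≤ 2B ≤ 4A`, against
`s ≥ 5`. If `|iso y| ≤ |w_β|`, then the point of order at least `2|w_β|` corresponds to one of order
at least `2s`, which does not exist.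

For twistor spaces the order of `torusIsotropy` is a constant multiple of that of the effective
isotropy. For 3-Sasakian orbifolds one multiplies by the order of the stabilizer of the point in
`U(1) ⊂ Sp(1)` acting on the right, which an equivariant homeomorphism preserves. -/

theorem circle_exp_sum {ι : Type*} (s : Finset ι) (f : ι → ℝ) :
    Circle.exp (∑ i ∈ s, f i) = ∏ i ∈ s, Circle.exp (f i) := by
  classical
  induction s using Finset.induction with
  | empty => simp
  | insert a s ha ih => rw [Finset.sum_insert ha, Finset.prod_insert ha, Circle.exp_add, ih]

theorem zpow_sum_exponents {ι A : Type*} [CommGroup A] (s : Finset ι) (a : A) (f : ι → ℤ) :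
    a ^ (∑ i ∈ s, f i) = ∏ i ∈ s, a ^ f i := by
  classical
  induction s using Finset.induction with
  | empty => simp
  | insert b s hb ih => rw [Finset.sum_insert hb, Finset.prod_insert hb, zpow_add, ih]

/-- `v` is a primitive integral generator of the kernel of `W`, described through the properties
used below: its coordinates satisfy no relation with coefficients `0, ±1` of the relevant kinds, it
spans the real kernel of `W`, and it is the only relation between the rotors of a torus element. -/
structure IsKernelVector {m : ℕ} (W : Matrix (Fin m) (Fin (m + 1)) ℤ) (v : Fin (m + 1) → ℤ) :
    Prop where
  ne_zero : ∀ α, v α ≠ 0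
  signed_sum_ne_zero : ∀ ε : Fin (m + 1) → ℤˣ, ∑ α, (ε α : ℤ) * v α ≠ 0
  ker : ∀ x : Fin (m + 1) → ℝ,
    (∀ l, ∑ α, (W l α : ℝ) * x α = 0) ↔ ∃ c : ℝ, ∀ α, x α = v α * c
  range_rotor : ∀ z : Torus (m + 1), (∃ τ, rotor W τ = z) ↔ ∏ α, z α ^ v α = 1
  primitive : ∃ n : Fin (m + 1) → ℤ, ∑ α, n α * v α = 1

/-- Expansion along the first row of the determinant obtained by putting a second copy of row `l` on
top of `W`. -/
theorem sum_mul_minor_eq_zero {m : ℕ} (W : Matrix (Fin m) (Fin (m + 1)) ℤ) (l : Fin m) :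
    ∑ α : Fin (m + 1), W l α * ((-1) ^ (α : ℕ) * (W.submatrix id α.succAbove).det) = 0 := by
  let A : Matrix (Fin (m + 1)) (Fin (m + 1)) ℤ :=
    fun i j => Fin.cases (motive := fun _ => ℤ) (W l j) (fun i => W i j) i
  have hA : A.det = 0 :=
    Matrix.det_zero_of_row_eq (i := 0) (j := l.succ) (Fin.succ_ne_zero l).symm rfl
  rw [Matrix.det_succ_row_zero] at hA
  rw [← hA]
  refine Finset.sum_congr rfl fun α _ => ?_
  have h1 : A.submatrix Fin.succ α.succAbove = W.submatrix id α.succAbove := rfl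
  have h2 : A 0 α = W l α := rfl
  rw [h1, h2]
  ring

/-- The signed maximal minors lie in the kernel; dividing them by their greatest common divisor
gives a primitive vector, and a Bézout relation records primitivity. -/
theorem exists_primitive_kernel {m : ℕ} (W : Matrix (Fin m) (Fin (m + 1)) ℤ)
    (h : ∀ α : Fin (m + 1), (W.submatrix id α.succAbove).det ≠ 0) :
    ∃ v : Fin (m + 1) → ℤ, (∀ α, v α ≠ 0) ∧ (∀ l, ∑ α, W l α * v α = 0) ∧
      ∃ n : Fin (m + 1) → ℤ, ∑ α, n α * v α = 1 := by
  let v₀ : Fin (m + 1) → ℤ := fun α => (-1) ^ (α : ℕ) * (W.submatrix id α.succAbove).det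
  have hv₀ : ∀ α, v₀ α ≠ 0 := fun α => mul_ne_zero (by simp) (h α)
  obtain ⟨v, hv, hg⟩ := Finset.extract_gcd v₀ (Finset.univ_nonempty)
  have hv' : ∀ α, v₀ α = Finset.univ.gcd v₀ * v α := fun α => hv α (Finset.mem_univ _)
  have hg0 : Finset.univ.gcd v₀ ≠ 0 := fun h0 => hv₀ 0 (by rw [hv' 0, h0, zero_mul])
  refine ⟨v, fun α h0 => hv₀ α (by rw [hv' α, h0, mul_zero]), fun l => ?_, ?_⟩
  · have := sum_mul_minor_eq_zero W l
    change ∑ α, W l α * v₀ α = 0 at this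
    simp_rw [fun α => hv' α] at this
    have h2 : Finset.univ.gcd v₀ * ∑ α, W l α * v α = 0 := by
      rw [← this, Finset.mul_sum]
      exact Finset.sum_congr rfl fun α _ => by ring
    exact (mul_eq_zero.1 h2).resolve_left hg0
  · obtain ⟨n, hn⟩ := Finset.gcd_eq_sum_mul Finset.univ v
    exact ⟨n, by rw [← hg, hn]; exact Finset.sum_congr rfl fun α _ => by ring⟩

/-- The square real matrix obtained by deleting a column. -/
theorem det_real_minor_ne_zero {m : ℕ} (W : Matrix (Fin m) (Fin (m + 1)) ℤ) (α : Fin (m + 1))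
    (h : (W.submatrix id α.succAbove).det ≠ 0) :
    ((W.submatrix id α.succAbove).map (Int.castRingHom ℝ)).det ≠ 0 := by
  rw [← RingHom.mapMatrix_apply, ← RingHom.map_det]
  simpa using h

/-- Subtracting the multiple of `v` that agrees with `x` at `0` leaves a kernel vector supported on
the other columns, where `W` is invertible. -/
theorem real_kernel_iff {m : ℕ} (W : Matrix (Fin m) (Fin (m + 1)) ℤ)
    (h : (W.submatrix id (Fin.succAbove 0)).det ≠ 0) (v : Fin (m + 1) → ℤ)
    (hv : v 0 ≠ 0) (hW : ∀ l, ∑ α, W l α * v α = 0) (x : Fin (m + 1) → ℝ) :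
    (∀ l, ∑ α, (W l α : ℝ) * x α = 0) ↔ ∃ c : ℝ, ∀ α, x α = v α * c := by
  have hWr : ∀ l, ∑ α, (W l α : ℝ) * v α = 0 := fun l => by exact_mod_cast hW l
  have hv' : (v 0 : ℝ) ≠ 0 := by exact_mod_cast hv
  constructor
  · intro hx
    refine ⟨x 0 / v 0, ?_⟩
    have key := Matrix.eq_zero_of_mulVec_eq_zero (det_real_minor_ne_zero W 0 h)
      (v := fun i => x (Fin.succAbove 0 i) - v (Fin.succAbove 0 i) * (x 0 / v 0)) (by
        ext l
        have h1 := hx l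
        have h2 := hWr l
        rw [Fin.sum_univ_succAbove _ 0] at h1 h2
        simp only [Matrix.mulVec, dotProduct, Matrix.map_apply, Matrix.submatrix_apply, id,
          eq_intCast, Pi.zero_apply, mul_sub, Finset.sum_sub_distrib, ← mul_assoc,
          ← Finset.sum_mul]
        rw [eq_neg_of_add_eq_zero_right h1, eq_neg_of_add_eq_zero_right h2]
        field_simp
        ring)
    intro α
    refine Fin.cases ?_ (fun i => ?_) α
    · field_simp
    · have := congrFun key i
      simp only [Fin.zero_succAbove, Pi.zero_apply] at this
      linarith
  · rintro ⟨c, hc⟩ l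
    simp_rw [hc, ← mul_assoc, ← Finset.sum_mul, hWr, zero_mul]

/-- With signs `-(ε 0 * ε i.succ)` in the second admissibility condition, a relation `∑ ε_α v_α = 0`
makes the vector `ε_i v_i` (`i ≥ 1`) annihilate a nonsingular matrix. -/
theorem signed_sum_ne_zero {m : ℕ} (W : Matrix (Fin m) (Fin (m + 1)) ℤ)
    (h : ∀ s : Fin m → ℤˣ, (Matrix.of fun i l : Fin m => W l 0 + (s i : ℤ) * W l i.succ).det ≠ 0)
    (v : Fin (m + 1) → ℤ) (hv : ∀ α, v α ≠ 0) (hW : ∀ l, ∑ α, W l α * v α = 0)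
    (ε : Fin (m + 1) → ℤˣ) : ∑ α, (ε α : ℤ) * v α ≠ 0 := by
  intro h0
  have hsq : ∀ e : ℤˣ, (e : ℤ) * e = 1 := fun e => by
    rw [← Units.val_mul, Int.units_mul_self, Units.val_one]
  have key := Matrix.eq_zero_of_vecMul_eq_zero (h fun i => -(ε 0 * ε i.succ))
    (v := fun i => (ε i.succ : ℤ) * v i.succ) (by
      ext l
      have h1 := hW l
      rw [Fin.sum_univ_succ] at h1 h0
      simp only [Matrix.vecMul, dotProduct, Matrix.of_apply, Units.val_neg, Units.val_mul,
        Pi.zero_apply]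
      have h2 : ∀ i : Fin m, (ε i.succ : ℤ) * v i.succ *
          (W l 0 + -(ε 0 * ε i.succ) * W l i.succ)
          = (ε i.succ : ℤ) * v i.succ * W l 0 - ε 0 * (W l i.succ * v i.succ) := fun i => by
        linear_combination (-(v i.succ * ε 0 * W l i.succ)) * hsq (ε i.succ)
      simp_rw [h2]
      rw [Finset.sum_sub_distrib, ← Finset.sum_mul, ← Finset.mul_sum,
        eq_neg_of_add_eq_zero_right h1, eq_neg_of_add_eq_zero_right h0]
      ring)
  have hall : ∀ i : Fin m, v i.succ = 0 := fun i => by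
    have := congrFun key i
    simpa using this
  rw [Fin.sum_univ_succ] at h0
  simp [hall] at h0
  exact hv 0 h0

/-- Primitivity of `v` makes the subgroup `∏ z_α ^ v_α = 1` connected: its elements have angles
exactly orthogonal to `v`, hence in the real row space of `W`. -/
theorem range_rotor_iff {m : ℕ} (W : Matrix (Fin m) (Fin (m + 1)) ℤ)
    (h : (W.submatrix id (Fin.succAbove 0)).det ≠ 0) (v : Fin (m + 1) → ℤ)
    (hv : v 0 ≠ 0) (hW : ∀ l, ∑ α, W l α * v α = 0)
    (n : Fin (m + 1) → ℤ) (hn : ∑ α, n α * v α = 1) (z : Torus (m + 1)) :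
    (∃ τ, rotor W τ = z) ↔ ∏ α, z α ^ v α = 1 := by
  constructor
  · rintro ⟨τ, rfl⟩
    simp only [rotor, ← Finset.prod_zpow, ← zpow_mul]
    rw [Finset.prod_comm]
    refine Finset.prod_eq_one fun l _ => ?_
    rw [← zpow_sum_exponents, hW l, zpow_zero]
  · intro hz
    have hexp : ∀ w : Circle, ∃ t : ℝ, Circle.exp t = w := fun w => ⟨_, Circle.exp_arg w⟩
    choose θ hθ using fun α => hexp (z α)
    have hsum : Circle.exp (∑ α, v α * θ α) = 1 := by
      rw [← hz, circle_exp_sum]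
      refine Finset.prod_congr rfl fun α _ => ?_
      rw [← hθ α, ← Circle.exp_zsmul, zsmul_eq_mul]
    obtain ⟨N, hN⟩ := Circle.exp_eq_one.1 hsum
    -- The angles satisfy `∑ v_α θ_α = 2πN` only. Since `∑ n_α v_α = 1`, subtracting `2πN n_α` makes
    -- the sum vanish without changing the circle elements.
    let θ' : Fin (m + 1) → ℝ := fun α => θ α - N * n α * (2 * Real.pi)
    have hθ' : ∀ α, Circle.exp (θ' α) = z α := fun α => by
      have : Circle.exp ((N * n α : ℤ) * (2 * Real.pi)) = 1 := Circle.exp_eq_one.2 ⟨_, rfl⟩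
      push_cast at this
      simp only [θ']
      rw [Circle.exp_sub, this, div_one, hθ]
    have horth : ∑ α, (v α : ℝ) * θ' α = 0 := by
      have hn' : ∑ α, (n α : ℝ) * v α = 1 := by exact_mod_cast hn
      calc ∑ α, (v α : ℝ) * θ' α
          = ∑ α, (v α : ℝ) * θ α - N * (2 * Real.pi) * ∑ α, (n α : ℝ) * v α := by
            rw [Finset.mul_sum, ← Finset.sum_sub_distrib]
            exact Finset.sum_congr rfl fun α _ => by simp only [θ']; ring
        _ = 0 := by rw [hn', hN]; ring
    let A := (W.submatrix id (Fin.succAbove 0)).map (Int.castRingHom ℝ)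
    have hA : IsUnit A.det := (det_real_minor_ne_zero W 0 h).isUnit
    let t : Fin m → ℝ := Matrix.vecMul (fun i => θ' i.succ) A⁻¹
    have ht : ∀ i : Fin m, ∑ l, (W l i.succ : ℝ) * t l = θ' i.succ := fun i => by
      have h1 : Matrix.vecMul t A = fun i => θ' i.succ := by
        simp only [t]
        rw [Matrix.vecMul_vecMul, Matrix.nonsing_inv_mul _ hA, Matrix.vecMul_one]
      have := congrFun h1 i
      simp only [Matrix.vecMul, dotProduct, A, Matrix.map_apply, Matrix.submatrix_apply, id,
        eq_intCast, Fin.zero_succAbove] at this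
      rw [← this]
      exact Finset.sum_congr rfl fun l _ => mul_comm _ _
    -- The system was solved in all columns but the first; orthogonality to `v` and `v 0 ≠ 0` give
    -- the first one.
    have ht0 : ∑ l, (W l 0 : ℝ) * t l = θ' 0 := by
      have hv' : (v 0 : ℝ) ≠ 0 := by exact_mod_cast hv
      have h1 : ∑ α, (v α : ℝ) * ∑ l, (W l α : ℝ) * t l = 0 := by
        simp_rw [Finset.mul_sum]
        rw [Finset.sum_comm]
        refine Finset.sum_eq_zero fun l _ => ?_
        have h2 : ∑ α, (W l α : ℝ) * v α = 0 := by exact_mod_cast hW l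
        calc ∑ α, (v α : ℝ) * ((W l α : ℝ) * t l) = (∑ α, (W l α : ℝ) * v α) * t l := by
              rw [Finset.sum_mul]
              exact Finset.sum_congr rfl fun α _ => by ring
          _ = 0 := by rw [h2, zero_mul]
      rw [Fin.sum_univ_succ] at h1 horth
      simp_rw [ht] at h1
      exact mul_left_cancel₀ hv' (by linarith)
    refine ⟨fun l => Circle.exp (t l), funext fun α => ?_⟩
    simp only [rotor, ← Circle.exp_zsmul]
    rw [← circle_exp_sum, ← hθ' α]
    congr 1
    simp only [zsmul_eq_mul]
    exact Fin.cases ht0 ht α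

theorem Admissible.exists_kernelVector {m : ℕ} {W : Matrix (Fin m) (Fin (m + 1)) ℤ}
    (h : Admissible W) : ∃ v, IsKernelVector W v := by
  obtain ⟨v, hv, hW, n, hn⟩ := exists_primitive_kernel W h.1
  exact ⟨v, hv, signed_sum_ne_zero W h.2 v hv hW, real_kernel_iff W (h.1 0) v (hv 0) hW,
    range_rotor_iff W (h.1 0) v (hv 0) hW n hn, n, hn⟩

/-! ### Complex coordinates -/

/-- The first complex coordinate of `t = c₁ + j c₂`. -/
def cOne (t : ℍ[ℝ]) : ℂ := ⟨t.re, t.imI⟩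

/-- The second complex coordinate of `t = c₁ + j c₂`. -/
def cTwo (t : ℍ[ℝ]) : ℂ := ⟨t.imJ, -t.imK⟩

/-- The quaternion `c₁ + j c₂`. -/
def ofPair (c₁ c₂ : ℂ) : ℍ[ℝ] := ⟨c₁.re, c₁.im, c₂.re, -c₂.im⟩

@[simp] theorem cOne_ofPair (a b : ℂ) : cOne (ofPair a b) = a := rfl

@[simp] theorem cTwo_ofPair (a b : ℂ) : cTwo (ofPair a b) = b := by
  apply Complex.ext <;> simp [cTwo, ofPair]

theorem quaternion_ext {s t : ℍ[ℝ]} (h₁ : cOne s = cOne t) (h₂ : cTwo s = cTwo t) : s = t := by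
  have a := congrArg re h₁
  have b := congrArg im h₁
  have c := congrArg re h₂
  have d := congrArg im h₂
  simp only [cOne, cTwo, neg_inj] at a b c d
  exact QuaternionAlgebra.ext a b c d

@[simp] theorem cOne_add (s t : ℍ[ℝ]) : cOne (s + t) = cOne s + cOne t := by
  apply Complex.ext <;> simp [cOne]

@[simp] theorem cTwo_add (s t : ℍ[ℝ]) : cTwo (s + t) = cTwo s + cTwo t := by
  apply Complex.ext <;> simp [cTwo]; ring

@[simp] theorem cOne_neg (s : ℍ[ℝ]) : cOne (-s) = -cOne s := by
  apply Complex.ext <;> simp [cOne]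

@[simp] theorem cTwo_neg (s : ℍ[ℝ]) : cTwo (-s) = -cTwo s := by
  apply Complex.ext <;> simp [cTwo]

@[simp] theorem cOne_smul (c : ℝ) (s : ℍ[ℝ]) : cOne (c • s) = c * cOne s := by
  apply Complex.ext <;> simp [cOne]

@[simp] theorem cTwo_smul (c : ℝ) (s : ℍ[ℝ]) : cTwo (c • s) = c * cTwo s := by
  apply Complex.ext <;> simp [cTwo]

theorem cOne_mul (s t : ℍ[ℝ]) : cOne (s * t) = cOne s * cOne t - conj (cTwo s) * cTwo t := by
  apply Complex.ext <;> simp [cOne, cTwo] <;> ring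

theorem cTwo_mul (s t : ℍ[ℝ]) : cTwo (s * t) = cTwo s * cOne t + conj (cOne s) * cTwo t := by
  apply Complex.ext <;> simp [cOne, cTwo] <;> ring

@[simp] theorem cOne_coe (w : ℂ) : cOne (w : ℍ[ℝ]) = w := by
  apply Complex.ext <;> simp [cOne]

@[simp] theorem cTwo_coe (w : ℂ) : cTwo (w : ℍ[ℝ]) = 0 := by
  apply Complex.ext <;> simp [cTwo]

@[simp] theorem coe_circleToSp1 (ρ : Circle) : (circleToSp1 ρ : ℍ[ℝ]) = ((ρ : ℂ) : ℍ[ℝ]) := rfl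

theorem norm_sq_eq (t : ℍ[ℝ]) : ‖t‖ ^ 2 = normSq (cOne t) + normSq (cTwo t) := by
  rw [sq, ← Quaternion.normSq_eq_norm_mul_self, Quaternion.normSq_def']
  simp [cOne, cTwo, normSq_apply]
  ring

section coordinates

variable {e k : ℕ}

/-- The first complex coordinates of the single quaternionic coordinates. -/
def U₁ (u : QVec e k) (i : Fin e) : ℂ := cOne (u.1 i)

/-- The second complex coordinates of the single quaternionic coordinates. -/
def U₂ (u : QVec e k) (i : Fin e) : ℂ := cTwo (u.1 i)

/-- The first complex coordinate of `a + b i`. -/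
def P₁ (u : QVec e k) (α : Fin k) : ℂ := cOne (u.2 α).1 + I * cOne (u.2 α).2

/-- The second complex coordinate of `a + b i`. -/
def P₂ (u : QVec e k) (α : Fin k) : ℂ := cTwo (u.2 α).1 + I * cTwo (u.2 α).2

/-- The first complex coordinate of `a - b i`. -/
def Q₁ (u : QVec e k) (α : Fin k) : ℂ := cOne (u.2 α).1 - I * cOne (u.2 α).2

/-- The second complex coordinate of `a - b i`. -/
def Q₂ (u : QVec e k) (α : Fin k) : ℂ := cTwo (u.2 α).1 - I * cTwo (u.2 α).2

theorem qvec_ext {u u' : QVec e k} (h₁ : ∀ i, U₁ u i = U₁ u' i) (h₂ : ∀ i, U₂ u i = U₂ u' i)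
    (h₃ : ∀ α, P₁ u α = P₁ u' α) (h₄ : ∀ α, P₂ u α = P₂ u' α) (h₅ : ∀ α, Q₁ u α = Q₁ u' α)
    (h₆ : ∀ α, Q₂ u α = Q₂ u' α) : u = u' := by
  have hI : (2 * I : ℂ) ≠ 0 := by simp
  refine Prod.ext (funext fun i => quaternion_ext (h₁ i) (h₂ i)) (funext fun α => ?_)
  have h3 := h₃ α
  have h4 := h₄ α
  have h5 := h₅ α
  have h6 := h₆ α
  simp only [P₁, P₂, Q₁, Q₂] at h3 h4 h5 h6
  refine Prod.ext (quaternion_ext ?_ ?_) (quaternion_ext ?_ ?_)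
  · linear_combination (h3 + h5) / 2
  · linear_combination (h4 + h6) / 2
  · exact mul_left_cancel₀ hI (by linear_combination h3 - h5)
  · exact mul_left_cancel₀ hI (by linear_combination h4 - h6)

/-- The vector with given complex coordinates. -/
def ofCoords (x₁ x₂ : Fin e → ℂ) (p₁ p₂ q₁ q₂ : Fin k → ℂ) : QVec e k :=
  (fun i => ofPair (x₁ i) (x₂ i), fun α =>
    (ofPair ((p₁ α + q₁ α) / 2) ((p₂ α + q₂ α) / 2),
      ofPair ((q₁ α - p₁ α) * I / 2) ((q₂ α - p₂ α) * I / 2)))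

section ofCoords

variable (x₁ x₂ : Fin e → ℂ) (p₁ p₂ q₁ q₂ : Fin k → ℂ)

@[simp] theorem U₁_ofCoords : U₁ (ofCoords x₁ x₂ p₁ p₂ q₁ q₂) = x₁ := rfl

@[simp] theorem U₂_ofCoords : U₂ (ofCoords x₁ x₂ p₁ p₂ q₁ q₂) = x₂ := by
  funext i; simp [U₂, ofCoords]

@[simp] theorem P₁_ofCoords : P₁ (ofCoords x₁ x₂ p₁ p₂ q₁ q₂) = p₁ := by
  funext α; simp only [P₁, ofCoords, cOne_ofPair]
  linear_combination ((q₁ α - p₁ α) / 2) * I_mul_I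

@[simp] theorem P₂_ofCoords : P₂ (ofCoords x₁ x₂ p₁ p₂ q₁ q₂) = p₂ := by
  funext α; simp only [P₂, ofCoords, cTwo_ofPair]
  linear_combination ((q₂ α - p₂ α) / 2) * I_mul_I

@[simp] theorem Q₁_ofCoords : Q₁ (ofCoords x₁ x₂ p₁ p₂ q₁ q₂) = q₁ := by
  funext α; simp only [Q₁, ofCoords, cOne_ofPair]
  linear_combination (-(q₁ α - p₁ α) / 2) * I_mul_I

@[simp] theorem Q₂_ofCoords : Q₂ (ofCoords x₁ x₂ p₁ p₂ q₁ q₂) = q₂ := by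
  funext α; simp only [Q₂, ofCoords, cTwo_ofPair]
  linear_combination (-(q₂ α - p₂ α) / 2) * I_mul_I

end ofCoords

/-- The action of the full torus `U(1)^k` and of `Sp(1) × Sp(1)`. -/
def act (z : Torus k) (lam p : Sp1) (u : QVec e k) : QVec e k := transform 1 z lam p u

theorem rotor_one_matrix (z : Torus k) (α : Fin k) : rotor 1 z α = z α := by
  rw [rotor, Finset.prod_eq_single α]
  · simp
  · intro b _ hb; simp [Matrix.one_apply_ne hb]
  · simp

/-- The weight matrix enters the action only through the rotors, so everything can be computed in
the full torus. -/
theorem transform_eq_act {m : ℕ} (W : Matrix (Fin m) (Fin k) ℤ) (τ : Torus m) (lam p : Sp1)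
    (u : QVec e k) : transform W τ lam p u = act (rotor W τ) lam p u := by
  simp only [act, transform, rotor_one_matrix]

theorem act_act (z z' : Torus k) (lam lam' p p' : Sp1) (u : QVec e k) :
    act z lam p (act z' lam' p' u) = act (z * z') (lam * lam') (p' * p) u :=
  transform_transform _ _ _ _ _ _ _ _

theorem act_one (u : QVec e k) : act 1 1 1 u = u := transform_one _ _

section actCoords

variable (z : Torus k) (lam : Sp1) (ρ : Circle) (u : QVec e k)

/-- Writing a quaternion as `c₁ + j c₂` turns left multiplication into an `SU(2)` matrix on `(c₁,
c₂)` and right multiplication by the circle into a scalar. On `P` and `Q` the rotation of a pair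
moreover has the eigenvalues `z⁻¹` and `z`. -/
theorem U₁_act (i : Fin e) : U₁ (act z lam (circleToSp1 ρ) u) i =
    (cOne lam * U₁ u i - conj (cTwo lam) * U₂ u i) * ρ := by
  simp [U₁, U₂, act, transform, cOne_mul, cTwo_mul]

theorem U₂_act (i : Fin e) : U₂ (act z lam (circleToSp1 ρ) u) i =
    (cTwo lam * U₁ u i + conj (cOne lam) * U₂ u i) * ρ := by
  simp [U₁, U₂, act, transform, cOne_mul, cTwo_mul]

theorem circle_eq (w : Circle) : (w : ℂ) = (w : ℂ).re + (w : ℂ).im * I := (re_add_im _).symm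

theorem circle_inv_eq (w : Circle) : ((w⁻¹ : Circle) : ℂ) = (w : ℂ).re - (w : ℂ).im * I := by
  rw [Circle.coe_inv_eq_conj]
  apply Complex.ext <;> simp

theorem P₁_act (α : Fin k) : P₁ (act z lam (circleToSp1 ρ) u) α =
    (cOne lam * P₁ u α - conj (cTwo lam) * P₂ u α) * ((z α)⁻¹ : Circle) * ρ := by
  rw [circle_inv_eq]
  simp only [P₁, P₂, act, transform, rotor_one_matrix, cOne_add, cOne_smul,
    cOne_neg, cOne_mul, cTwo_mul, coe_circleToSp1, cOne_coe, cTwo_coe, mul_zero, sub_zero]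
  linear_combination ((z α : ℂ).im * (cOne lam * cOne (u.2 α).2
    - conj (cTwo lam) * cTwo (u.2 α).2) * ρ) * I_mul_I

theorem P₂_act (α : Fin k) : P₂ (act z lam (circleToSp1 ρ) u) α =
    (cTwo lam * P₁ u α + conj (cOne lam) * P₂ u α) * ((z α)⁻¹ : Circle) * ρ := by
  rw [circle_inv_eq]
  simp only [P₁, P₂, act, transform, rotor_one_matrix, cTwo_add, cTwo_smul,
    cTwo_neg, cOne_mul, cTwo_mul, coe_circleToSp1, cOne_coe, cTwo_coe, mul_zero,
    add_zero]
  linear_combination ((z α : ℂ).im * (cTwo lam * cOne (u.2 α).2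
    + conj (cOne lam) * cTwo (u.2 α).2) * ρ) * I_mul_I

theorem Q₁_act (α : Fin k) : Q₁ (act z lam (circleToSp1 ρ) u) α =
    (cOne lam * Q₁ u α - conj (cTwo lam) * Q₂ u α) * z α * ρ := by
  rw [circle_eq (z α)]
  simp only [Q₁, Q₂, act, transform, rotor_one_matrix, cOne_add, cOne_smul,
    cOne_neg, cOne_mul, cTwo_mul, coe_circleToSp1, cOne_coe, cTwo_coe, mul_zero, sub_zero]
  linear_combination ((z α : ℂ).im * (cOne lam * cOne (u.2 α).2
    - conj (cTwo lam) * cTwo (u.2 α).2) * ρ) * I_mul_I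

theorem Q₂_act (α : Fin k) : Q₂ (act z lam (circleToSp1 ρ) u) α =
    (cTwo lam * Q₁ u α + conj (cOne lam) * Q₂ u α) * z α * ρ := by
  rw [circle_eq (z α)]
  simp only [Q₁, Q₂, act, transform, rotor_one_matrix, cTwo_add, cTwo_smul,
    cTwo_neg, cOne_mul, cTwo_mul, coe_circleToSp1, cOne_coe, cTwo_coe, mul_zero,
    add_zero]
  linear_combination ((z α : ℂ).im * (cTwo lam * cOne (u.2 α).2
    + conj (cOne lam) * cTwo (u.2 α).2) * ρ) * I_mul_I

end actCoords

/-! ### The zero level in complex coordinates -/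

/-- The equations of the zero level in complex coordinates. The real number `r` and the complex
number `d` are the components of the common value of `Im (ā_α b_α) / v_α`. -/
structure Level (v : Fin k → ℤ) (r : ℝ) (d : ℂ) (u : QVec e k) : Prop where
  norm₁ : ∑ i, 2 * normSq (U₁ u i) + ∑ α, (normSq (P₁ u α) + normSq (Q₁ u α)) = 1
  norm₂ : ∑ i, 2 * normSq (U₂ u i) + ∑ α, (normSq (P₂ u α) + normSq (Q₂ u α)) = 1
  herm : ∑ i, 2 * (U₁ u i * conj (U₂ u i))
    + ∑ α, (P₁ u α * conj (P₂ u α) + Q₁ u α * conj (Q₂ u α)) = 0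
  quad₁ : ∑ i, U₁ u i ^ 2 + ∑ α, P₁ u α * Q₁ u α = 0
  quad₂ : ∑ i, U₂ u i ^ 2 + ∑ α, P₂ u α * Q₂ u α = 0
  quad₁₂ : ∑ i, 2 * (U₁ u i * U₂ u i) + ∑ α, (P₁ u α * Q₂ u α + P₂ u α * Q₁ u α) = 0
  torus : ∀ α, normSq (Q₁ u α) + normSq (Q₂ u α) - normSq (P₁ u α) - normSq (P₂ u α) = v α * r
  torus' : ∀ α, P₁ u α * Q₂ u α - P₂ u α * Q₁ u α = v α * d

/-- The sum of the values of a function at all quaternionic coordinates. -/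
def total {A : Type*} [AddCommMonoid A] (F : ℍ[ℝ] → A) (u : QVec e k) : A :=
  ∑ i, F (u.1 i) + ∑ α, (F (u.2 α).1 + F (u.2 α).2)

theorem map_total {A B : Type*} [AddCommMonoid A] [AddCommMonoid B] (g : A →+ B) (F : ℍ[ℝ] → A)
    (u : QVec e k) : g (total F u) = total (fun t => g (F t)) u := by
  simp [total, map_sum]

theorem total_add {A : Type*} [AddCommMonoid A] (F F' : ℍ[ℝ] → A) (u : QVec e k) :
    total (fun t => F t + F' t) u = total F u + total F' u := by
  simp only [total, Finset.sum_add_distrib]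
  abel

theorem total_smul (c : ℝ) (F : ℍ[ℝ] → ℝ) (u : QVec e k) :
    total (fun t => c * F t) u = c * total F u := by
  simp only [total, Finset.mul_sum, mul_add]

theorem total_zero {A : Type*} [AddCommMonoid A] (u : QVec e k) :
    total (fun _ => (0 : A)) u = 0 := by
  simp [total]

theorem quaternion_eq_zero_iff (t : ℍ[ℝ]) :
    t = 0 ↔ t.re = 0 ∧ t.imI = 0 ∧ t.imJ = 0 ∧ t.imK = 0 :=
  ⟨fun h => h ▸ ⟨rfl, rfl, rfl, rfl⟩, fun ⟨a, b, c, d⟩ => QuaternionAlgebra.ext a b c d⟩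

theorem total_quaternion_eq_zero_iff (F : ℍ[ℝ] → ℍ[ℝ]) (u : QVec e k) :
    total F u = 0 ↔ total (fun t => (F t).re) u = 0 ∧ total (fun t => (F t).imI) u = 0 ∧
      total (fun t => (F t).imJ) u = 0 ∧ total (fun t => (F t).imK) u = 0 := by
  have h1 : (total F u).re = total (fun t => (F t).re) u :=
    map_total (AddMonoidHom.mk' (fun t : ℍ[ℝ] => t.re) fun _ _ => rfl) F u
  have h2 : (total F u).imI = total (fun t => (F t).imI) u :=
    map_total (AddMonoidHom.mk' (fun t : ℍ[ℝ] => t.imI) fun _ _ => rfl) F u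
  have h3 : (total F u).imJ = total (fun t => (F t).imJ) u :=
    map_total (AddMonoidHom.mk' (fun t : ℍ[ℝ] => t.imJ) fun _ _ => rfl) F u
  have h4 : (total F u).imK = total (fun t => (F t).imK) u :=
    map_total (AddMonoidHom.mk' (fun t : ℍ[ℝ] => t.imK) fun _ _ => rfl) F u
  rw [quaternion_eq_zero_iff, ← h1, ← h2, ← h3, ← h4]

theorem total_complex_eq_zero_iff (F : ℍ[ℝ] → ℂ) (u : QVec e k) :
    total F u = 0 ↔ total (fun t => (F t).re) u = 0 ∧ total (fun t => (F t).im) u = 0 := by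
  rw [Complex.ext_iff]
  have h1 := map_total reAddGroupHom F u
  have h2 := map_total imAddGroupHom F u
  simp only [coe_reAddGroupHom, coe_imAddGroupHom] at h1 h2
  rw [h1, h2]
  simp

/-- The nine imaginary components of the three moment maps are linear combinations of nine real
expressions, and the combinations can be inverted. -/
theorem moment_eq_zero_iff (u : QVec e k) :
    (momentSp1 qI u = 0 ∧ momentSp1 qJ u = 0 ∧ momentSp1 qK u = 0) ↔
      total (fun t => normSq (cOne t)) u = total (fun t => normSq (cTwo t)) u ∧
      total (fun t => cOne t * cTwo t) u = 0 ∧ total (fun t => cOne t * conj (cTwo t)) u = 0 ∧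
      total (fun t => cOne t ^ 2) u = 0 ∧ total (fun t => cTwo t ^ 2) u = 0 := by
  have hm : ∀ σ, momentSp1 σ u = total (fun t => star t * σ * t) u := fun σ => rfl
  simp only [hm, total_quaternion_eq_zero_iff, total_complex_eq_zero_iff]
  have lin : ∀ (c₁ c₂ : ℝ) (F G H : ℍ[ℝ] → ℝ), (∀ t, F t = c₁ * G t + c₂ * H t) →
      total F u = c₁ * total G u + c₂ * total H u := fun c₁ c₂ F G H h => by
    rw [← total_smul, ← total_smul, ← total_add]
    exact congrArg (fun K => total K u) (funext h)
  have re0 : ∀ σ : ℍ[ℝ], σ.re = 0 → total (fun t => (star t * σ * t).re) u = 0 := fun σ hσ =>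
    (congrArg (fun K => total K u) (funext fun t => re_conj t σ hσ)).trans (total_zero u)
  have hI : qI.re = 0 ∧ qI.imI = 1 ∧ qI.imJ = 0 ∧ qI.imK = 0 := ⟨rfl, rfl, rfl, rfl⟩
  have hJ : qJ.re = 0 ∧ qJ.imI = 0 ∧ qJ.imJ = 1 ∧ qJ.imK = 0 := ⟨rfl, rfl, rfl, rfl⟩
  have hK : qK.re = 0 ∧ qK.imI = 0 ∧ qK.imJ = 0 ∧ qK.imK = 1 := ⟨rfl, rfl, rfl, rfl⟩
  rw [re0 qI rfl, re0 qJ rfl, re0 qK rfl,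
    lin 1 (-1) (fun t => (star t * qI * t).imI) (fun t => normSq (cOne t))
      (fun t => normSq (cTwo t)) (fun t => by simp [hI, cOne, cTwo, normSq_apply]; ring),
    lin 2 0 (fun t => (star t * qI * t).imJ) (fun t => (cOne t * cTwo t).im) (fun _ => 0)
      (fun t => by simp [hI, cOne, cTwo]; ring),
    lin 2 0 (fun t => (star t * qI * t).imK) (fun t => (cOne t * cTwo t).re) (fun _ => 0)
      (fun t => by simp [hI, cOne, cTwo]; ring),
    lin 2 0 (fun t => (star t * qJ * t).imI) (fun t => (cOne t * conj (cTwo t)).im) (fun _ => 0)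
      (fun t => by simp [hJ, cOne, cTwo]; ring),
    lin 1 1 (fun t => (star t * qJ * t).imJ) (fun t => (cOne t ^ 2).re) (fun t => (cTwo t ^ 2).re)
      (fun t => by simp [hJ, cOne, cTwo, sq]; ring),
    lin (-1) (-1) (fun t => (star t * qJ * t).imK) (fun t => (cOne t ^ 2).im)
      (fun t => (cTwo t ^ 2).im) (fun t => by simp [hJ, cOne, cTwo, sq]; ring),
    lin (-2) 0 (fun t => (star t * qK * t).imI) (fun t => (cOne t * conj (cTwo t)).re) (fun _ => 0)
      (fun t => by simp [hK, cOne, cTwo]; ring),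
    lin 1 (-1) (fun t => (star t * qK * t).imJ) (fun t => (cOne t ^ 2).im)
      (fun t => (cTwo t ^ 2).im) (fun t => by simp [hK, cOne, cTwo, sq]; ring),
    lin 1 (-1) (fun t => (star t * qK * t).imK) (fun t => (cOne t ^ 2).re)
      (fun t => (cTwo t ^ 2).re) (fun t => by simp [hK, cOne, cTwo, sq]; ring), total_zero]
  constructor
  · rintro ⟨⟨-, h1, h2, h3⟩, ⟨-, h4, h5, h6⟩, ⟨-, h7, h8, h9⟩⟩
    refine ⟨?_, ⟨?_, ?_⟩, ⟨?_, ?_⟩, ⟨?_, ?_⟩, ⟨?_, ?_⟩⟩ <;> linarith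
  · rintro ⟨h1, ⟨h2, h3⟩, ⟨h4, h5⟩, ⟨h6, h7⟩, ⟨h8, h9⟩⟩
    refine ⟨⟨rfl, ?_, ?_, ?_⟩, ⟨rfl, ?_, ?_, ?_⟩, ⟨rfl, ?_, ?_, ?_⟩⟩ <;> linarith

theorem sqNorm_eq_total (u : QVec e k) :
    sqNorm u = total (fun t => normSq (cOne t)) u + total (fun t => normSq (cTwo t)) u := by
  rw [← total_add]
  simp only [sqNorm, total, norm_sq_eq]

theorem normSq_add_sub (a b : ℂ) :
    normSq (a + I * b) + normSq (a - I * b) = 2 * (normSq a + normSq b) := by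
  simp [normSq_apply]; ring

theorem two_mul_total_normSq_cOne (u : QVec e k) : 2 * total (fun t => normSq (cOne t)) u =
    ∑ i, 2 * normSq (U₁ u i) + ∑ α, (normSq (P₁ u α) + normSq (Q₁ u α)) := by
  simp only [total, P₁, Q₁, U₁, normSq_add_sub, mul_add, Finset.mul_sum]

theorem two_mul_total_normSq_cTwo (u : QVec e k) : 2 * total (fun t => normSq (cTwo t)) u =
    ∑ i, 2 * normSq (U₂ u i) + ∑ α, (normSq (P₂ u α) + normSq (Q₂ u α)) := by
  simp only [total, P₂, Q₂, U₂, normSq_add_sub, mul_add, Finset.mul_sum]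

theorem two_mul_total_herm (u : QVec e k) : 2 * total (fun t => cOne t * conj (cTwo t)) u =
    ∑ i, 2 * (U₁ u i * conj (U₂ u i))
      + ∑ α, (P₁ u α * conj (P₂ u α) + Q₁ u α * conj (Q₂ u α)) := by
  simp only [total, mul_add, Finset.mul_sum, U₁, U₂]
  congr 1
  refine Finset.sum_congr rfl fun α _ => ?_
  simp only [P₁, P₂, Q₁, Q₂, map_add, map_sub, map_mul, conj_I]
  linear_combination (2 * cOne (u.2 α).2 * conj (cTwo (u.2 α).2)) * I_mul_I

theorem two_mul_total_mixed (u : QVec e k) : 2 * total (fun t => cOne t * cTwo t) u =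
    ∑ i, 2 * (U₁ u i * U₂ u i) + ∑ α, (P₁ u α * Q₂ u α + P₂ u α * Q₁ u α) := by
  simp only [total, mul_add, Finset.mul_sum, U₁, U₂]
  congr 1
  refine Finset.sum_congr rfl fun α _ => ?_
  simp only [P₁, P₂, Q₁, Q₂]
  linear_combination (2 * cOne (u.2 α).2 * cTwo (u.2 α).2) * I_mul_I

theorem total_sq_cOne (u : QVec e k) : total (fun t => cOne t ^ 2) u =
    ∑ i, U₁ u i ^ 2 + ∑ α, P₁ u α * Q₁ u α := by
  simp only [total, U₁]
  congr 1
  refine Finset.sum_congr rfl fun α _ => ?_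
  simp only [P₁, Q₁]
  linear_combination (cOne (u.2 α).2 ^ 2) * I_mul_I

theorem total_sq_cTwo (u : QVec e k) : total (fun t => cTwo t ^ 2) u =
    ∑ i, U₂ u i ^ 2 + ∑ α, P₂ u α * Q₂ u α := by
  simp only [total, U₂]
  congr 1
  refine Finset.sum_congr rfl fun α _ => ?_
  simp only [P₂, Q₂]
  linear_combination (cTwo (u.2 α).2 ^ 2) * I_mul_I

end coordinates

section level

/-- The imaginary quaternion `ā b - b̄ a` attached to a pair. -/
def pairMoment (x : ℍ[ℝ] × ℍ[ℝ]) : ℍ[ℝ] := star x.1 * x.2 - star x.2 * x.1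

theorem pairMoment_re (x : ℍ[ℝ] × ℍ[ℝ]) : (pairMoment x).re = 0 := by
  simp [pairMoment]; ring

theorem normSq_sub_eq_pairMoment {e k : ℕ} (u : QVec e k) (α : Fin k) :
    normSq (Q₁ u α) + normSq (Q₂ u α) - normSq (P₁ u α) - normSq (P₂ u α)
      = 2 * (pairMoment (u.2 α)).imI := by
  simp [pairMoment, P₁, P₂, Q₁, Q₂, normSq_apply, cOne, cTwo]; ring

theorem det_eq_pairMoment {e k : ℕ} (u : QVec e k) (α : Fin k) :
    P₁ u α * Q₂ u α - P₂ u α * Q₁ u α = -I * cTwo (pairMoment (u.2 α)) := by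
  apply Complex.ext <;> simp [pairMoment, P₁, P₂, Q₁, Q₂, cOne, cTwo] <;> ring

/-- Each imaginary component of `ā_α b_α - b̄_α a_α`, as a vector indexed by `α`, lies in the real
kernel of `W`, hence is a multiple of `v`; `r` and `d` collect the three multiples. -/
theorem momentTorus_eq_zero_iff {e m : ℕ} {W : Matrix (Fin m) (Fin (m + 1)) ℤ}
    {v : Fin (m + 1) → ℤ} (hv : IsKernelVector W v) (u : QVec e (m + 1)) :
    (∀ l, momentTorus W u l = 0) ↔ ∃ (r : ℝ) (d : ℂ),
      (∀ α, normSq (Q₁ u α) + normSq (Q₂ u α) - normSq (P₁ u α) - normSq (P₂ u α) = v α * r) ∧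
      ∀ α, P₁ u α * Q₂ u α - P₂ u α * Q₁ u α = v α * d := by
  have comp : (∀ l, momentTorus W u l = 0) ↔
      (∀ l, ∑ α, (W l α : ℝ) * (pairMoment (u.2 α)).imI = 0) ∧
      (∀ l, ∑ α, (W l α : ℝ) * (pairMoment (u.2 α)).imJ = 0) ∧
      (∀ l, ∑ α, (W l α : ℝ) * (pairMoment (u.2 α)).imK = 0) := by
    have h0 : ∀ l, (momentTorus W u l).re = ∑ α, (W l α : ℝ) * (pairMoment (u.2 α)).re := fun l =>
      map_sum (AddMonoidHom.mk' (fun t : ℍ[ℝ] => t.re) fun _ _ => rfl) _ _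
    have h1 : ∀ l, (momentTorus W u l).imI = ∑ α, (W l α : ℝ) * (pairMoment (u.2 α)).imI :=
      fun l => map_sum (AddMonoidHom.mk' (fun t : ℍ[ℝ] => t.imI) fun _ _ => rfl) _ _
    have h2 : ∀ l, (momentTorus W u l).imJ = ∑ α, (W l α : ℝ) * (pairMoment (u.2 α)).imJ :=
      fun l => map_sum (AddMonoidHom.mk' (fun t : ℍ[ℝ] => t.imJ) fun _ _ => rfl) _ _
    have h3 : ∀ l, (momentTorus W u l).imK = ∑ α, (W l α : ℝ) * (pairMoment (u.2 α)).imK :=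
      fun l => map_sum (AddMonoidHom.mk' (fun t : ℍ[ℝ] => t.imK) fun _ _ => rfl) _ _
    have h0' : ∀ l, (momentTorus W u l).re = 0 := fun l => by
      rw [h0]; exact Finset.sum_eq_zero fun α _ => by rw [pairMoment_re, mul_zero]
    simp only [quaternion_eq_zero_iff, h0', ← h1, ← h2, ← h3]
    exact ⟨fun h => ⟨fun l => (h l).2.1, fun l => (h l).2.2.1, fun l => (h l).2.2.2⟩,
      fun h l => ⟨trivial, h.1 l, h.2.1 l, h.2.2 l⟩⟩
  rw [comp, hv.ker fun α => (pairMoment (u.2 α)).imI, hv.ker fun α => (pairMoment (u.2 α)).imJ,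
    hv.ker fun α => (pairMoment (u.2 α)).imK]
  simp only [normSq_sub_eq_pairMoment, det_eq_pairMoment]
  constructor
  · rintro ⟨⟨a, ha⟩, ⟨b, hb⟩, ⟨c, hc⟩⟩
    refine ⟨2 * a, -I * ⟨b, -c⟩, fun α => by rw [ha]; ring, fun α => ?_⟩
    have : cTwo (pairMoment (u.2 α)) = v α * ⟨b, -c⟩ := by
      apply Complex.ext <;> simp [cTwo, hb, hc]
    rw [this]; ring
  · rintro ⟨r, d, hr, hd⟩
    have hd' : ∀ α, cTwo (pairMoment (u.2 α)) = v α * (I * d) := fun α => by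
      linear_combination I * hd α + (cTwo (pairMoment (u.2 α))) * I_mul_I
    refine ⟨⟨r / 2, fun α => by linarith [hr α]⟩, ⟨(I * d).re, fun α => ?_⟩,
      ⟨-(I * d).im, fun α => ?_⟩⟩
    · have := congrArg re (hd' α)
      simpa [cTwo] using this
    · have := congrArg im (hd' α)
      simp [cTwo] at this ⊢
      linarith

theorem mem_zeroLevel_iff {e m : ℕ} {W : Matrix (Fin m) (Fin (m + 1)) ℤ}
    {v : Fin (m + 1) → ℤ} (hv : IsKernelVector W v) (u : QVec e (m + 1)) :
    u ∈ zeroLevel e W ↔ ∃ (r : ℝ) (d : ℂ), Level v r d u := by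
  have h2 : (2 : ℂ) ≠ 0 := two_ne_zero
  constructor
  · rintro ⟨hn, hi, hj, hk, ht⟩
    obtain ⟨m1, m2, m3, m4, m5⟩ := (moment_eq_zero_iff u).1 ⟨hi, hj, hk⟩
    obtain ⟨r, d, hr, hd⟩ := (momentTorus_eq_zero_iff hv u).1 ht
    rw [sqNorm_eq_total] at hn
    refine ⟨r, d, ?_, ?_, ?_, ?_, ?_, ?_, hr, hd⟩
    · rw [← two_mul_total_normSq_cOne]; linarith
    · rw [← two_mul_total_normSq_cTwo]; linarith
    · rw [← two_mul_total_herm, m3, mul_zero]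
    · rw [← total_sq_cOne, m4]
    · rw [← total_sq_cTwo, m5]
    · rw [← two_mul_total_mixed, m2, mul_zero]
  · rintro ⟨r, d, h⟩
    have n1 := h.norm₁
    have n2 := h.norm₂
    have n3 := h.herm
    have n6 := h.quad₁₂
    rw [← two_mul_total_normSq_cOne] at n1
    rw [← two_mul_total_normSq_cTwo] at n2
    rw [← two_mul_total_herm] at n3
    rw [← two_mul_total_mixed] at n6
    obtain ⟨hi, hj, hk⟩ := (moment_eq_zero_iff u).2 ⟨by linarith,
      (mul_eq_zero.1 n6).resolve_left h2, (mul_eq_zero.1 n3).resolve_left h2,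
      by rw [total_sq_cOne, h.quad₁], by rw [total_sq_cTwo, h.quad₂]⟩
    refine ⟨by rw [sqNorm_eq_total]; linarith, hi, hj, hk, ?_⟩
    exact (momentTorus_eq_zero_iff hv u).2 ⟨r, d, h.torus, h.torus'⟩

end level

/-! ### Every quaternionic pair is nonzero -/

/-- If a pair has vanishing moment, then it consists of real multiples of one quaternion. -/
theorem exists_common_quaternion (x : ℍ[ℝ] × ℍ[ℝ]) (h : pairMoment x = 0) :
    ∃ (y : ℍ[ℝ]) (c s : ℝ), x.1 = c • y ∧ x.2 = s • y := by
  obtain ⟨a, b⟩ := x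
  by_cases ha : a = 0
  · exact ⟨b, 0, 1, by simp [ha], by simp⟩
  · have hn : Quaternion.normSq a ≠ 0 := by simpa using ha
    refine ⟨a, 1, (star a * b).re / Quaternion.normSq a, by simp, ?_⟩
    have hre : star a * b = (((star a * b).re : ℝ) : ℍ[ℝ]) := by
      have h1 : star a * b = star b * a := sub_eq_zero.1 h
      have h2 : star (star a * b) = star a * b := by rw [star_mul, star_star, h1]
      exact Quaternion.star_eq_self.1 h2
    have h3 : Quaternion.normSq a • b = (star a * b).re • a := by
      rw [← Quaternion.coe_mul_eq_smul, ← Quaternion.self_mul_star, mul_assoc, hre,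
        ← Quaternion.coe_commutes, Quaternion.coe_mul_eq_smul, Quaternion.re_coe]
    change b = _ • a
    rw [div_eq_inv_mul, mul_smul, ← h3, smul_smul, inv_mul_cancel₀ hn, one_smul]

/-- The real inner product of two quaternions. -/
def pairing (t x : ℍ[ℝ]) : ℝ := (conj (cOne t) * cOne x + conj (cTwo t) * cTwo x).re

theorem pairing_add (t s x : ℍ[ℝ]) : pairing (t + s) x = pairing t x + pairing s x := by
  simp [pairing]; ring

theorem pairing_smul (c : ℝ) (t x : ℍ[ℝ]) : pairing (c • t) x = c * pairing t x := by
  simp [pairing]; ring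

theorem pairing_smul_right (c : ℝ) (t x : ℍ[ℝ]) : pairing t (c • x) = c * pairing t x := by
  simp [pairing]; ring

/-- A linear functional on the quaternions. -/
def pairingHom (x : ℍ[ℝ]) : ℍ[ℝ] →ₗ[ℝ] ℝ where
  toFun t := pairing t x
  map_add' t s := pairing_add t s x
  map_smul' c t := pairing_smul c t x

/-- The Gram matrix of the coordinates of a zero of the moment map is scalar. -/
theorem total_pairing_sq {e k : ℕ} {u : QVec e k} (hn : sqNorm u = 1)
    (hi : momentSp1 qI u = 0) (hj : momentSp1 qJ u = 0) (hk : momentSp1 qK u = 0) (t : ℍ[ℝ]) :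
    4 * total (fun x => pairing t x ^ 2) u = normSq (cOne t) + normSq (cTwo t) := by
  obtain ⟨m1, m2, m3, m4, m5⟩ := (moment_eq_zero_iff u).1 ⟨hi, hj, hk⟩
  rw [sqNorm_eq_total] at hn
  simp only [total_complex_eq_zero_iff] at m2 m3 m4 m5
  set N₁ := total (fun t => normSq (cOne t)) u
  set N₂ := total (fun t => normSq (cTwo t)) u
  have hN₁ : N₁ = 1 / 2 := by linarith
  have hN₂ : N₂ = 1 / 2 := by linarith
  let a := cOne t
  let b := cTwo t
  have key : total (fun x => pairing t x ^ 2) u =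
      normSq a / 2 * N₁ + normSq b / 2 * N₂ + (a.re ^ 2 - a.im ^ 2) / 2 *
        total (fun x => (cOne x ^ 2).re) u + a.re * a.im * total (fun x => (cOne x ^ 2).im) u
      + (b.re ^ 2 - b.im ^ 2) / 2 * total (fun x => (cTwo x ^ 2).re) u
      + b.re * b.im * total (fun x => (cTwo x ^ 2).im) u
      + (a.re * b.re - a.im * b.im) * total (fun x => (cOne x * cTwo x).re) u
      + (a.re * b.im + a.im * b.re) * total (fun x => (cOne x * cTwo x).im) u
      + (a.re * b.re + a.im * b.im) * total (fun x => (cOne x * conj (cTwo x)).re) u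
      + (a.im * b.re - a.re * b.im) * total (fun x => (cOne x * conj (cTwo x)).im) u := by
    simp only [N₁, N₂, ← total_smul, ← total_add]
    refine congrArg (fun K => total K u) (funext fun x => ?_)
    simp only [pairing, a, b, normSq_apply, add_re, mul_re, mul_im, conj_re, conj_im, sq]
    ring
  rw [key, m2.1, m2.2, m3.1, m3.2, m4.1, m4.2, m5.1, m5.2, hN₁, hN₂]
  ring

/-- A vanishing pair forces `r = d = 0`, so every other pair consists of real multiples of one
quaternion. All coordinates then lie in a real subspace of `ℍ` of dimension at most `e + m = 3`,
whereas by `total_pairing_sq` they span `ℍ`. -/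
theorem alive {e m : ℕ} (hem : e + m = 3) {W : Matrix (Fin m) (Fin (m + 1)) ℤ}
    {v : Fin (m + 1) → ℤ} (hv : IsKernelVector W v) {u : QVec e (m + 1)}
    (hu : u ∈ zeroLevel e W) (α : Fin (m + 1)) :
    ¬ (P₁ u α = 0 ∧ P₂ u α = 0 ∧ Q₁ u α = 0 ∧ Q₂ u α = 0) := by
  rintro ⟨hp1, hp2, hq1, hq2⟩
  obtain ⟨r, d, h⟩ := (mem_zeroLevel_iff hv u).1 hu
  have hvα : v α ≠ 0 := hv.ne_zero α
  have hr : r = 0 := by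
    have := h.torus α
    rw [hp1, hp2, hq1, hq2] at this
    simpa [hvα] using this.symm
  have hd : d = 0 := by
    have := h.torus' α
    rw [hp1, hp2, hq1, hq2] at this
    simpa [hvα] using this.symm
  have hpm : ∀ β, pairMoment (u.2 β) = 0 := fun β => by
    have h1 := h.torus β
    have h2 := h.torus' β
    rw [normSq_sub_eq_pairMoment, hr, mul_zero] at h1
    rw [det_eq_pairMoment, hd, mul_zero] at h2
    have h3 : cTwo (pairMoment (u.2 β)) = 0 := by simpa using h2
    refine quaternion_ext ?_ (by rw [h3]; apply Complex.ext <;> simp [cTwo])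
    apply Complex.ext
    · simpa [cOne] using pairMoment_re (u.2 β)
    · simp [cOne]; linarith
  choose y c s hc hs using fun β => exists_common_quaternion _ (hpm β)
  -- Three linear functionals on a space of dimension four have a common nonzero zero `t`.
  let F : ℍ[ℝ] →ₗ[ℝ] (Fin e ⊕ Fin m → ℝ) := LinearMap.pi
    (Sum.elim (fun i => pairingHom (u.1 i)) fun β => pairingHom (y (α.succAbove β)))
  have hF : LinearMap.ker F ≠ ⊥ := LinearMap.ker_ne_bot_of_finrank_lt (by
    rw [Module.finrank_fintype_fun_eq_card, Fintype.card_sum, Fintype.card_fin, Fintype.card_fin,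
      hem, Quaternion.finrank_eq_four]
    norm_num)
  obtain ⟨t, ht, ht0⟩ := (Submodule.ne_bot_iff _).1 hF
  have ht1 : ∀ i, pairing t (u.1 i) = 0 := fun i => congrFun ht (Sum.inl i)
  have ht2 : ∀ β, pairing t (y (α.succAbove β)) = 0 := fun β => congrFun ht (Sum.inr β)
  have hα : (u.2 α).1 = 0 ∧ (u.2 α).2 = 0 := by
    simp only [P₁, P₂, Q₁, Q₂] at hp1 hp2 hq1 hq2
    have hI : (2 * I : ℂ) ≠ 0 := by simp
    have z1 : cOne (0 : ℍ[ℝ]) = 0 := by apply Complex.ext <;> simp [cOne]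
    have z2 : cTwo (0 : ℍ[ℝ]) = 0 := by apply Complex.ext <;> simp [cTwo]
    constructor <;> apply quaternion_ext <;> simp only [z1, z2]
    · linear_combination (hp1 + hq1) / 2
    · linear_combination (hp2 + hq2) / 2
    · exact mul_left_cancel₀ hI (by linear_combination hp1 - hq1)
    · exact mul_left_cancel₀ hI (by linear_combination hp2 - hq2)
  have htot : total (fun x => pairing t x ^ 2) u = 0 := by
    have hzero : pairing t 0 = 0 := by
      have := pairing_smul_right 0 t 0
      simpa using this
    have hall : ∀ β, pairing t (u.2 β).1 = 0 ∧ pairing t (u.2 β).2 = 0 := fun β => by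
      rcases Fin.eq_self_or_eq_succAbove α β with rfl | ⟨i, rfl⟩
      · rw [hα.1, hα.2]; exact ⟨hzero, hzero⟩
      · rw [hc, hs, pairing_smul_right, pairing_smul_right, ht2]; simp
    simp [total, ht1, hall]
  have hG := total_pairing_sq hu.1 hu.2.1 hu.2.2.1 hu.2.2.2.1 t
  rw [htot, mul_zero, ← norm_sq_eq] at hG
  exact ht0 (by simpa using hG.symm)

/-! ### Isotropy groups inside the torus -/

section isotropy

variable {e m k : ℕ} {W : Matrix (Fin m) (Fin k) ℤ}

/-- The homomorphism `(τ, λ, ρ) ↦ (exp (i ω_α))_α`. -/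
def rotorHom (W : Matrix (Fin m) (Fin k) ℤ) : GTilde m →* Torus k where
  toFun g := rotor W g.1
  map_one' := funext fun α => rotor_one W α
  map_mul' g h := funext fun α => rotor_mul W g.1 h.1 α

/-- The group of rotors of the elements of `G̃` that fix `u`. -/
def torusIsotropy (u : zeroLevel e W) : Subgroup (Torus k) :=
  (MulAction.stabilizer (GTilde m) u).map (rotorHom W)

theorem coe_smul_eq_act (g : GTilde m) (u : zeroLevel e W) :
    ((g • u : zeroLevel e W) : QVec e k) = act (rotor W g.1) g.2.1 (circleToSp1 g.2.2) u :=
  transform_eq_act W g.1 g.2.1 _ u.1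

/-- Stabilizers in an orbit are conjugate, and conjugation disappears in the commutative group of
rotors. -/
theorem torusIsotropy_smul (g : GTilde m) (u : zeroLevel e W) :
    torusIsotropy (g • u) = torusIsotropy u := by
  ext z
  simp only [torusIsotropy, Subgroup.mem_map, MulAction.mem_stabilizer_iff]
  constructor
  · rintro ⟨h, hh, rfl⟩
    refine ⟨g⁻¹ * h * g, ?_, ?_⟩
    · rw [mul_smul, mul_smul, hh, inv_smul_smul]
    · rw [map_mul, map_mul, mul_right_comm, ← map_mul, inv_mul_cancel, map_one, one_mul]
  · rintro ⟨h, hh, rfl⟩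
    refine ⟨g * h * g⁻¹, ?_, ?_⟩
    · rw [mul_smul, mul_smul, inv_smul_smul, hh]
    · rw [map_mul, map_mul, mul_right_comm, ← map_mul, mul_inv_cancel, map_one, one_mul]

end isotropy

theorem mem_torusIsotropy_iff {e m : ℕ} {W : Matrix (Fin m) (Fin (m + 1)) ℤ}
    {v : Fin (m + 1) → ℤ} (hv : IsKernelVector W v) (u : zeroLevel e W) (z : Torus (m + 1)) :
    z ∈ torusIsotropy u ↔ ∏ α, z α ^ v α = 1 ∧
      ∃ (lam : Sp1) (ρ : Circle), act z lam (circleToSp1 ρ) u.1 = u.1 := by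
  simp only [torusIsotropy, Subgroup.mem_map, MulAction.mem_stabilizer_iff, Subtype.ext_iff,
    coe_smul_eq_act]
  rw [← hv.range_rotor]
  constructor
  · rintro ⟨⟨τ, lam, ρ⟩, h, rfl⟩
    exact ⟨⟨τ, rfl⟩, lam, ρ, h⟩
  · rintro ⟨⟨τ, rfl⟩, lam, ρ, h⟩
    exact ⟨⟨τ, lam, ρ⟩, h, rfl⟩

/-! ### Diagonal stabilizers -/

theorem normSq_cOne_add_normSq_cTwo (lam : Sp1) :
    normSq (cOne lam) + normSq (cTwo lam) = 1 := by
  rw [← norm_sq_eq, Sp1.norm_eq_one, one_pow]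

theorem exists_circle_coe_eq {c : ℂ} (hc : normSq c = 1) : ∃ w : Circle, (w : ℂ) = c := by
  rw [normSq_eq_norm_sq] at hc
  exact ⟨⟨c, mem_sphere_zero_iff_norm.2
    ((pow_eq_one_iff_of_nonneg (norm_nonneg _) two_ne_zero).1 hc)⟩, rfl⟩

theorem exists_circle_of_cTwo_eq_zero (lam : Sp1) (h : cTwo lam = 0) :
    ∃ l : Circle, lam = circleToSp1 l := by
  have hn := normSq_cOne_add_normSq_cTwo lam
  rw [h, map_zero, add_zero] at hn
  obtain ⟨l, hl⟩ := exists_circle_coe_eq hn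
  refine ⟨l, Subtype.ext (quaternion_ext ?_ ?_)⟩
  · rw [coe_circleToSp1, cOne_coe, hl]
  · rw [coe_circleToSp1, cTwo_coe, h]

theorem exists_conj_circle (lam : Sp1) :
    ∃ (ν : Sp1) (l : Circle), ν * lam = circleToSp1 l * ν := by
  obtain ⟨a, b, c, d, hlam⟩ : ∃ a b c d : ℝ, (lam : ℍ[ℝ]) = ⟨a, b, c, d⟩ :=
    ⟨_, _, _, _, rfl⟩
  let n : ℝ := Real.sqrt (b ^ 2 + c ^ 2 + d ^ 2)
  have hn : n ^ 2 = b ^ 2 + c ^ 2 + d ^ 2 := Real.sq_sqrt (by positivity)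
  -- This is `n - i · Im λ` with `n = |Im λ|`. As `(Im λ)² = -n²`, it satisfies `ν₀ · Im λ = n i ·
  -- ν₀`. It can vanish only if `Im λ` is already a multiple of `i`.
  let ν₀ : ℍ[ℝ] := ⟨n + b, 0, d, -c⟩
  let c₀ : ℍ[ℝ] := ⟨a, n, 0, 0⟩
  have hν₀ : ν₀.re = n + b ∧ ν₀.imI = 0 ∧ ν₀.imJ = d ∧ ν₀.imK = -c := ⟨rfl, rfl, rfl, rfl⟩
  have hc₀ : c₀.re = a ∧ c₀.imI = n ∧ c₀.imJ = 0 ∧ c₀.imK = 0 := ⟨rfl, rfl, rfl, rfl⟩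
  have hl : (lam : ℍ[ℝ]).re = a ∧ (lam : ℍ[ℝ]).imI = b ∧ (lam : ℍ[ℝ]).imJ = c ∧
      (lam : ℍ[ℝ]).imK = d := by rw [hlam]; exact ⟨rfl, rfl, rfl, rfl⟩
  have hcomm : ν₀ * lam = c₀ * ν₀ := by
    apply QuaternionAlgebra.ext
    · rw [Quaternion.re_mul, Quaternion.re_mul, hν₀.1, hν₀.2.1, hν₀.2.2.1, hν₀.2.2.2, hc₀.1,
        hc₀.2.1, hc₀.2.2.1, hc₀.2.2.2, hl.1, hl.2.1, hl.2.2.1, hl.2.2.2]; ring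
    · rw [Quaternion.imI_mul, Quaternion.imI_mul, hν₀.1, hν₀.2.1, hν₀.2.2.1, hν₀.2.2.2, hc₀.1,
        hc₀.2.1, hc₀.2.2.1, hc₀.2.2.2, hl.1, hl.2.1, hl.2.2.1, hl.2.2.2]
      linear_combination -hn
    · rw [Quaternion.imJ_mul, Quaternion.imJ_mul, hν₀.1, hν₀.2.1, hν₀.2.2.1, hν₀.2.2.2, hc₀.1,
        hc₀.2.1, hc₀.2.2.1, hc₀.2.2.2, hl.1, hl.2.1, hl.2.2.1, hl.2.2.2]; ring
    · rw [Quaternion.imK_mul, Quaternion.imK_mul, hν₀.1, hν₀.2.1, hν₀.2.2.1, hν₀.2.2.2, hc₀.1,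
        hc₀.2.1, hc₀.2.2.1, hc₀.2.2.2, hl.1, hl.2.1, hl.2.2.1, hl.2.2.2]; ring
  by_cases h0 : ν₀ = 0
  · have hc : c = 0 := by
      have := congrArg (fun t : ℍ[ℝ] => t.imK) h0
      simpa [ν₀] using this
    have hd : d = 0 := congrArg (fun t : ℍ[ℝ] => t.imJ) h0
    obtain ⟨l, hl⟩ := exists_circle_of_cTwo_eq_zero lam (by
      rw [hlam, hc, hd]; apply Complex.ext <;> simp [cTwo])
    exact ⟨1, l, by rw [hl, one_mul, mul_one]⟩
  · have hs : ‖ν₀‖ ≠ 0 := norm_ne_zero_iff.2 h0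
    let ν : Sp1 := ⟨‖ν₀‖⁻¹ • ν₀, by
      have h1 : star (‖ν₀‖⁻¹ • ν₀) * (‖ν₀‖⁻¹ • ν₀) = 1 := by
        rw [Quaternion.star_smul, smul_mul_smul_comm, Quaternion.star_mul_self,
          Quaternion.normSq_eq_norm_mul_self, ← Quaternion.coe_smul, smul_eq_mul]
        field_simp
        simp
      have h2 : (‖ν₀‖⁻¹ • ν₀) * star (‖ν₀‖⁻¹ • ν₀) = 1 := by
        rw [Quaternion.star_smul, smul_mul_smul_comm, Quaternion.self_mul_star,
          Quaternion.normSq_eq_norm_mul_self, ← Quaternion.coe_smul, smul_eq_mul]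
        field_simp
        simp
      exact Unitary.mem_iff.2 ⟨h1, h2⟩⟩
    have hν : (ν : ℍ[ℝ]) * lam = c₀ * ν := by
      simp only [ν]
      rw [smul_mul_assoc, hcomm, mul_smul_comm]
    have hconj : ((ν * lam * ν⁻¹ : Sp1) : ℍ[ℝ]) = c₀ := by
      have h3 : (ν : ℍ[ℝ]) * ((ν⁻¹ : Sp1) : ℍ[ℝ]) = 1 := by
        rw [← Submonoid.coe_mul, mul_inv_cancel, Submonoid.coe_one]
      rw [Submonoid.coe_mul, Submonoid.coe_mul, hν, mul_assoc, h3, mul_one]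
    obtain ⟨l, hl⟩ := exists_circle_of_cTwo_eq_zero (ν * lam * ν⁻¹) (by
      rw [hconj]; apply Complex.ext <;> simp [cTwo, c₀])
    exact ⟨ν, l, by rw [← hl, inv_mul_cancel_right]⟩

section diag

variable {e k : ℕ}

/-- The torus element `z`, together with a diagonal left factor and a right factor whose product
and quotient are `a` and `b`, fixes `u`. -/
structure DiagStab (z : Torus k) (a b : Circle) (u : QVec e k) : Prop where
  u₁ : ∀ i, U₁ u i ≠ 0 → a = 1
  u₂ : ∀ i, U₂ u i ≠ 0 → b = 1
  p₁ : ∀ α, P₁ u α ≠ 0 → z α = a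
  p₂ : ∀ α, P₂ u α ≠ 0 → z α = b
  q₁ : ∀ α, Q₁ u α ≠ 0 → z α = a⁻¹
  q₂ : ∀ α, Q₂ u α ≠ 0 → z α = b⁻¹

theorem U₁_act_circle (z : Torus k) (l ρ : Circle) (u : QVec e k) (i : Fin e) :
    U₁ (act z (circleToSp1 l) (circleToSp1 ρ) u) i = ((l * ρ : Circle) : ℂ) * U₁ u i := by
  rw [U₁_act]; simp; ring

theorem U₂_act_circle (z : Torus k) (l ρ : Circle) (u : QVec e k) (i : Fin e) :
    U₂ (act z (circleToSp1 l) (circleToSp1 ρ) u) i = ((l⁻¹ * ρ : Circle) : ℂ) * U₂ u i := by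
  rw [U₂_act, Circle.coe_mul, Circle.coe_inv_eq_conj]; simp; ring

theorem P₁_act_circle (z : Torus k) (l ρ : Circle) (u : QVec e k) (α : Fin k) :
    P₁ (act z (circleToSp1 l) (circleToSp1 ρ) u) α
      = ((l * ρ * (z α)⁻¹ : Circle) : ℂ) * P₁ u α := by
  rw [P₁_act]; simp; ring

theorem P₂_act_circle (z : Torus k) (l ρ : Circle) (u : QVec e k) (α : Fin k) :
    P₂ (act z (circleToSp1 l) (circleToSp1 ρ) u) α
      = ((l⁻¹ * ρ * (z α)⁻¹ : Circle) : ℂ) * P₂ u α := by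
  rw [P₂_act, Circle.coe_mul, Circle.coe_mul, Circle.coe_inv_eq_conj l]; simp; ring

theorem Q₁_act_circle (z : Torus k) (l ρ : Circle) (u : QVec e k) (α : Fin k) :
    Q₁ (act z (circleToSp1 l) (circleToSp1 ρ) u) α = ((l * ρ * z α : Circle) : ℂ) * Q₁ u α := by
  rw [Q₁_act]; simp; ring

theorem Q₂_act_circle (z : Torus k) (l ρ : Circle) (u : QVec e k) (α : Fin k) :
    Q₂ (act z (circleToSp1 l) (circleToSp1 ρ) u) α
      = ((l⁻¹ * ρ * z α : Circle) : ℂ) * Q₂ u α := by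
  rw [Q₂_act, Circle.coe_mul, Circle.coe_mul, Circle.coe_inv_eq_conj l]; simp; ring

theorem circle_mul_eq_self_iff (w : Circle) (c : ℂ) : (w : ℂ) * c = c ↔ (c ≠ 0 → w = 1) := by
  constructor
  · intro h hc
    have : (w : ℂ) = 1 := mul_right_cancel₀ hc (by rw [h, one_mul])
    exact Circle.ext (by simpa using this)
  · intro h
    by_cases hc : c = 0
    · simp [hc]
    · simp [h hc]

/-- A diagonal transformation multiplies each complex coordinate by a phase, so it fixes `u` exactly
if the phases at the nonzero coordinates are `1`. -/
theorem diagStab_iff (z : Torus k) (l ρ : Circle) (u : QVec e k) :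
    act z (circleToSp1 l) (circleToSp1 ρ) u = u ↔ DiagStab z (l * ρ) (l⁻¹ * ρ) u := by
  constructor
  · intro h
    refine ⟨fun i => ?_, fun i => ?_, fun α hα => ?_, fun α hα => ?_, fun α hα => ?_,
      fun α hα => ?_⟩
    · have := U₁_act_circle z l ρ u i
      rw [h] at this
      exact (circle_mul_eq_self_iff _ _).1 this.symm
    · have := U₂_act_circle z l ρ u i
      rw [h] at this
      exact (circle_mul_eq_self_iff _ _).1 this.symm
    · have := P₁_act_circle z l ρ u α
      rw [h] at this
      exact (mul_inv_eq_one.1 ((circle_mul_eq_self_iff _ _).1 this.symm hα)).symm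
    · have := P₂_act_circle z l ρ u α
      rw [h] at this
      exact (mul_inv_eq_one.1 ((circle_mul_eq_self_iff _ _).1 this.symm hα)).symm
    · have := Q₁_act_circle z l ρ u α
      rw [h] at this
      exact eq_inv_of_mul_eq_one_right ((circle_mul_eq_self_iff _ _).1 this.symm hα)
    · have := Q₂_act_circle z l ρ u α
      rw [h] at this
      exact eq_inv_of_mul_eq_one_right ((circle_mul_eq_self_iff _ _).1 this.symm hα)
  · intro h
    refine qvec_ext (fun i => ?_) (fun i => ?_) (fun α => ?_) (fun α => ?_) (fun α => ?_)
      (fun α => ?_)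
    · rw [U₁_act_circle, circle_mul_eq_self_iff]; exact h.u₁ i
    · rw [U₂_act_circle, circle_mul_eq_self_iff]; exact h.u₂ i
    · rw [P₁_act_circle, circle_mul_eq_self_iff]; intro hα; rw [h.p₁ α hα, mul_inv_cancel]
    · rw [P₂_act_circle, circle_mul_eq_self_iff]; intro hα; rw [h.p₂ α hα, mul_inv_cancel]
    · rw [Q₁_act_circle, circle_mul_eq_self_iff]; intro hα; rw [h.q₁ α hα, mul_inv_cancel]
    · rw [Q₂_act_circle, circle_mul_eq_self_iff]; intro hα; rw [h.q₂ α hα, mul_inv_cancel]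

theorem circle_exists_pow_eq (w : Circle) {n : ℕ} (hn : n ≠ 0) : ∃ t : Circle, t ^ n = w := by
  refine ⟨Circle.exp (arg w / n), ?_⟩
  rw [← Circle.exp_natCast_mul, mul_div_cancel₀ _ (by exact_mod_cast hn), Circle.exp_arg]

/-- The left and right factors are recovered from `a` and `b` by a square root of `a / b`. -/
theorem exists_mul_and_inv_mul (a b : Circle) : ∃ l ρ : Circle, l * ρ = a ∧ l⁻¹ * ρ = b := by
  obtain ⟨l, hl⟩ := circle_exists_pow_eq (a * b⁻¹) two_ne_zero
  refine ⟨l, l * b, ?_, by rw [inv_mul_cancel_left]⟩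
  rw [← mul_assoc, ← sq, hl, inv_mul_cancel_right]

theorem DiagStab.exists_act {z : Torus k} {a b : Circle} {u : QVec e k} (h : DiagStab z a b u) :
    ∃ l ρ : Circle, act z (circleToSp1 l) (circleToSp1 ρ) u = u := by
  obtain ⟨l, ρ, rfl, rfl⟩ := exists_mul_and_inv_mul a b
  exact ⟨l, ρ, (diagStab_iff z l ρ u).2 h⟩

end diag

section diagIsotropy

variable {e m : ℕ} {W : Matrix (Fin m) (Fin (m + 1)) ℤ} {v : Fin (m + 1) → ℤ}

theorem DiagStab.mem_torusIsotropy (hv : IsKernelVector W v) {u : zeroLevel e W}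
    {z : Torus (m + 1)} {a b : Circle} (h : DiagStab z a b u.1) (hz : ∏ α, z α ^ v α = 1) :
    z ∈ torusIsotropy u := by
  obtain ⟨l, ρ, h⟩ := h.exists_act
  exact (mem_torusIsotropy_iff hv u z).2 ⟨hz, _, _, h⟩

theorem exists_diagStab_of_cTwo_eq_zero {z : Torus (m + 1)} {lam : Sp1} {ρ : Circle}
    {u : QVec e (m + 1)} (h : act z lam (circleToSp1 ρ) u = u) (hlam : cTwo lam = 0) :
    ∃ a b, DiagStab z a b u := by
  obtain ⟨l, rfl⟩ := exists_circle_of_cTwo_eq_zero lam hlam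
  exact ⟨_, _, (diagStab_iff z l ρ u).1 h⟩

/-- Up to the left action of `Sp(1)`, stabilizers are diagonal. -/
theorem exists_smul_diagStab (hv : IsKernelVector W v) {u : zeroLevel e W}
    {z : Torus (m + 1)} (hz : z ∈ torusIsotropy u) :
    ∃ (ν : Sp1) (a b : Circle),
      DiagStab z a b (((1, ν, 1) : GTilde m) • u : zeroLevel e W).1 := by
  obtain ⟨-, lam, ρ, h⟩ := (mem_torusIsotropy_iff hv u z).1 hz
  obtain ⟨ν, l, hν⟩ := exists_conj_circle lam
  refine ⟨ν, _, _, (diagStab_iff z l ρ _).1 ?_⟩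
  have h1 : rotor W (1 : Torus m) = 1 := funext fun α => rotor_one W α
  rw [coe_smul_eq_act]
  simp only [h1, map_one]
  conv_rhs => rw [← h]
  rw [act_act, act_act, mul_one, one_mul, mul_one, one_mul, hν]

/-- The unit quaternion `j`. -/
def jSp1 : Sp1 := ⟨qJ, by
  have hJ : qJ.re = 0 ∧ qJ.imI = 0 ∧ qJ.imJ = 1 ∧ qJ.imK = 0 := ⟨rfl, rfl, rfl, rfl⟩
  rw [Unitary.mem_iff]
  constructor <;> apply QuaternionAlgebra.ext <;> simp [hJ]⟩

/-- Left multiplication by `j` exchanges the two complex coordinates. -/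
theorem swap_coords (u : zeroLevel e W) :
    let u' := (((1, jSp1, 1) : GTilde m) • u : zeroLevel e W).1
    (∀ i, U₁ u' i = -U₂ u.1 i ∧ U₂ u' i = U₁ u.1 i) ∧
    ∀ α, P₁ u' α = -P₂ u.1 α ∧ P₂ u' α = P₁ u.1 α ∧ Q₁ u' α = -Q₂ u.1 α ∧ Q₂ u' α = Q₁ u.1 α := by
  have h1 : rotor W (1 : Torus m) = 1 := funext fun α => rotor_one W α
  have hj1 : cOne (jSp1 : ℍ[ℝ]) = 0 := rfl
  have hj2 : cTwo (jSp1 : ℍ[ℝ]) = 1 := by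
    apply Complex.ext <;> simp [cTwo, jSp1, qJ]
  simp only [coe_smul_eq_act, h1, U₁_act, U₂_act, P₁_act, P₂_act, Q₁_act, Q₂_act, hj1, hj2]
  simp

theorem DiagStab.swap {z : Torus (m + 1)} {a b : Circle} {u : zeroLevel e W}
    (h : DiagStab z a b u.1) :
    DiagStab z b a (((1, jSp1, 1) : GTilde m) • u : zeroLevel e W).1 := by
  obtain ⟨h1, h2⟩ := swap_coords u
  refine ⟨fun i hi => h.u₂ i ?_, fun i hi => h.u₁ i ?_, fun α hα => h.p₂ α ?_,
    fun α hα => h.p₁ α ?_, fun α hα => h.q₂ α ?_, fun α hα => h.q₁ α ?_⟩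
  · rwa [(h1 i).1, neg_ne_zero] at hi
  · rwa [(h1 i).2] at hi
  · rwa [(h2 α).1, neg_ne_zero] at hα
  · rwa [(h2 α).2.1] at hα
  · rwa [(h2 α).2.2.1, neg_ne_zero] at hα
  · rwa [(h2 α).2.2.2] at hα

end diagIsotropy

/-! ### Counting roots in the circle -/

/-- The solutions form a coset of the `n`-th roots of unity, all of which lie on the circle. -/
theorem ncard_circle_pow_eq {n : ℕ} (hn : 0 < n) (c : Circle) :
    {w : Circle | w ^ n = c}.Finite ∧ {w : Circle | w ^ n = c}.ncard = n := by
  obtain ⟨w₀, hw₀⟩ := circle_exists_pow_eq c hn.ne'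
  have : NeZero n := ⟨hn.ne'⟩
  have hinj : Function.Injective (Circle.toUnits : Circle →* ℂˣ) :=
    fun x y h => Circle.ext (congrArg Units.val h)
  have hset : {w : Circle | w ^ n = c} = (fun w => w₀ * w) '' {w : Circle | w ^ n = 1} := by
    ext w
    simp only [Set.mem_ofPred_eq, Set.mem_image]
    constructor
    · intro h
      exact ⟨w₀⁻¹ * w, by rw [mul_pow, inv_pow, hw₀, h, inv_mul_cancel], by simp⟩
    · rintro ⟨x, hx, rfl⟩
      rw [mul_pow, hx, hw₀, mul_one]
  have hcard : {w : Circle | w ^ n = 1}.Finite ∧ {w : Circle | w ^ n = 1}.ncard = n := by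
    have himg : Circle.toUnits '' {w : Circle | w ^ n = 1} = (rootsOfUnity n ℂ : Set ℂˣ) := by
      ext x
      simp only [Set.mem_image, Set.mem_ofPred_eq, SetLike.mem_coe, _root_.mem_rootsOfUnity]
      constructor
      · rintro ⟨w, hw, rfl⟩
        rw [← map_pow, hw, map_one]
      · intro hx
        have hx' : (x : ℂ) ^ n = 1 := by rw [← Units.val_pow_eq_pow_val, hx, Units.val_one]
        have hnorm : ‖(x : ℂ)‖ = 1 := Complex.norm_eq_one_of_pow_eq_one hx' hn.ne'
        obtain ⟨w, hw⟩ := exists_circle_coe_eq (c := (x : ℂ))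
          (by rw [normSq_eq_norm_sq, hnorm, one_pow])
        refine ⟨w, hinj ?_, Units.ext hw⟩
        rw [map_pow, map_one]
        rw [show Circle.toUnits w = x from Units.ext hw, hx]
    have hroots : (rootsOfUnity n ℂ : Set ℂˣ).ncard = n := by
      rw [← Nat.card_coe_set_eq]
      exact Complex.card_rootsOfUnity n
    have hfin : (rootsOfUnity n ℂ : Set ℂˣ).Finite :=
      Set.finite_of_ncard_ne_zero (by rw [hroots]; exact hn.ne')
    refine ⟨Set.Finite.of_finite_image (himg ▸ hfin) hinj.injOn, ?_⟩
    rw [← Set.ncard_image_of_injective _ hinj, himg, hroots]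
  rw [hset]
  exact ⟨hcard.1.image _, by rw [Set.ncard_image_of_injective _ (mul_right_injective w₀), hcard.2]⟩

/-- The pairs `(η, w)` with `η = ±1` and `η ^ k * w ^ n = 1`. -/
def signedRoots (k : ℤ) (n : ℕ) : Set (Circle × Circle) := {x | x.1 ^ 2 = 1 ∧ x.1 ^ k * x.2 ^ n = 1}

theorem ncard_signedRoots (k : ℤ) {n : ℕ} (hn : 0 < n) :
    (signedRoots k n).Finite ∧ (signedRoots k n).ncard = 2 * n := by
  obtain ⟨x, y, hxy, h⟩ := Set.ncard_eq_two.1 (ncard_circle_pow_eq two_pos 1).2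
  have hmem : ∀ η : Circle, η ^ 2 = 1 ↔ η = x ∨ η = y := fun η => by
    have := Set.ext_iff.1 h η
    simpa using this
  have hinj : ∀ c : Circle, Function.Injective (fun w : Circle => (c, w)) :=
    fun c w w' h => (Prod.ext_iff.1 h).2
  have hset : signedRoots k n = (fun w => (x, w)) '' {w : Circle | w ^ n = (x ^ k)⁻¹} ∪
      (fun w => (y, w)) '' {w : Circle | w ^ n = (y ^ k)⁻¹} := by
    ext ⟨η, w⟩
    simp only [signedRoots, Set.mem_ofPred_eq, hmem, Set.mem_union, Set.mem_image, Prod.mk.injEq]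
    constructor
    · rintro ⟨rfl | rfl, h'⟩
      · exact Or.inl ⟨w, eq_inv_of_mul_eq_one_right h', rfl, rfl⟩
      · exact Or.inr ⟨w, eq_inv_of_mul_eq_one_right h', rfl, rfl⟩
    · rintro (⟨w', h, rfl, rfl⟩ | ⟨w', h, rfl, rfl⟩)
      · exact ⟨Or.inl rfl, by rw [h, mul_inv_cancel]⟩
      · exact ⟨Or.inr rfl, by rw [h, mul_inv_cancel]⟩
  have f1 := (ncard_circle_pow_eq hn (x ^ k)⁻¹)
  have f2 := (ncard_circle_pow_eq hn (y ^ k)⁻¹)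
  have g1 := f1.1.image (fun w => (x, w))
  have g2 := f2.1.image (fun w => (y, w))
  rw [hset]
  refine ⟨g1.union g2, ?_⟩
  rw [Set.ncard_union_eq ?_ g1 g2, Set.ncard_image_of_injective _ (hinj x),
    Set.ncard_image_of_injective _ (hinj y), f1.2, f2.2, two_mul]
  rw [Set.disjoint_left]
  rintro _ ⟨w, -, rfl⟩ ⟨w', -, h⟩
  exact hxy (Prod.ext_iff.1 h).1.symm

theorem circle_eq_of_sq_eq_one {w w' : Circle} (h : w ^ 2 = 1) (h' : w' ^ 2 = 1) (hw : w ≠ 1)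
    (hw' : w' ≠ 1) : w = w' := by
  have key : ∀ x : Circle, x ^ 2 = 1 → x ≠ 1 → (x : ℂ) = -1 := fun x hx hx1 => by
    have h1 : (x : ℂ) ^ 2 = 1 := by rw [← Circle.coe_pow, hx, Circle.coe_one]
    exact (sq_eq_one_iff.1 h1).resolve_left fun h2 => hx1 (Circle.ext (by simpa using h2))
  exact Circle.ext (by rw [key w h hw, key w' h' hw'])

theorem zpow_eq_self_of_odd {w : Circle} (h : w ^ 2 = 1) {n : ℤ} (hn : Odd n) : w ^ n = w := by
  obtain ⟨k, rfl⟩ := hn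
  rw [zpow_add, zpow_mul, zpow_one]
  rw [show w ^ (2 : ℤ) = 1 from by exact_mod_cast h, one_zpow, one_mul]

theorem zpow_sign_mul {w : Circle} (n : ℤ) : (w ^ n.sign) ^ n = w ^ n.natAbs := by
  rw [← zpow_mul, Int.sign_mul_self_eq_natAbs, zpow_natCast]

/-! ### Consequences of admissibility -/

section signs

variable {e m : ℕ} {W : Matrix (Fin m) (Fin (m + 1)) ℤ} {v : Fin (m + 1) → ℤ}

/-- The form in which nonvanishing of the sums `∑ ±v_α` is used: it forces `r` or `d` to be zero. -/
theorem IsKernelVector.eq_zero_of_sum_eq_zero {K : Type*} [Field K] [CharZero K]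
    (hv : IsKernelVector W v) {r : K} {f : Fin (m + 1) → K}
    (hf : ∀ α, f α = v α * r ∨ f α = -(v α * r)) (hsum : ∑ α, f α = 0) : r = 0 := by
  classical
  let ε : Fin (m + 1) → ℤˣ := fun α => if f α = v α * r then 1 else -1
  have hε : ∀ α, f α = ((ε α : ℤ) * v α : ℤ) * r := fun α => by
    simp only [ε]
    split_ifs with h
    · rw [h]; simp
    · rw [(hf α).resolve_left h]; simp
  simp_rw [hε] at hsum
  rw [← Finset.sum_mul, ← Int.cast_sum] at hsum
  exact (mul_eq_zero.1 hsum).resolve_left (by exact_mod_cast hv.signed_sum_ne_zero ε)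

theorem IsKernelVector.cast_ne_zero (hv : IsKernelVector W v) (α : Fin (m + 1)) :
    (v α : ℝ) ≠ 0 := by exact_mod_cast hv.ne_zero α

/-- The sum of the absolute values of the coordinates of `v`. -/
def weightSum (v : Fin (m + 1) → ℤ) : ℕ := ∑ α, (v α).natAbs

theorem normSq_eq_zero_of_sum_eq_zero {x y : ℂ} (h : normSq x + normSq y = 0) :
    x = 0 ∧ y = 0 := by
  have hx := normSq_nonneg x
  have hy := normSq_nonneg y
  exact ⟨normSq_eq_zero.1 (by linarith), normSq_eq_zero.1 (by linarith)⟩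

variable {z : Torus (m + 1)} {a b : Circle} {u : zeroLevel e W}

theorem DiagStab.apply_cases (hem : e + m = 3) (hv : IsKernelVector W v)
    (h : DiagStab z a b u.1) (α : Fin (m + 1)) :
    z α = a ∨ z α = a⁻¹ ∨ z α = b ∨ z α = b⁻¹ := by
  by_contra hcon
  push Not at hcon
  obtain ⟨h1, h2, h3, h4⟩ := hcon
  exact alive hem hv u.2 α
    ⟨by_contra fun hne => h1 (h.p₁ α hne), by_contra fun hne => h3 (h.p₂ α hne),
      by_contra fun hne => h2 (h.q₁ α hne), by_contra fun hne => h4 (h.q₂ α hne)⟩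

/-- The group `G` acts locally freely: a stabilizer with trivial right factor is trivial. -/
theorem DiagStab.eq_of_mul_eq_one (hem : e + m = 3) (hv : IsKernelVector W v)
    (h : DiagStab z a b u.1) (hab : a * b = 1) : a = b := by
  by_contra hne
  obtain ⟨r, d, hL⟩ := (mem_zeroLevel_iff hv u.1).1 u.2
  have hb : b = a⁻¹ := eq_inv_of_mul_eq_one_right hab
  have hU₁ : ∀ i, U₁ u.1 i = 0 := fun i => by_contra fun hi => hne (by
    have := h.u₁ i hi; rw [hb, this, inv_one])
  have hU₂ : ∀ i, U₂ u.1 i = 0 := fun i => by_contra fun hi => hne (by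
    have h1 := h.u₂ i hi; rw [h1, mul_one] at hab; rw [h1, hab])
  -- Here `b = a⁻¹ ≠ a`, so `z α` cannot have both values `a` and `a⁻¹`: it selects either `P₁, Q₂`
  -- or `P₂, Q₁`.
  have hcase : ∀ α, (P₂ u.1 α = 0 ∧ Q₁ u.1 α = 0) ∨ (P₁ u.1 α = 0 ∧ Q₂ u.1 α = 0) := fun α => by
    by_cases hz : z α = a
    · left
      refine ⟨by_contra fun h' => hne ?_, by_contra fun h' => hne ?_⟩
      · rw [← hz, h.p₂ α h']
      · rw [hb, ← h.q₁ α h', hz]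
    · right
      refine ⟨by_contra fun h' => hz (h.p₁ α h'), by_contra fun h' => hz ?_⟩
      rw [h.q₂ α h', hb, inv_inv]
  -- The mixed quadratic equation is a signed sum of the `v_α d`. In the same way, the difference of
  -- the two norm equations below is a signed sum of the `v_α r`.
  have hd : d = 0 := by
    refine hv.eq_zero_of_sum_eq_zero (f := fun α => P₁ u.1 α * Q₂ u.1 α + P₂ u.1 α * Q₁ u.1 α)
      (fun α => ?_) ?_
    · have := hL.torus' α
      rcases hcase α with ⟨h1, h2⟩ | ⟨h1, h2⟩
      · left; rw [← this, h1]; ring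
      · right; rw [← this, h1]; ring
    · have := hL.quad₁₂
      simpa [hU₁] using this
  have hr : r = 0 := by
    refine hv.eq_zero_of_sum_eq_zero (f := fun α => (normSq (P₁ u.1 α) + normSq (Q₁ u.1 α))
      - (normSq (P₂ u.1 α) + normSq (Q₂ u.1 α))) (fun α => ?_) ?_
    · have := hL.torus α
      rcases hcase α with ⟨h1, h2⟩ | ⟨h1, h2⟩
      · right; rw [← this, h1, h2]; simp
      · left; rw [← this, h1, h2]; simp
    · have h1 := hL.norm₁
      have h2 := hL.norm₂
      simp only [hU₁, hU₂, map_zero, mul_zero, Finset.sum_const_zero, zero_add] at h1 h2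
      rw [Finset.sum_sub_distrib, h1, h2, sub_self]
  have h1 := hL.torus 0
  have h2 := hL.torus' 0
  rw [hr, mul_zero] at h1
  rw [hd, mul_zero] at h2
  refine alive hem hv u.2 0 ?_
  rcases hcase 0 with ⟨e1, e2⟩ | ⟨e1, e2⟩
  · rw [e1, e2] at h1 h2
    simp only [map_zero, zero_add, sub_zero, zero_mul] at h1 h2
    rcases mul_eq_zero.1 h2 with e3 | e3
    · rw [e3, map_zero, sub_zero] at h1
      exact ⟨e3, e1, e2, normSq_eq_zero.1 h1⟩
    · rw [e3, map_zero, zero_sub, neg_eq_zero] at h1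
      exact ⟨normSq_eq_zero.1 h1, e1, e2, e3⟩
  · rw [e1, e2] at h1 h2
    simp only [map_zero, add_zero, sub_zero, zero_sub, zero_mul, neg_eq_zero] at h1 h2
    rcases mul_eq_zero.1 h2 with e3 | e3
    · rw [e3, map_zero, sub_zero] at h1
      exact ⟨e1, e3, normSq_eq_zero.1 h1, e2⟩
    · rw [e3, map_zero, zero_sub, neg_eq_zero] at h1
      exact ⟨e1, normSq_eq_zero.1 h1, e3, e2⟩

/-- The complex coordinates of the pairs cannot all be concentrated in one place. -/
theorem not_all_single (hem : e + m = 3) (hv : IsKernelVector W v) (u : zeroLevel e W)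
    (hU₁ : ∀ i, U₁ u.1 i = 0) (hU₂ : ∀ i, U₂ u.1 i = 0)
    (hPQ : ∀ α, (P₁ u.1 α = 0 ∧ P₂ u.1 α = 0) ∨ (Q₁ u.1 α = 0 ∧ Q₂ u.1 α = 0))
    (h₁₂ : ∀ α, (P₁ u.1 α = 0 ∧ Q₁ u.1 α = 0) ∨ (P₂ u.1 α = 0 ∧ Q₂ u.1 α = 0)) : False := by
  obtain ⟨r, d, hL⟩ := (mem_zeroLevel_iff hv u.1).1 u.2
  -- Each pair has at most one nonzero complex coordinate, so its contribution to the difference of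
  -- the norm equations is `±v_α r`.
  have hr : r = 0 := by
    refine hv.eq_zero_of_sum_eq_zero (f := fun α => (normSq (P₁ u.1 α) + normSq (Q₁ u.1 α))
      - (normSq (P₂ u.1 α) + normSq (Q₂ u.1 α))) (fun α => ?_) ?_
    · have := hL.torus α
      rw [← this]
      rcases hPQ α with ⟨h1, h2⟩ | ⟨h1, h2⟩ <;> rcases h₁₂ α with ⟨h3, h4⟩ | ⟨h3, h4⟩ <;>
        simp [h1, h2, h3, h4]
    · have h1 := hL.norm₁
      have h2 := hL.norm₂
      simp only [hU₁, hU₂, map_zero, mul_zero, Finset.sum_const_zero, zero_add] at h1 h2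
      rw [Finset.sum_sub_distrib, h1, h2, sub_self]
  have h1 := hL.torus 0
  rw [hr, mul_zero] at h1
  refine alive hem hv u.2 0 ?_
  rcases hPQ 0 with ⟨e1, e2⟩ | ⟨e1, e2⟩
  · rw [e1, e2, map_zero, sub_zero, sub_zero] at h1
    exact ⟨e1, e2, normSq_eq_zero_of_sum_eq_zero h1⟩
  · rw [e1, e2, map_zero] at h1
    obtain ⟨h3, h4⟩ := normSq_eq_zero_of_sum_eq_zero (x := P₁ u.1 0) (y := P₂ u.1 0) (by linarith)
    exact ⟨h3, h4, e1, e2⟩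

/-- The sets `{a, a⁻¹}` and `{b, b⁻¹}` are disjoint, and `z α` lies in at most one of them. -/
theorem DiagStab.first_or_second (h : DiagStab z a b u.1) (hab : a ≠ b) (hab' : a * b ≠ 1)
    (α : Fin (m + 1)) :
    (P₁ u.1 α = 0 ∧ Q₁ u.1 α = 0) ∨ (P₂ u.1 α = 0 ∧ Q₂ u.1 α = 0) := by
  by_cases h1 : P₁ u.1 α = 0
  · by_cases h2 : Q₁ u.1 α = 0
    · exact Or.inl ⟨h1, h2⟩
    · have hz := h.q₁ α h2
      refine Or.inr ⟨by_contra fun h' => hab' ?_, by_contra fun h' => hab ?_⟩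
      · rw [← h.p₂ α h', hz, mul_inv_cancel]
      · exact inv_injective (by rw [← hz, h.q₂ α h'])
  · have hz := h.p₁ α h1
    refine Or.inr ⟨by_contra fun h' => hab ?_, by_contra fun h' => hab' ?_⟩
    · rw [← hz, h.p₂ α h']
    · rw [← hz, h.q₂ α h', inv_mul_cancel]

/-- Since `a² ≠ 1`, the value `z α` cannot be both `a` and `a⁻¹`. -/
theorem DiagStab.p_or_q (h : DiagStab z a b u.1) (hab : a = b) (hab' : a * b ≠ 1)
    (α : Fin (m + 1)) :
    (P₁ u.1 α = 0 ∧ P₂ u.1 α = 0) ∨ (Q₁ u.1 α = 0 ∧ Q₂ u.1 α = 0) := by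
  subst hab
  have key : z α = a → z α ≠ a⁻¹ := fun h1 h2 => hab' (by
    rw [← h1]; nth_rewrite 1 [h1]; rw [h2, mul_inv_cancel])
  by_cases hz : z α = a
  · exact Or.inr ⟨by_contra fun h' => key hz (h.q₁ α h'), by_contra fun h' => key hz (h.q₂ α h')⟩
  · exact Or.inl ⟨by_contra fun h' => hz (h.p₁ α h'), by_contra fun hne => hz (h.p₂ α hne)⟩

end signs

/-! ### Upper bounds for the isotropy groups -/

/-- Here `ε` is the sign of `-r`. At a pair with `P = 0` or `Q = 0` the sign of `v_α r` tells which
one survives; this converts that information into the sign of `v_α`, so that a stabilizer reads `z_α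
= w ^ sign v_α` uniformly in `α`. -/
theorem exists_orientation {r : ℝ} (hr : r ≠ 0) : ∃ ε : ℤ, ε * ε = 1 ∧ ∀ n : ℤ,
    (n * r < 0 → n.sign = ε) ∧ (0 < n * r → n.sign = -ε) := by
  have key : ∀ n : ℤ, ((0 : ℝ) < n → n.sign = 1) ∧ ((n : ℝ) < 0 → n.sign = -1) := fun n =>
    ⟨fun h => Int.sign_eq_one_of_pos (by exact_mod_cast h),
      fun h => Int.sign_eq_neg_one_of_neg (by exact_mod_cast h)⟩
  rcases lt_or_gt_of_ne hr with h | h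
  · refine ⟨1, rfl, fun n => ⟨fun hn => (key n).1 ?_, fun hn => (key n).2 ?_⟩⟩
    · exact pos_of_mul_neg_left hn h.le
    · exact neg_of_mul_pos_left hn h.le
  · refine ⟨-1, rfl, fun n => ⟨fun hn => (key n).2 ?_, fun hn => (key n).1 ?_⟩⟩
    · exact neg_of_mul_neg_left hn h.le
    · exact pos_of_mul_pos_left hn h.le

theorem exists_oriented (c : Circle) {r : ℝ} (hr : r ≠ 0) :
    ∃ w : Circle, ∀ n : ℤ, (n * r < 0 → c = w ^ n.sign) ∧ (0 < n * r → c⁻¹ = w ^ n.sign) := by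
  obtain ⟨ε, hε, h⟩ := exists_orientation hr
  refine ⟨c ^ ε, fun n => ⟨fun hn => ?_, fun hn => ?_⟩⟩
  · rw [(h n).1 hn, ← zpow_mul, hε, zpow_one]
  · rw [(h n).2 hn, zpow_neg, ← zpow_mul, hε, zpow_one]

theorem normSq_add_pos {x y : ℂ} (h : ¬ (x = 0 ∧ y = 0)) : 0 < normSq x + normSq y := by
  have hx := normSq_nonneg x
  have hy := normSq_nonneg y
  by_contra hc
  exact h (normSq_eq_zero_of_sum_eq_zero (by linarith))

section cardinality

variable {e m : ℕ} {W : Matrix (Fin m) (Fin (m + 1)) ℤ} {v : Fin (m + 1) → ℤ}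

theorem IsKernelVector.weightSum_pos (hv : IsKernelVector W v) : 0 < weightSum v :=
  Finset.sum_pos (fun α _ => Int.natAbs_pos.2 (hv.ne_zero α)) Finset.univ_nonempty

/-- The isotropy group of a point at which every pair has `P = 0` or `Q = 0`. -/
theorem ncard_torusIsotropy_le_of_p_or_q (hem : e + m = 3) (hv : IsKernelVector W v)
    (u : zeroLevel e W) (hU₁ : ∀ i, U₁ u.1 i = 0) (hU₂ : ∀ i, U₂ u.1 i = 0)
    (hPQ : ∀ α, (P₁ u.1 α = 0 ∧ P₂ u.1 α = 0) ∨ (Q₁ u.1 α = 0 ∧ Q₂ u.1 α = 0)) :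
    (torusIsotropy u : Set (Torus (m + 1))).Finite ∧
      (torusIsotropy u : Set (Torus (m + 1))).ncard ≤ weightSum v := by
  have hfin := ncard_circle_pow_eq hv.weightSum_pos 1
  let F : Circle → Torus (m + 1) := fun w α => w ^ (v α).sign
  have hsub : (torusIsotropy u : Set (Torus (m + 1))) ⊆ F '' {w : Circle | w ^ weightSum v = 1} := by
    intro z hz
    have hprod := ((mem_torusIsotropy_iff hv u z).1 hz).1
    obtain ⟨ν, a, b, h⟩ := exists_smul_diagStab hv hz
    set u' := (((1, ν, 1) : GTilde m) • u : zeroLevel e W)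
    have hcoe : u'.1 = act (rotor W 1) ν (circleToSp1 1) u.1 := coe_smul_eq_act _ u
    have hU₁' : ∀ i, U₁ u'.1 i = 0 := fun i => by rw [hcoe, U₁_act, hU₁, hU₂]; simp
    have hU₂' : ∀ i, U₂ u'.1 i = 0 := fun i => by rw [hcoe, U₂_act, hU₁, hU₂]; simp
    have hPQ' : ∀ α, (P₁ u'.1 α = 0 ∧ P₂ u'.1 α = 0) ∨ (Q₁ u'.1 α = 0 ∧ Q₂ u'.1 α = 0) := fun α => by
      rw [hcoe, P₁_act, P₂_act, Q₁_act, Q₂_act]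
      rcases hPQ α with ⟨h1, h2⟩ | ⟨h1, h2⟩
      · left; rw [h1, h2]; simp
      · right; rw [h1, h2]; simp
    -- If `a ≠ b`, then each pair, already concentrated in `P` or `Q`, would be concentrated in a
    -- first or a second coordinate as well, against `not_all_single`.
    have hab : a = b := by
      by_contra hab
      refine not_all_single hem hv u' hU₁' hU₂' hPQ' fun α => ?_
      by_cases hz : z α = a ∨ z α = a⁻¹
      · rcases hPQ' α with ⟨h1, h2⟩ | ⟨h1, h2⟩
        · by_cases h3 : Q₂ u'.1 α = 0
          · exact Or.inr ⟨h2, h3⟩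
          · refine Or.inl ⟨h1, by_contra fun h4 => hab (inv_injective ?_)⟩
            rw [← h.q₁ α h4, ← h.q₂ α h3]
        · by_cases h3 : P₂ u'.1 α = 0
          · exact Or.inr ⟨h3, h2⟩
          · refine Or.inl ⟨by_contra fun h4 => hab ?_, h1⟩
            rw [← h.p₁ α h4, ← h.p₂ α h3]
      · push Not at hz
        exact Or.inl ⟨by_contra fun h' => hz.1 (h.p₁ α h'), by_contra fun h' => hz.2 (h.q₁ α h')⟩
    subst hab
    obtain ⟨r, d, hL⟩ := (mem_zeroLevel_iff hv u'.1).1 u'.2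
    have hpos : ∀ α, (v α * r < 0 ∧ z α = a) ∨ (0 < v α * r ∧ z α = a⁻¹) := fun α => by
      have ht := hL.torus α
      rcases hPQ' α with ⟨h1, h2⟩ | ⟨h1, h2⟩
      · have hne : ¬ (Q₁ u'.1 α = 0 ∧ Q₂ u'.1 α = 0) := fun h' => alive hem hv u'.2 α ⟨h1, h2, h'⟩
        refine Or.inr ⟨?_, ?_⟩
        · rw [← ht, h1, h2]; simpa using normSq_add_pos hne
        · by_cases h3 : Q₁ u'.1 α = 0
          · exact h.q₂ α fun h4 => hne ⟨h3, h4⟩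
          · exact h.q₁ α h3
      · have hne : ¬ (P₁ u'.1 α = 0 ∧ P₂ u'.1 α = 0) := fun h' =>
          alive hem hv u'.2 α ⟨h'.1, h'.2, h1, h2⟩
        refine Or.inl ⟨?_, ?_⟩
        · rw [← ht, h1, h2]
          have := normSq_add_pos hne
          simp only [map_zero]; linarith
        · by_cases h3 : P₁ u'.1 α = 0
          · exact h.p₂ α fun h4 => hne ⟨h3, h4⟩
          · exact h.p₁ α h3
    have hr : r ≠ 0 := by
      rintro rfl
      have := hpos 0
      simp at this
    obtain ⟨w, hw⟩ := exists_oriented a hr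
    have hzw : ∀ α, z α = w ^ (v α).sign := fun α => by
      rcases hpos α with ⟨h1, h2⟩ | ⟨h1, h2⟩
      · rw [h2]; exact (hw _).1 h1
      · rw [h2]; exact (hw _).2 h1
    refine ⟨w, ?_, funext fun α => (hzw α).symm⟩
    -- The equation `∏ z_α ^ v_α = 1` becomes `w ^ ∑ |v_α| = 1`.
    simp only [hzw, zpow_sign_mul] at hprod
    rwa [Finset.prod_pow_eq_pow_sum] at hprod
  refine ⟨(hfin.1.image F).subset hsub, ?_⟩
  calc _ ≤ _ := Set.ncard_le_ncard hsub (hfin.1.image F)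
    _ ≤ _ := Set.ncard_image_le hfin.1
    _ = _ := hfin.2

/-- The sum of the absolute values of the coordinates of `v` over a set of indices. -/
def partialSum (v : Fin (m + 1) → ℤ) (S : Finset (Fin (m + 1))) : ℕ := ∑ α ∈ S, (v α).natAbs

theorem IsKernelVector.partialSum_pos (hv : IsKernelVector W v) {S : Finset (Fin (m + 1))}
    (hS : S.Nonempty) : 0 < partialSum v S :=
  Finset.sum_pos (fun α _ => Int.natAbs_pos.2 (hv.ne_zero α)) hS

/-- The torus element equal to `η` outside `S` and to `w ^ sign v_α` on `S`. -/
def mixedElement (v : Fin (m + 1) → ℤ) (S : Finset (Fin (m + 1))) (x : Circle × Circle) :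
    Torus (m + 1) := fun α => if α ∈ S then x.2 ^ (v α).sign else x.1

theorem prod_mixedElement (v : Fin (m + 1) → ℤ) (S : Finset (Fin (m + 1))) (x : Circle × Circle) :
    ∏ α, mixedElement v S x α ^ v α = x.1 ^ (∑ α ∈ Sᶜ, v α) * x.2 ^ partialSum v S := by
  rw [← Finset.prod_mul_prod_compl S, mul_comm]
  congr 1
  · rw [zpow_sum_exponents]
    refine Finset.prod_congr rfl fun α hα => ?_
    rw [mixedElement, if_neg (Finset.mem_compl.1 hα)]
  · rw [partialSum, ← Finset.prod_pow_eq_pow_sum]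
    refine Finset.prod_congr rfl fun α hα => ?_
    rw [mixedElement, if_pos hα, zpow_sign_mul]

/-- The left factor must keep `P₁ = Q₁ = 0` at a pair whose second coordinates do not both vanish,
so its off-diagonal entry is zero; no conjugation is needed. -/
theorem exists_diagStab_of_second {z : Torus (m + 1)} (hv : IsKernelVector W v) {u : zeroLevel e W}
    (hz : z ∈ torusIsotropy u) {α : Fin (m + 1)} (h₁ : P₁ u.1 α = 0 ∧ Q₁ u.1 α = 0)
    (h₂ : ¬ (P₂ u.1 α = 0 ∧ Q₂ u.1 α = 0)) : ∃ a b, DiagStab z a b u.1 := by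
  obtain ⟨-, lam, ρ, h⟩ := (mem_torusIsotropy_iff hv u z).1 hz
  refine exists_diagStab_of_cTwo_eq_zero h ?_
  by_cases hP : P₂ u.1 α = 0
  · have hQ : Q₂ u.1 α ≠ 0 := fun h' => h₂ ⟨hP, h'⟩
    have := Q₁_act z lam ρ u.1 α
    rw [h, h₁.2] at this
    simpa [hQ] using this
  · have := P₁_act z lam ρ u.1 α
    rw [h, h₁.1] at this
    simpa [hP] using this

/-- The isotropy group of a point of mixed type: the pairs outside `S` involve only the first
complex coordinates, and the pairs in `S` only one of the second complex coordinates. -/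
theorem ncard_torusIsotropy_le_of_mixed (hem : e + m = 3) (hv : IsKernelVector W v)
    (u : zeroLevel e W) (S : Finset (Fin (m + 1))) (hSne : S.Nonempty)
    (hS : ∀ α ∈ S, P₁ u.1 α = 0 ∧ Q₁ u.1 α = 0)
    (hS' : ∀ α ∈ S, P₂ u.1 α = 0 ∨ Q₂ u.1 α = 0)
    (hSc : ∀ α ∉ S, P₂ u.1 α = 0 ∧ Q₂ u.1 α = 0)
    {β : Fin (m + 1)} (hβ : P₁ u.1 β ≠ 0 ∧ Q₁ u.1 β ≠ 0) :
    (torusIsotropy u : Set (Torus (m + 1))).Finite ∧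
      (torusIsotropy u : Set (Torus (m + 1))).ncard ≤ 2 * partialSum v S := by
  have hfin := ncard_signedRoots (∑ α ∈ Sᶜ, v α) (hv.partialSum_pos hSne)
  have hne : ∀ α ∈ S, ¬ (P₂ u.1 α = 0 ∧ Q₂ u.1 α = 0) := fun α hα h' =>
    alive hem hv u.2 α ⟨(hS α hα).1, h'.1, (hS α hα).2, h'.2⟩
  obtain ⟨α₂, hα₂⟩ := hSne
  have hsub : (torusIsotropy u : Set (Torus (m + 1))) ⊆
      mixedElement v S '' signedRoots (∑ α ∈ Sᶜ, v α) (partialSum v S) := by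
    intro z hz
    have hprod := ((mem_torusIsotropy_iff hv u z).1 hz).1
    obtain ⟨a, b, h⟩ := exists_diagStab_of_second hv hz (hS α₂ hα₂) (hne α₂ hα₂)
    -- The pair `β` has both first coordinates nonzero, so `a = z β = a⁻¹`. Outside `S` the element
    -- is therefore the sign `a`.
    have ha : a ^ 2 = 1 := by
      have h1 := h.p₁ β hβ.1
      have h2 := h.q₁ β hβ.2
      rw [sq]; nth_rewrite 1 [← h1]; rw [h2, inv_mul_cancel]
    have ha' : a⁻¹ = a := by
      rw [inv_eq_iff_mul_eq_one, ← sq, ha]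
    obtain ⟨r, d, hL⟩ := (mem_zeroLevel_iff hv u.1).1 u.2
    have hpos : ∀ α ∈ S, (v α * r < 0 ∧ z α = b) ∨ (0 < v α * r ∧ z α = b⁻¹) := fun α hα => by
      have ht := hL.torus α
      obtain ⟨h1, h2⟩ := hS α hα
      rcases hS' α hα with h3 | h3
      · have h4 : Q₂ u.1 α ≠ 0 := fun h' => hne α hα ⟨h3, h'⟩
        refine Or.inr ⟨?_, h.q₂ α h4⟩
        rw [← ht, h1, h2, h3]
        simpa using h4
      · have h4 : P₂ u.1 α ≠ 0 := fun h' => hne α hα ⟨h', h3⟩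
        refine Or.inl ⟨?_, h.p₂ α h4⟩
        rw [← ht, h1, h2, h3]
        simpa using h4
    have hr : r ≠ 0 := by
      rintro rfl
      have := hpos α₂ hα₂
      simp at this
    obtain ⟨w, hw⟩ := exists_oriented b hr
    have hzw : mixedElement v S (a, w) = z := funext fun α => by
      by_cases hα : α ∈ S
      · rw [mixedElement, if_pos hα]
        rcases hpos α hα with ⟨h1, h2⟩ | ⟨h1, h2⟩
        · rw [h2]; exact ((hw _).1 h1).symm
        · rw [h2]; exact ((hw _).2 h1).symm
      · rw [mixedElement, if_neg hα]
        by_cases h1 : P₁ u.1 α = 0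
        · have h2 : Q₁ u.1 α ≠ 0 := fun h' =>
            alive hem hv u.2 α ⟨h1, (hSc α hα).1, h', (hSc α hα).2⟩
          rw [h.q₁ α h2, ha']
        · rw [h.p₁ α h1]
    refine ⟨(a, w), ⟨ha, ?_⟩, hzw⟩
    rw [← hzw, prod_mixedElement] at hprod
    exact hprod
  refine ⟨(hfin.1.image _).subset hsub, ?_⟩
  calc _ ≤ _ := Set.ncard_le_ncard hsub (hfin.1.image _)
    _ ≤ _ := Set.ncard_image_le hfin.1
    _ = _ := hfin.2

end cardinality

/-! ### The case of `Gr₄(ℝ⁸)` -/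

section theta

variable {W : Matrix (Fin 3) (Fin 4) ℤ} {v : Fin 4 → ℤ}

/-- A sum of at most four forces `|v_α| = 1` for all four coordinates, and then two of them cancel
against the other two with suitable signs. -/
theorem five_le_weightSum (hv : IsKernelVector W v) : 5 ≤ weightSum v := by
  have hpos : ∀ α, 1 ≤ (v α).natAbs := fun α => Int.natAbs_pos.2 (hv.ne_zero α)
  have hsum : weightSum v = (v 0).natAbs + (v 1).natAbs + (v 2).natAbs + (v 3).natAbs :=
    Fin.sum_univ_four _
  by_contra hlt
  have h1 : ∀ α, (v α).natAbs = 1 := by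
    intro α
    have := hpos 0; have := hpos 1; have := hpos 2; have := hpos 3
    fin_cases α <;> simp <;> omega
  choose ε hε using fun α => Int.isUnit_iff_natAbs_eq.2 (h1 α)
  have := hv.signed_sum_ne_zero ![ε 0, ε 1, -ε 2, -ε 3]
  rw [Fin.sum_univ_four] at this
  have hsq : ∀ x : ℤˣ, (x : ℤ) * x = 1 := fun x => by
    rw [← Units.val_mul, Int.units_mul_self, Units.val_one]
  apply this
  simp [← hε, hsq]

theorem exists_odd (hv : IsKernelVector W v) : ∃ α, Odd (v α) := by
  by_contra hne
  push Not at hne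
  obtain ⟨n, hn⟩ := hv.primitive
  have : Even (∑ α, n α * v α) := Finset.even_sum _ fun α _ => by
    have := hne α
    rw [Int.not_odd_iff_even] at this
    exact this.mul_left _
  rw [hn] at this
  exact absurd this (by decide)

/-- All coordinates are signs, and the coordinate with odd exponent is determined by the other three
through `∏ z_α ^ v_α = 1`, so there are at most `2 ^ 3` elements. -/
theorem ncard_torusIsotropy_le_eight (hv : IsKernelVector W v) (u : zeroLevel 0 W)
    (h : ∀ z ∈ torusIsotropy u, ∀ α, z α ^ 2 = 1) :
    (torusIsotropy u : Set (Torus 4)).Finite ∧ (torusIsotropy u : Set (Torus 4)).ncard ≤ 8 := by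
  classical
  obtain ⟨α, hα⟩ := exists_odd hv
  let F : Torus 4 → (Fin 3 → Bool) := fun z i => decide (z (α.succAbove i) = 1)
  have hF : Set.InjOn F (torusIsotropy u) := by
    intro z hz z' hz' hzz
    have hoff : ∀ i, z (α.succAbove i) = z' (α.succAbove i) := fun i => by
      have h1 : z (α.succAbove i) = 1 ↔ z' (α.succAbove i) = 1 := by
        have := congrFun hzz i
        simpa [F] using this
      by_cases h2 : z (α.succAbove i) = 1
      · rw [h2, h1.1 h2]
      · exact circle_eq_of_sq_eq_one (h z hz _) (h z' hz' _) h2 fun h3 => h2 (h1.2 h3)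
    have hp := ((mem_torusIsotropy_iff hv u z).1 hz).1
    have hp' := ((mem_torusIsotropy_iff hv u z').1 hz').1
    rw [Fin.prod_univ_succAbove _ α, zpow_eq_self_of_odd (h z hz α) hα] at hp
    rw [Fin.prod_univ_succAbove _ α, zpow_eq_self_of_odd (h z' hz' α) hα] at hp'
    simp only [hoff] at hp
    have hα' : z α = z' α := mul_right_cancel (hp.trans hp'.symm)
    funext β
    rcases Fin.eq_self_or_eq_succAbove α β with rfl | ⟨i, rfl⟩
    · exact hα'
    · exact hoff i
  have hfin : (F '' (torusIsotropy u : Set (Torus 4))).Finite := Set.toFinite _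
  refine ⟨Set.Finite.of_finite_image hfin hF, ?_⟩
  rw [← hF.ncard_image]
  calc _ ≤ (Set.univ : Set (Fin 3 → Bool)).ncard := Set.ncard_le_ncard (Set.subset_univ _)
    _ = 8 := by rw [Set.ncard_univ, Nat.card_eq_fintype_card]; rfl

/-- The mixed case, with `S` the set of pairs having only second coordinates. It is a proper subset,
which makes `2 * partialSum v S` smaller than `2 * weightSum v`. -/
theorem ncard_torusIsotropy_lt_of_diagStab (hv : IsKernelVector W v) (u : zeroLevel 0 W)
    {z : Torus 4} {a b : Circle} (h : DiagStab z a b u.1) (hab : a ≠ b) (hab' : a * b ≠ 1)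
    (hb : b ^ 2 ≠ 1) :
    (torusIsotropy u : Set (Torus 4)).Finite ∧
      (torusIsotropy u : Set (Torus 4)).ncard < 2 * weightSum v := by
  classical
  have hcase := h.first_or_second hab hab'
  let S : Finset (Fin 4) := Finset.univ.filter fun α => P₁ u.1 α = 0 ∧ Q₁ u.1 α = 0
  have hS : ∀ α ∈ S, P₁ u.1 α = 0 ∧ Q₁ u.1 α = 0 := fun α hα => (Finset.mem_filter.1 hα).2
  have hSc : ∀ α ∉ S, P₂ u.1 α = 0 ∧ Q₂ u.1 α = 0 := fun α hα =>
    (hcase α).resolve_left fun h' => hα (Finset.mem_filter.2 ⟨Finset.mem_univ _, h'⟩)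
  have h₂ : ∀ α, P₂ u.1 α = 0 ∨ Q₂ u.1 α = 0 := fun α => by
    by_contra hne
    push Not at hne
    apply hb
    have h1 := h.p₂ α hne.1
    rw [sq]; nth_rewrite 1 [← h1]; rw [h.q₂ α hne.2, inv_mul_cancel]
  obtain ⟨r, d, hL⟩ := (mem_zeroLevel_iff hv u.1).1 u.2
  have hSne : S.Nonempty := by
    by_contra hne
    rw [Finset.not_nonempty_iff_eq_empty] at hne
    have := hL.norm₂
    simp [fun α => hSc α (by rw [hne]; simp)] at this
  -- Otherwise every pair would have a single nonzero complex coordinate, against `not_all_single`.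
  have hβ : ∃ β, P₁ u.1 β ≠ 0 ∧ Q₁ u.1 β ≠ 0 := by
    by_contra hne
    push Not at hne
    refine not_all_single rfl hv u nofun nofun (fun α => ?_) hcase
    by_cases hα : α ∈ S
    · rcases h₂ α with h1 | h1
      · exact Or.inl ⟨(hS α hα).1, h1⟩
      · exact Or.inr ⟨(hS α hα).2, h1⟩
    · by_cases h1 : P₁ u.1 α = 0
      · exact Or.inl ⟨h1, (hSc α hα).1⟩
      · exact Or.inr ⟨hne α h1, (hSc α hα).2⟩
  obtain ⟨β, hβ⟩ := hβ
  have hmain := ncard_torusIsotropy_le_of_mixed rfl hv u S hSne hS (fun α _ => h₂ α) hSc hβ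
  refine ⟨hmain.1, lt_of_le_of_lt hmain.2 ?_⟩
  have hlt : partialSum v S < weightSum v := by
    refine Finset.sum_lt_sum_of_subset (Finset.subset_univ S) (i := β) (Finset.mem_univ _)
      (fun h' => hβ.1 (hS β h').1) (Int.natAbs_pos.2 (hv.ne_zero β)) fun _ _ _ => Nat.zero_le _
  omega

/-- If all elements are real, the bound is `8 < 2 * 5`. An element that is not real has `a² ≠ 1` or
`b² ≠ 1`. Then either `a = b`, with bound `weightSum v`, or first and second coordinates split;
exactly one of `a`, `b` being a sign is the mixed case up to exchanging the coordinates, and neither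
being a sign is impossible. -/
theorem ncard_torusIsotropy_lt (hv : IsKernelVector W v) (u : zeroLevel 0 W) :
    (torusIsotropy u : Set (Torus 4)).Finite ∧
      (torusIsotropy u : Set (Torus 4)).ncard < 2 * weightSum v := by
  have h5 := five_le_weightSum hv
  by_cases hreal : ∀ z ∈ torusIsotropy u, ∀ α, z α ^ 2 = 1
  · obtain ⟨h1, h2⟩ := ncard_torusIsotropy_le_eight hv u hreal
    exact ⟨h1, by omega⟩
  push Not at hreal
  obtain ⟨z, hz, α, hα⟩ := hreal
  obtain ⟨ν, a, b, h⟩ := exists_smul_diagStab hv hz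
  rw [← torusIsotropy_smul ((1, ν, 1) : GTilde 3) u]
  set u' := (((1, ν, 1) : GTilde 3) • u : zeroLevel 0 W)
  have hzcase := h.apply_cases rfl hv α
  have hinv : ∀ x : Circle, x ^ 2 = 1 → (x⁻¹) ^ 2 = 1 := fun x hx => by rw [inv_pow, hx, inv_one]
  have hnot : ¬ (a ^ 2 = 1 ∧ b ^ 2 = 1) := by
    rintro ⟨h1, h2⟩
    apply hα
    rcases hzcase with h3 | h3 | h3 | h3 <;> rw [h3]
    exacts [h1, hinv a h1, h2, hinv b h2]
  by_cases hab' : a * b = 1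
  · have := h.eq_of_mul_eq_one rfl hv hab'
    subst this
    exact absurd ⟨by rw [sq, hab'], by rw [sq, hab']⟩ hnot
  by_cases hab : a = b
  · obtain ⟨h1, h2⟩ := ncard_torusIsotropy_le_of_p_or_q rfl hv u' nofun nofun (h.p_or_q hab hab')
    exact ⟨h1, by omega⟩
  by_cases ha : a ^ 2 = 1
  · exact ncard_torusIsotropy_lt_of_diagStab hv u' h hab hab' fun hb => hnot ⟨ha, hb⟩
  by_cases hb : b ^ 2 = 1
  · rw [← torusIsotropy_smul ((1, jSp1, 1) : GTilde 3) u']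
    exact ncard_torusIsotropy_lt_of_diagStab hv _ h.swap (Ne.symm hab) (by rwa [mul_comm]) ha
  · exfalso
    refine not_all_single rfl hv u' nofun nofun (fun α => ?_) (h.first_or_second hab hab')
    have hsq : ∀ x : Circle, z α = x → z α = x⁻¹ → x ^ 2 = 1 := fun x h1 h2 => by
      rw [sq]; nth_rewrite 1 [← h1]; rw [h2, inv_mul_cancel]
    rcases h.first_or_second hab hab' α with ⟨h1, h2⟩ | ⟨h1, h2⟩
    · by_cases h3 : P₂ u'.1 α = 0
      · exact Or.inl ⟨h1, h3⟩
      · exact Or.inr ⟨h2, by_contra fun h4 => hb (hsq b (h.p₂ α h3) (h.q₂ α h4))⟩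
    · by_cases h3 : P₁ u'.1 α = 0
      · exact Or.inl ⟨h3, h1⟩
      · exact Or.inr ⟨by_contra fun h4 => ha (hsq a (h.p₁ α h3) (h.q₁ α h4)), h2⟩

end theta

/-! ### Points with large isotropy groups -/

/-- The number `q + ip` is a square root of `δ + 2iy`. Quadratic conditions on real coordinates
thereby become linear conditions on plane vectors, with `p² + q²` as their lengths. -/
theorem exists_real_pair (δ y : ℝ) :
    ∃ p q : ℝ, q ^ 2 - p ^ 2 = δ ∧ p * q = y ∧ p ^ 2 + q ^ 2 = Real.sqrt (δ ^ 2 + 4 * y ^ 2) := by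
  obtain ⟨c, hc⟩ := IsAlgClosed.exists_pow_nat_eq (⟨δ, 2 * y⟩ : ℂ) two_pos
  have h1 := congrArg re hc
  have h2 := congrArg im hc
  simp only [sq, mul_re, mul_im] at h1 h2
  refine ⟨c.im, c.re, by linarith, by linarith, ?_⟩
  rw [← h1, show y = c.re * c.im by linarith, show (c.re * c.re - c.im * c.im) ^ 2
    + 4 * (c.re * c.im) ^ 2 = (c.im ^ 2 + c.re ^ 2) ^ 2 by ring]
  exact (Real.sqrt_sq (by positivity)).symm

/-! ### Continuous invariants of orbits -/

section invariants

theorem normSq_left_mul (lam : Sp1) (x y : ℂ) :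
    normSq (cOne lam * x - conj (cTwo lam) * y) + normSq (cTwo lam * x + conj (cOne lam) * y)
      = normSq x + normSq y := by
  have h := normSq_cOne_add_normSq_cTwo lam
  have : normSq (cOne lam * x - conj (cTwo lam) * y)
      + normSq (cTwo lam * x + conj (cOne lam) * y)
      = (normSq (cOne lam) + normSq (cTwo lam)) * (normSq x + normSq y) := by
    simp only [normSq_apply, add_re, add_im, sub_re, sub_im, mul_re, mul_im, conj_re, conj_im]
    ring
  rw [this, h, one_mul]

/-- The left factor has determinant one as a complex `2 × 2` matrix. -/
theorem wedge_left_mul (lam : Sp1) (x y x' y' : ℂ) :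
    (cOne lam * x - conj (cTwo lam) * y) * (cTwo lam * x' + conj (cOne lam) * y')
      - (cTwo lam * x + conj (cOne lam) * y) * (cOne lam * x' - conj (cTwo lam) * y')
      = x * y' - y * x' := by
  have h : conj (cOne (lam : ℍ[ℝ])) * cOne lam + conj (cTwo (lam : ℍ[ℝ])) * cTwo lam = 1 := by
    rw [← normSq_eq_conj_mul_self, ← normSq_eq_conj_mul_self, ← ofReal_add,
      normSq_cOne_add_normSq_cTwo, ofReal_one]
  linear_combination (x * y' - y * x') * h

variable {e m k : ℕ} {W : Matrix (Fin m) (Fin k) ℤ}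

/-- Twice the square of the norm of a pair. -/
def pairSize (u : QVec e k) (α : Fin k) : ℝ :=
  normSq (P₁ u α) + normSq (P₂ u α) + (normSq (Q₁ u α) + normSq (Q₂ u α))

theorem pairSize_smul (g : GTilde m) (u : zeroLevel e W) (α : Fin k) :
    pairSize (g • u : zeroLevel e W).1 α = pairSize u.1 α := by
  simp only [pairSize, coe_smul_eq_act, P₁_act, P₂_act, Q₁_act, Q₂_act, normSq_mul,
    Circle.normSq_coe, mul_one, normSq_left_mul]

/-- The sum of the squares of the areas spanned by the vectors of two pairs. -/
def pairArea (u : QVec e k) (α β : Fin k) : ℝ :=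
  normSq (P₁ u α * P₂ u β - P₂ u α * P₁ u β) + normSq (P₁ u α * Q₂ u β - P₂ u α * Q₁ u β)
    + (normSq (Q₁ u α * P₂ u β - Q₂ u α * P₁ u β) + normSq (Q₁ u α * Q₂ u β - Q₂ u α * Q₁ u β))

theorem pairArea_smul (g : GTilde m) (u : zeroLevel e W) (α β : Fin k) :
    pairArea (g • u : zeroLevel e W).1 α β = pairArea u.1 α β := by
  have key : ∀ (x y x' y' : ℂ) (s t : Circle),
      normSq ((cOne g.2.1 * x - conj (cTwo g.2.1) * y) * s * g.2.2
          * ((cTwo g.2.1 * x' + conj (cOne g.2.1) * y') * t * g.2.2)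
        - (cTwo g.2.1 * x + conj (cOne g.2.1) * y) * s * g.2.2
          * ((cOne g.2.1 * x' - conj (cTwo g.2.1) * y') * t * g.2.2))
      = normSq (x * y' - y * x') := fun x y x' y' s t => by
    have : (cOne g.2.1 * x - conj (cTwo g.2.1) * y) * s * g.2.2
          * ((cTwo g.2.1 * x' + conj (cOne g.2.1) * y') * t * g.2.2)
        - (cTwo g.2.1 * x + conj (cOne g.2.1) * y) * s * g.2.2
          * ((cOne g.2.1 * x' - conj (cTwo g.2.1) * y') * t * g.2.2)
        = (x * y' - y * x') * s * g.2.2 * t * g.2.2 := by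
      rw [← wedge_left_mul g.2.1 x y x' y']; ring
    rw [this]
    simp only [normSq_mul, Circle.normSq_coe, mul_one]
  simp only [pairArea, coe_smul_eq_act, P₁_act, P₂_act, Q₁_act, Q₂_act, key]

end invariants

section dominated

variable {e m : ℕ} {W : Matrix (Fin m) (Fin (m + 1)) ℤ} {v : Fin (m + 1) → ℤ}

theorem mixedElement_injective (hv : IsKernelVector W v) {S : Finset (Fin (m + 1))}
    {α β : Fin (m + 1)} (hα : α ∈ S) (hβ : β ∉ S) : Function.Injective (mixedElement v S) := by
  intro x y h
  have h1 := congrFun h α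
  have h2 := congrFun h β
  simp only [mixedElement, if_pos hα, if_neg hβ] at h1 h2
  refine Prod.ext h2 ?_
  rcases lt_or_gt_of_ne (hv.ne_zero α) with h3 | h3
  · rw [Int.sign_eq_neg_one_of_neg h3] at h1
    simpa using h1
  · rw [Int.sign_eq_one_of_pos h3] at h1
    simpa using h1

/-- A point at which the pair `α₀` involves only one of the second complex coordinates, and the
other pairs only the first ones. -/
theorem exists_dominated_point (hv : IsKernelVector W v) (hm : 0 < m) (α₀ : Fin (m + 1))
    (p q : Fin m → ℝ)
    (hpq : ∀ i, q i ^ 2 - p i ^ 2 = v (α₀.succAbove i) / |(v α₀ : ℝ)|)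
    (hnorm : ∑ i, (p i ^ 2 + q i ^ 2) = 1) (hquad : ∑ i, p i * q i = 0) :
    ∃ u : zeroLevel e W, (∀ i, pairSize u.1 (α₀.succAbove i) = p i ^ 2 + q i ^ 2) ∧
      ((torusIsotropy u : Set (Torus (m + 1))).Finite →
        2 * (v α₀).natAbs ≤ (torusIsotropy u : Set (Torus (m + 1))).ncard) := by
  have hv0 : (v α₀ : ℝ) ≠ 0 := hv.cast_ne_zero α₀
  let p₁ : Fin (m + 1) → ℂ := Fin.insertNth (α := fun _ => ℂ) α₀ 0 fun i => (p i : ℂ)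
  let q₁ : Fin (m + 1) → ℂ := Fin.insertNth (α := fun _ => ℂ) α₀ 0 fun i => (q i : ℂ)
  let p₂ : Fin (m + 1) → ℂ :=
    Fin.insertNth (α := fun _ => ℂ) α₀ (if 0 < v α₀ then 0 else 1) fun _ => 0
  let q₂ : Fin (m + 1) → ℂ :=
    Fin.insertNth (α := fun _ => ℂ) α₀ (if 0 < v α₀ then 1 else 0) fun _ => 0
  let u₀ : QVec e (m + 1) := ofCoords 0 0 p₁ p₂ q₁ q₂
  have hP₁ : P₁ u₀ = p₁ := P₁_ofCoords _ _ _ _ _ _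
  have hP₂ : P₂ u₀ = p₂ := P₂_ofCoords _ _ _ _ _ _
  have hQ₁ : Q₁ u₀ = q₁ := Q₁_ofCoords _ _ _ _ _ _
  have hQ₂ : Q₂ u₀ = q₂ := Q₂_ofCoords _ _ _ _ _ _
  have hU₁ : U₁ u₀ = 0 := U₁_ofCoords _ _ _ _ _ _
  have hU₂ : U₂ u₀ = 0 := U₂_ofCoords _ _ _ _ _ _
  have hu₀ : u₀ ∈ zeroLevel e W := by
    -- At `α₀` the only nonzero coordinate has modulus `1`, which forces `|r| = 1 / |v α₀|`; it is
    -- put into `Q₂` or `P₂` according to the sign of `v α₀`, so that `r > 0`.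
    refine (mem_zeroLevel_iff hv u₀).2 ⟨1 / |(v α₀ : ℝ)|, 0, ?_, ?_, ?_, ?_, ?_, ?_, ?_, ?_⟩
    · rw [hU₁, hP₁, hQ₁, Fin.sum_univ_succAbove _ α₀]
      simp [p₁, q₁, normSq_ofReal, ← sq, hnorm]
    · rw [hU₂, hP₂, hQ₂, Fin.sum_univ_succAbove _ α₀]
      simp only [p₂, q₂, Fin.insertNth_apply_same, Fin.insertNth_apply_succAbove]
      split_ifs <;> simp
    · rw [hU₂, hP₂, hQ₂, hP₁, hQ₁, Fin.sum_univ_succAbove _ α₀]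
      simp [p₁, q₁, p₂, q₂]
    · rw [hU₁, hP₁, hQ₁, Fin.sum_univ_succAbove _ α₀]
      simp only [p₁, q₁, Fin.insertNth_apply_same, Fin.insertNth_apply_succAbove, ← ofReal_mul,
        ← ofReal_sum, hquad]
      simp
    · rw [hU₂, hP₂, hQ₂, Fin.sum_univ_succAbove _ α₀]
      simp only [p₂, q₂, Fin.insertNth_apply_same, Fin.insertNth_apply_succAbove]
      split_ifs <;> simp
    · rw [hU₂, hP₂, hQ₂, hP₁, hQ₁, Fin.sum_univ_succAbove _ α₀]
      simp [p₁, q₁, p₂, q₂]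
    · intro α
      rw [hP₂, hQ₂, hP₁, hQ₁]
      rcases Fin.eq_self_or_eq_succAbove α₀ α with rfl | ⟨i, rfl⟩
      · simp only [p₁, q₁, p₂, q₂, Fin.insertNth_apply_same]
        split_ifs with h
        · have : (0 : ℝ) < v α := by exact_mod_cast h
          rw [abs_of_pos this]
          field_simp
          simp
        · have : (v α : ℝ) < 0 := by
            have h1 : (v α : ℝ) ≤ 0 := by exact_mod_cast not_lt.1 h
            exact lt_of_le_of_ne h1 hv0
          rw [abs_of_neg this]
          field_simp
          simp
      · simp only [p₁, q₁, p₂, q₂, Fin.insertNth_apply_succAbove, normSq_ofReal, map_zero]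
        linear_combination hpq i
    · intro α
      rw [hP₂, hQ₂, hP₁, hQ₁]
      rcases Fin.eq_self_or_eq_succAbove α₀ α with rfl | ⟨i, rfl⟩ <;> simp [p₁, q₁, p₂, q₂]
  refine ⟨⟨u₀, hu₀⟩, fun i => ?_, fun hfin => ?_⟩
  · simp only [pairSize, hP₁, hP₂, hQ₁, hQ₂, p₁, q₁, p₂, q₂, Fin.insertNth_apply_succAbove,
      normSq_ofReal, map_zero]
    ring
  -- The stabilizer contains a common sign on the other pairs together with a root at `α₀`, hence `2
  -- |v α₀|` elements. Finiteness is needed for the lower bound because `ncard` is zero on infinite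
  -- sets.
  · have hsub : mixedElement v {α₀} '' signedRoots (∑ α ∈ {α₀}ᶜ, v α) (partialSum v {α₀}) ⊆
        (torusIsotropy (⟨u₀, hu₀⟩ : zeroLevel e W) : Set (Torus (m + 1))) := by
      rintro _ ⟨⟨η, w⟩, ⟨hη, hw⟩, rfl⟩
      have hη' : η⁻¹ = η := by rw [inv_eq_iff_mul_eq_one, ← sq]; exact hη
      refine DiagStab.mem_torusIsotropy hv (a := η) (b := w⁻¹) ?_
        (by rw [prod_mixedElement]; exact hw)
      refine ⟨fun i hi => ?_, fun i hi => ?_, fun α hα => ?_, fun α hα => ?_, fun α hα => ?_,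
        fun α hα => ?_⟩
      · exact absurd (congrFun hU₁ i) hi
      · exact absurd (congrFun hU₂ i) hi
      · rcases Fin.eq_self_or_eq_succAbove α₀ α with rfl | ⟨i, rfl⟩
        · simp [hP₁, p₁] at hα
        · simp [mixedElement]
      · rcases Fin.eq_self_or_eq_succAbove α₀ α with rfl | ⟨i, rfl⟩
        · simp only [hP₂, p₂, Fin.insertNth_apply_same] at hα
          have hneg : v α < 0 := by
            by_contra hc
            exact hα (if_pos (lt_of_le_of_ne (not_lt.1 hc) (hv.ne_zero α).symm))
          simp [mixedElement, Int.sign_eq_neg_one_of_neg hneg]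
        · simp [hP₂, p₂] at hα
      · rcases Fin.eq_self_or_eq_succAbove α₀ α with rfl | ⟨i, rfl⟩
        · simp [hQ₁, q₁] at hα
        · simp [mixedElement, hη']
      · rcases Fin.eq_self_or_eq_succAbove α₀ α with rfl | ⟨i, rfl⟩
        · simp only [hQ₂, q₂, Fin.insertNth_apply_same] at hα
          have hpos : 0 < v α := by
            by_contra hc
            exact hα (if_neg hc)
          simp [mixedElement, Int.sign_eq_one_of_pos hpos]
        · simp [hQ₂, q₂] at hα
    have hpos : 0 < partialSum v {α₀} := hv.partialSum_pos (Finset.singleton_nonempty _)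
    have hps : partialSum v {α₀} = (v α₀).natAbs := Finset.sum_singleton _ _
    have hinj := mixedElement_injective hv (Finset.mem_singleton_self α₀)
      (β := α₀.succAbove ⟨0, hm⟩) (by simp)
    calc 2 * (v α₀).natAbs = (signedRoots (∑ α ∈ {α₀}ᶜ, v α) (partialSum v {α₀})).ncard := by
          rw [(ncard_signedRoots _ hpos).2, hps]
      _ = _ := (Set.ncard_image_of_injective _ hinj).symm
      _ ≤ _ := Set.ncard_le_ncard hsub hfin

end dominated

/-! ### Families of points with large isotropy groups -/

section families

variable {e m : ℕ} {W : Matrix (Fin m) (Fin (m + 1)) ℤ} {v : Fin (m + 1) → ℤ}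

/-- A point at which every pair has `P = 0` or `Q = 0`, with real coordinates. -/
theorem exists_polygon_point (hv : IsKernelVector W v) (a b : Fin (m + 1) → ℝ)
    (ha : ∑ α, a α ^ 2 = 1) (hb : ∑ α, b α ^ 2 = 1) (hab : ∑ α, a α * b α = 0)
    (hlen : ∀ α, a α ^ 2 + b α ^ 2 = |(v α : ℝ)| * (2 / weightSum v)) :
    ∃ u : zeroLevel e W, (∀ α β, pairArea u.1 α β = (a α * b β - b α * a β) ^ 2) ∧
      ((torusIsotropy u : Set (Torus (m + 1))).Finite →
        weightSum v ≤ (torusIsotropy u : Set (Torus (m + 1))).ncard) := by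
  classical
  let p₁ : Fin (m + 1) → ℂ := fun α => if 0 < v α then 0 else a α
  let p₂ : Fin (m + 1) → ℂ := fun α => if 0 < v α then 0 else b α
  let q₁ : Fin (m + 1) → ℂ := fun α => if 0 < v α then a α else 0
  let q₂ : Fin (m + 1) → ℂ := fun α => if 0 < v α then b α else 0
  let u₀ : QVec e (m + 1) := ofCoords 0 0 p₁ p₂ q₁ q₂
  have hP₁ : P₁ u₀ = p₁ := P₁_ofCoords _ _ _ _ _ _
  have hP₂ : P₂ u₀ = p₂ := P₂_ofCoords _ _ _ _ _ _
  have hQ₁ : Q₁ u₀ = q₁ := Q₁_ofCoords _ _ _ _ _ _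
  have hQ₂ : Q₂ u₀ = q₂ := Q₂_ofCoords _ _ _ _ _ _
  have hU₁ : U₁ u₀ = 0 := U₁_ofCoords _ _ _ _ _ _
  have hU₂ : U₂ u₀ = 0 := U₂_ofCoords _ _ _ _ _ _
  have hu₀ : u₀ ∈ zeroLevel e W := by
    -- The total norm is `2`, and the pair `α` has size `|v_α| r`, which gives `r = 2 / weightSum
    -- v`.
    refine (mem_zeroLevel_iff hv u₀).2 ⟨2 / weightSum v, 0, ?_, ?_, ?_, ?_, ?_, ?_, ?_, ?_⟩
    · have : ∀ α, normSq (p₁ α) + normSq (q₁ α) = a α ^ 2 := fun α => by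
        simp only [p₁, q₁]; split_ifs <;> simp [normSq_ofReal, sq]
      simp [hU₁, hP₁, hQ₁, this, ha]
    · have : ∀ α, normSq (p₂ α) + normSq (q₂ α) = b α ^ 2 := fun α => by
        simp only [p₂, q₂]; split_ifs <;> simp [normSq_ofReal, sq]
      simp [hU₂, hP₂, hQ₂, this, hb]
    · have : ∀ α, p₁ α * conj (p₂ α) + q₁ α * conj (q₂ α) = ((a α * b α : ℝ) : ℂ) := fun α => by
        simp only [p₁, q₁, p₂, q₂]; split_ifs <;> simp
      simp only [hU₁, hP₁, hQ₁, hP₂, hQ₂, this]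
      rw [← ofReal_sum, hab]
      simp
    · have : ∀ α, p₁ α * q₁ α = 0 := fun α => by
        simp only [p₁, q₁]; split_ifs <;> simp
      simp [hU₁, hP₁, hQ₁, this]
    · have : ∀ α, p₂ α * q₂ α = 0 := fun α => by
        simp only [p₂, q₂]; split_ifs <;> simp
      simp [hU₂, hP₂, hQ₂, this]
    · have : ∀ α, p₁ α * q₂ α + p₂ α * q₁ α = 0 := fun α => by
        simp only [p₁, p₂, q₁, q₂]; split_ifs <;> simp
      simp [hU₁, hP₁, hQ₁, hP₂, hQ₂, this]
    · intro α
      have h1 := hlen α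
      simp only [hP₁, hQ₁, hP₂, hQ₂, p₁, p₂, q₁, q₂]
      split_ifs with h
      · rw [abs_of_pos (by exact_mod_cast h)] at h1
        simp only [normSq_ofReal, map_zero]
        linarith
      · rw [abs_of_nonpos (by exact_mod_cast not_lt.1 h)] at h1
        simp only [normSq_ofReal, map_zero]
        linarith
    · intro α
      simp only [hP₁, hQ₁, hP₂, hQ₂, p₁, p₂, q₁, q₂]
      split_ifs <;> simp
  refine ⟨⟨u₀, hu₀⟩, fun α β => ?_, fun hfin => ?_⟩
  · simp only [pairArea, hP₁, hP₂, hQ₁, hQ₂, p₁, q₁, p₂, q₂]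
    split_ifs <;> simp [← ofReal_mul, ← ofReal_sub, normSq_ofReal, sq]
  · let F : Circle → Torus (m + 1) := fun w α => w ^ (v α).sign
    have hsub : F '' {w : Circle | w ^ weightSum v = 1} ⊆
        (torusIsotropy (⟨u₀, hu₀⟩ : zeroLevel e W) : Set (Torus (m + 1))) := by
      rintro _ ⟨w, hw, rfl⟩
      refine DiagStab.mem_torusIsotropy hv (a := w⁻¹) (b := w⁻¹) ?_ ?_
      · have hp : ∀ α, ¬ 0 < v α → F w α = w⁻¹ := fun α hα => by
          have : v α < 0 := lt_of_le_of_ne (not_lt.1 hα) (hv.ne_zero α)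
          simp [F, Int.sign_eq_neg_one_of_neg this]
        have hq : ∀ α, 0 < v α → F w α = w⁻¹⁻¹ := fun α hα => by
          simp [F, Int.sign_eq_one_of_pos hα]
        refine ⟨fun i hi => absurd (congrFun hU₁ i) hi, fun i hi => absurd (congrFun hU₂ i) hi,
          fun α hα => hp α fun h => hα ?_, fun α hα => hp α fun h => hα ?_,
          fun α hα => hq α (by_contra fun h => hα ?_), fun α hα => hq α (by_contra fun h => hα ?_)⟩
        · rw [hP₁]; exact if_pos h
        · rw [hP₂]; exact if_pos h
        · rw [hQ₁]; exact if_neg h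
        · rw [hQ₂]; exact if_neg h
      · simp only [F, zpow_sign_mul]
        rw [Finset.prod_pow_eq_pow_sum]
        exact hw
    have hinj : Function.Injective F := fun x y h => by
      have h1 := congrFun h 0
      simp only [F] at h1
      rcases lt_or_gt_of_ne (hv.ne_zero 0) with h3 | h3
      · rw [Int.sign_eq_neg_one_of_neg h3] at h1
        simpa using h1
      · rw [Int.sign_eq_one_of_pos h3] at h1
        simpa using h1
    calc weightSum v = {w : Circle | w ^ weightSum v = 1}.ncard :=
          (ncard_circle_pow_eq hv.weightSum_pos 1).2.symm
      _ = _ := (Set.ncard_image_of_injective _ hinj).symm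
      _ ≤ _ := Set.ncard_le_ncard hsub hfin

/-- An orbit invariant with infinitely many values separates infinitely many orbits. -/
theorem infinite_of_invariant (φ : zeroLevel e W → ℝ) (hφ : ∀ (g : GTilde m) u, φ (g • u) = φ u)
    {C : zeroLevel e W → Prop} {I : Set ℝ} (hI : I.Infinite) (h : ∀ t ∈ I, ∃ u, C u ∧ φ u = t) :
    ((fun u => (Quotient.mk _ u : Twistor e W)) '' {u | C u}).Infinite := by
  let ψ : Twistor e W → ℝ := Quotient.lift φ (by rintro _ b ⟨g, rfl⟩; exact hφ g b)
  refine Set.Infinite.of_image ψ (hI.mono fun t ht => ?_)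
  obtain ⟨u, hu, rfl⟩ := h t ht
  exact ⟨_, ⟨u, hu, rfl⟩, rfl⟩

end families

/-! ### Plane vectors of prescribed lengths -/

section reals

theorem sqrt_sq_add_le {x y : ℝ} (hy : 0 ≤ y) : Real.sqrt (x ^ 2 + 4 * y ^ 2) ≤ |x| + 2 * y := by
  rw [Real.sqrt_le_left (by positivity)]
  nlinarith [sq_abs x, mul_nonneg (abs_nonneg x) hy]

theorem two_mul_le_sqrt {x y : ℝ} : 2 * y ≤ Real.sqrt (x ^ 2 + 4 * y ^ 2) :=
  Real.le_sqrt_of_sq_le (by nlinarith [sq_nonneg x])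

/-- Intermediate values on `[0, 1]`: at `τ = 0` the sum is at most `|δ₁| + |δ₂| + |δ₃| + 4t`, and at
`τ = 1` the second root alone is at least `2`. -/
theorem exists_sqrt_sum_eq_one {δ₁ δ₂ δ₃ t : ℝ} (ht : 0 ≤ t)
    (h : |δ₁| + |δ₂| + |δ₃| + 4 * t ≤ 1) :
    ∃ τ, Real.sqrt (δ₁ ^ 2 + 4 * t ^ 2) + (Real.sqrt (δ₂ ^ 2 + 4 * τ ^ 2)
      + Real.sqrt (δ₃ ^ 2 + 4 * (-(t + τ)) ^ 2)) = 1 := by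
  have hcont : ContinuousOn (fun τ : ℝ => Real.sqrt (δ₁ ^ 2 + 4 * t ^ 2)
      + (Real.sqrt (δ₂ ^ 2 + 4 * τ ^ 2) + Real.sqrt (δ₃ ^ 2 + 4 * (-(t + τ)) ^ 2)))
      (Set.Icc 0 1) := by fun_prop
  suffices h1 : (1 : ℝ) ∈ Set.Icc _ _ by
    obtain ⟨τ, -, hτ⟩ := intermediate_value_Icc zero_le_one hcont h1
    exact ⟨τ, hτ⟩
  constructor
  · have h1 := sqrt_sq_add_le (x := δ₁) ht
    have h3 := sqrt_sq_add_le (x := δ₃) ht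
    simp only [add_zero, neg_sq, ne_eq, OfNat.ofNat_ne_zero, not_false_eq_true, zero_pow,
      mul_zero, Real.sqrt_sq_eq_abs]
    linarith
  · have h1 := Real.sqrt_nonneg (δ₁ ^ 2 + 4 * t ^ 2)
    have h2 := two_mul_le_sqrt (x := δ₂) (y := 1)
    have h3 := Real.sqrt_nonneg (δ₃ ^ 2 + 4 * (-(t + 1)) ^ 2)
    linarith

/-- The vertex of a triangle with sides `x`, `y`, `d`, the side `d` being horizontal. -/
theorem exists_triangle {x y d : ℝ} (hd : 0 < d) (h1 : |x - y| ≤ d) (h2 : d ≤ x + y) :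
    ∃ X Y : ℝ, 2 * d * X = d ^ 2 + x ^ 2 - y ^ 2 ∧ X ^ 2 + 4 * Y ^ 2 = x ^ 2 ∧
      (d - X) ^ 2 + 4 * Y ^ 2 = y ^ 2 := by
  obtain ⟨h3, h4⟩ := abs_le.1 h1
  let X := (d ^ 2 + x ^ 2 - y ^ 2) / (2 * d)
  have hX : 2 * d * X = d ^ 2 + x ^ 2 - y ^ 2 := by simp only [X]; field_simp
  have hX2 : (2 * d) ^ 2 * X ^ 2 = (d ^ 2 + x ^ 2 - y ^ 2) ^ 2 := by rw [← mul_pow, hX]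
  have hpos : 0 ≤ x ^ 2 - X ^ 2 := by
    -- Heron's formula: the triangle inequalities make all four factors nonnegative.
    have heron : (2 * d) ^ 2 * (x ^ 2 - X ^ 2)
        = ((x + d + y) * (x + d - y)) * ((y + x - d) * (y - x + d)) := by
      rw [mul_sub, hX2]; ring
    have : 0 ≤ (2 * d) ^ 2 * (x ^ 2 - X ^ 2) := by
      rw [heron]
      refine mul_nonneg (mul_nonneg ?_ ?_) (mul_nonneg ?_ ?_) <;> linarith
    exact nonneg_of_mul_nonneg_right this (by positivity)
  have hY : (2 : ℝ) ^ 2 * (Real.sqrt (x ^ 2 - X ^ 2) / 2) ^ 2 = x ^ 2 - X ^ 2 := by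
    rw [← mul_pow, mul_div_cancel₀ _ two_ne_zero, Real.sq_sqrt hpos]
  refine ⟨X, Real.sqrt (x ^ 2 - X ^ 2) / 2, hX, by linarith, ?_⟩
  linear_combination hY - hX

end reals

/-! ### Infinitely many large isotropy groups and a small one in the case of eight coordinates -/

section theta

variable {W : Matrix (Fin 3) (Fin 4) ℤ} {v : Fin 4 → ℤ}

/-- Equality would be a vanishing signed sum; it would correspond to a degenerate quadrilateral. -/
theorem two_mul_natAbs_ne_weightSum (hv : IsKernelVector W v) (α : Fin 4) :
    2 * (v α).natAbs ≠ weightSum v := by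
  intro h
  have hs : ∀ x : ℤ, ∃ ε : ℤˣ, (ε : ℤ) * x = x.natAbs := fun x => by
    rcases le_total 0 x with hx | hx
    · exact ⟨1, by simp [abs_of_nonneg hx]⟩
    · exact ⟨-1, by simp [abs_of_nonpos hx]⟩
  choose ε hε using fun β => hs (v β)
  apply hv.signed_sum_ne_zero fun β => if β = α then -ε β else ε β
  rw [weightSum, Fin.sum_univ_succAbove _ α] at h
  rw [Fin.sum_univ_succAbove _ α]
  simp only [if_true, Fin.succAbove_ne, if_false, hε, Units.val_neg, neg_mul]
  rw [← Nat.cast_sum]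
  omega

/-- Infinitely many points whose isotropy group has order at least `weightSum v`. -/
theorem infinite_large_isotropy (hv : IsKernelVector W v) :
    ((fun u => (Quotient.mk _ u : Twistor 0 W)) ''
      {u | weightSum v ≤ (torusIsotropy u : Set (Torus 4)).ncard}).Infinite := by
  by_cases hdom : ∃ α₀, weightSum v < 2 * (v α₀).natAbs
  · obtain ⟨α₀, hα₀⟩ := hdom
    let δ : Fin 3 → ℝ := fun i => v (α₀.succAbove i) / |(v α₀ : ℝ)|
    have hv0 : 0 < |(v α₀ : ℝ)| := abs_pos.2 (hv.cast_ne_zero α₀)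
    have hδ : |δ 0| + |δ 1| + |δ 2| < 1 := by
      simp only [δ, abs_div, abs_abs, ← add_div]
      rw [div_lt_one hv0]
      rw [weightSum, Fin.sum_univ_succAbove _ α₀, Fin.sum_univ_three] at hα₀
      have : (v (α₀.succAbove 0)).natAbs + (v (α₀.succAbove 1)).natAbs
        + (v (α₀.succAbove 2)).natAbs < (v α₀).natAbs := by omega
      have h2 : (((v (α₀.succAbove 0)).natAbs + (v (α₀.succAbove 1)).natAbs
        + (v (α₀.succAbove 2)).natAbs : ℕ) : ℝ) < ((v α₀).natAbs : ℝ) := by exact_mod_cast this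
      simpa [Nat.cast_natAbs] using h2
    -- The slack left by the dominating coordinate leaves `p₀ q₀ = t` free in an interval. The other
    -- two products `τ` and `-(t + τ)` then adjust the norm, and the size of the first of the other
    -- pairs detects `t`.
    let t₀ : ℝ := (1 - (|δ 0| + |δ 1| + |δ 2|)) / 4
    have ht₀ : 0 < t₀ := by simp only [t₀]; linarith
    have hI : ((fun t : ℝ => Real.sqrt (δ 0 ^ 2 + 4 * t ^ 2)) '' Set.Ioo 0 t₀).Infinite := by
      refine (Set.Ioo_infinite ht₀).image fun x hx y hy hxy => ?_
      have h1 := (Real.sqrt_inj (by positivity) (by positivity)).1 hxy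
      exact (sq_eq_sq₀ hx.1.le hy.1.le).1 (by linarith)
    refine infinite_of_invariant (fun u => pairSize u.1 (α₀.succAbove 0))
      (fun g u => pairSize_smul g u _) hI ?_
    rintro _ ⟨t, ht, rfl⟩
    obtain ⟨τ, hτ⟩ := exists_sqrt_sum_eq_one (δ₁ := δ 0) (δ₂ := δ 1) (δ₃ := δ 2) ht.1.le
      (by have := ht.2; simp only [t₀] at this; linarith)
    obtain ⟨p0, q0, h1, h2, h3⟩ := exists_real_pair (δ 0) t
    obtain ⟨p1, q1, h4, h5, h6⟩ := exists_real_pair (δ 1) τ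
    obtain ⟨p2, q2, h7, h8, h9⟩ := exists_real_pair (δ 2) (-(t + τ))
    obtain ⟨u, hu, hu'⟩ := exists_dominated_point (e := 0) hv (by norm_num) α₀ ![p0, p1, p2]
      ![q0, q1, q2] (fun i => by fin_cases i; exacts [h1, h4, h7])
      (by rw [Fin.sum_univ_three]; simp only [Matrix.cons_val]; linarith)
      (by rw [Fin.sum_univ_three]; simp only [Matrix.cons_val]; linarith)
    refine ⟨u, ?_, ?_⟩
    · have := hu' (ncard_torusIsotropy_lt hv u).1
      exact hα₀.le.trans this
    · exact (hu 0).trans h3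
  · push Not at hdom
    have hs : (0 : ℝ) < weightSum v := by exact_mod_cast hv.weightSum_pos
    -- With `c_α = a_α + i b_α`, the conditions on `a` and `b` say that the vectors `c_α²` close up
    -- to a quadrilateral with these side lengths. Its perimeter is `2` and each side is shorter
    -- than `1`.
    let l : Fin 4 → ℝ := fun α => |(v α : ℝ)| * (2 / weightSum v)
    have hl : ∀ α, 0 < l α := fun α =>
      mul_pos (abs_pos.2 (hv.cast_ne_zero α)) (by positivity)
    have hl1 : ∀ α, l α < 1 := fun α => by
      have h1 : 2 * (v α).natAbs < weightSum v :=
        lt_of_le_of_ne (hdom α) (two_mul_natAbs_ne_weightSum hv α)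
      have h2 : ((2 * (v α).natAbs : ℕ) : ℝ) < weightSum v := by exact_mod_cast h1
      simp only [Nat.cast_mul, Nat.cast_natAbs, Int.cast_abs, Nat.cast_ofNat] at h2
      simp only [l]
      rw [mul_div_assoc', div_lt_one hs]
      linarith
    have hlsum : l 0 + l 1 + l 2 + l 3 = 2 := by
      have h1 : (weightSum v : ℝ) = |(v 0 : ℝ)| + |(v 1 : ℝ)| + |(v 2 : ℝ)| + |(v 3 : ℝ)| := by
        rw [weightSum, Fin.sum_univ_four]; simp [Nat.cast_natAbs]
      simp only [l, ← add_mul]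
      rw [← h1]
      field_simp
    have h0 := hl 0; have h1 := hl 1; have h2 := hl 2; have h3 := hl 3
    have k0 := hl1 0; have k1 := hl1 1; have k2 := hl1 2; have k3 := hl1 3
    -- The admissible lengths of the diagonal cutting the quadrilateral into two triangles form a
    -- nondegenerate interval.
    have hlt : max |l 0 - l 1| |l 2 - l 3| < min (l 0 + l 1) (l 2 + l 3) := by
      rw [max_lt_iff, lt_min_iff, lt_min_iff, abs_lt, abs_lt, abs_lt, abs_lt]
      refine ⟨⟨⟨?_, ?_⟩, ⟨?_, ?_⟩⟩, ⟨⟨?_, ?_⟩, ⟨?_, ?_⟩⟩⟩ <;> linarith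
    have hI : ((fun d : ℝ => ((l 0 + l 1) ^ 2 - d ^ 2) / 4) ''
        Set.Ioo (max |l 0 - l 1| |l 2 - l 3|) (min (l 0 + l 1) (l 2 + l 3))).Infinite := by
      refine (Set.Ioo_infinite hlt).image fun x hx y hy hxy => ?_
      have hx0 : 0 ≤ x := le_trans (le_max_of_le_left (abs_nonneg _)) hx.1.le
      have hy0 : 0 ≤ y := le_trans (le_max_of_le_left (abs_nonneg _)) hy.1.le
      exact (sq_eq_sq₀ hx0 hy0).1 (by linarith)
    refine infinite_of_invariant (fun u => pairArea u.1 0 1)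
      (fun g u => pairArea_smul g u _ _) hI ?_
    rintro _ ⟨d, ⟨hd, hd'⟩, rfl⟩
    rw [max_lt_iff] at hd
    rw [lt_min_iff] at hd'
    have hd0 : 0 < d := lt_of_le_of_lt (abs_nonneg _) hd.1
    -- Two triangles are glued along the diagonal `d`: the first two sides add up to `(d, 0)`, the
    -- last two to `(-d, 0)`.
    obtain ⟨X, Y, e1, e2, e3⟩ := exists_triangle hd0 hd.1.le hd'.1.le
    obtain ⟨X', Y', e4, e5, e6⟩ := exists_triangle hd0 hd.2.le hd'.2.le
    obtain ⟨b0, a0, f1, f2, f3⟩ := exists_real_pair X Y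
    obtain ⟨b1, a1, f4, f5, f6⟩ := exists_real_pair (d - X) (-Y)
    obtain ⟨b2, a2, f7, f8, f9⟩ := exists_real_pair (-X') Y'
    obtain ⟨b3, a3, f10, f11, f12⟩ := exists_real_pair (-(d - X')) (-Y')
    rw [e2, Real.sqrt_sq h0.le] at f3
    rw [neg_sq, e3, Real.sqrt_sq h1.le] at f6
    rw [neg_sq, e5, Real.sqrt_sq h2.le] at f9
    rw [neg_sq, neg_sq, e6, Real.sqrt_sq h3.le] at f12
    obtain ⟨u, hu, hu'⟩ := exists_polygon_point (e := 0) hv ![a0, a1, a2, a3] ![b0, b1, b2, b3]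
      (by rw [Fin.sum_univ_four]; simp only [Matrix.cons_val]; linarith)
      (by rw [Fin.sum_univ_four]; simp only [Matrix.cons_val]; linarith)
      (by rw [Fin.sum_univ_four]; simp only [Matrix.cons_val]; linarith)
      (fun α => by
        fin_cases α
        exacts [(add_comm _ _).trans f3, (add_comm _ _).trans f6, (add_comm _ _).trans f9,
          (add_comm _ _).trans f12])
    refine ⟨u, hu' (ncard_torusIsotropy_lt hv u).1, ?_⟩
    rw [hu 0 1]
    simp only [Matrix.cons_val]
    have g0 : a0 ^ 2 = (l 0 + X) / 2 := by linarith
    have g0' : b0 ^ 2 = (l 0 - X) / 2 := by linarith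
    have g1 : a1 ^ 2 = (l 1 + (d - X)) / 2 := by linarith
    have g1' : b1 ^ 2 = (l 1 - (d - X)) / 2 := by linarith
    have : (a0 * b1 - b0 * a1) ^ 2
        = a0 ^ 2 * b1 ^ 2 + b0 ^ 2 * a1 ^ 2 - 2 * (b0 * a0) * (b1 * a1) := by ring
    rw [this, g0, g0', g1, g1', f2, f5]
    linear_combination (1 / 2) * e2 - (1 / 4) * e1

/-- A point with isotropy group of order at most two. -/
theorem exists_small_isotropy (hv : IsKernelVector W v) :
    ∃ u : zeroLevel 0 W, (torusIsotropy u : Set (Torus 4)).ncard ≤ 2 := by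
  -- Taking `P = Q` means `b = 0` in every pair, so the torus moment vanishes. The four quaternions
  -- are half the vectors of a rational orthonormal basis of `ℝ⁴`. The zero in `c₁` makes
  -- stabilizers diagonal, and the nonzero entries of `c₂` make `z` a constant sign.
  let c₁ : Fin 4 → ℂ := ![0, ⟨1 / 3, 1 / 6⟩, ⟨1 / 3, -1 / 3⟩, ⟨-1 / 6, -1 / 3⟩]
  let c₂ : Fin 4 → ℂ := ![⟨1 / 2, 0⟩, ⟨0, 1 / 3⟩, ⟨0, -1 / 6⟩, ⟨0, 1 / 3⟩]
  let u₀ : QVec 0 4 := ofCoords 0 0 c₁ c₂ c₁ c₂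
  have hP₁ : P₁ u₀ = c₁ := P₁_ofCoords _ _ _ _ _ _
  have hP₂ : P₂ u₀ = c₂ := P₂_ofCoords _ _ _ _ _ _
  have hQ₁ : Q₁ u₀ = c₁ := Q₁_ofCoords _ _ _ _ _ _
  have hQ₂ : Q₂ u₀ = c₂ := Q₂_ofCoords _ _ _ _ _ _
  have hu₀ : u₀ ∈ zeroLevel 0 W := by
    refine (mem_zeroLevel_iff hv u₀).2 ⟨0, 0, ?_, ?_, ?_, ?_, ?_, ?_, ?_, ?_⟩
    · simp only [hP₁, hQ₁]
      rw [Fin.sum_univ_four]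
      simp only [c₁, Matrix.cons_val, normSq_mk, map_zero]
      norm_num
    · simp only [hP₂, hQ₂]
      rw [Fin.sum_univ_four]
      simp only [c₂, Matrix.cons_val, normSq_mk]
      norm_num
    · simp only [hP₁, hQ₁, hP₂, hQ₂]
      rw [Fin.sum_univ_four]
      simp only [c₁, c₂, Matrix.cons_val]
      apply Complex.ext <;> simp <;> norm_num
    · simp only [hP₁, hQ₁]
      rw [Fin.sum_univ_four]
      simp only [c₁, Matrix.cons_val]
      apply Complex.ext <;> simp <;> norm_num
    · simp only [hP₂, hQ₂]
      rw [Fin.sum_univ_four]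
      simp only [c₂, Matrix.cons_val]
      apply Complex.ext <;> simp <;> norm_num
    · simp only [hP₁, hQ₁, hP₂, hQ₂]
      rw [Fin.sum_univ_four]
      simp only [c₁, c₂, Matrix.cons_val]
      apply Complex.ext <;> simp <;> norm_num
    · intro α; rw [hP₁, hP₂, hQ₁, hQ₂]; ring
    · intro α; rw [hP₁, hP₂, hQ₁, hQ₂]; ring
  have hc₂ : ∀ α, c₂ α ≠ 0 := by
    intro α
    fin_cases α <;> simp [c₂, Complex.ext_iff]
  have hroots := ncard_circle_pow_eq two_pos 1
  refine ⟨⟨u₀, hu₀⟩, ?_⟩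
  have hsub : (torusIsotropy (⟨u₀, hu₀⟩ : zeroLevel 0 W) : Set (Torus 4)) ⊆
      (fun b : Circle => fun _ => b) '' {w : Circle | w ^ 2 = 1} := by
    intro z hz
    obtain ⟨a, b, h⟩ := exists_diagStab_of_second hv hz (α := 0)
      (by rw [hP₁, hQ₁]; exact ⟨rfl, rfl⟩)
      (by rw [hP₂]; exact fun h => hc₂ 0 h.1)
    have h1 : ∀ α, z α = b := fun α => h.p₂ α (by rw [hP₂]; exact hc₂ α)
    refine ⟨b, ?_, (funext h1).symm⟩
    have h2 := h.q₂ 0 (by rw [hQ₂]; exact hc₂ 0)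
    rw [Set.mem_ofPred_eq, sq]
    nth_rewrite 1 [← h1 0]
    rw [h2, inv_mul_cancel]
  calc _ ≤ _ := Set.ncard_le_ncard hsub (hroots.1.image _)
    _ ≤ _ := Set.ncard_image_le hroots.1
    _ = 2 := hroots.2

end theta

/-! ### The case of `Gr₄(ℝ⁷)` -/

theorem sum_three_succAbove {A : Type*} [AddCommMonoid A] (f : Fin 3 → A) (β : Fin 3) :
    ∑ α, f α = f β + (f (β.succAbove 0) + f (β.succAbove 1)) := by
  rw [Fin.sum_univ_succAbove _ β, Fin.sum_univ_two]

theorem circle_sq_eq_one {w x : Circle} (h : w = x) (h' : w = x⁻¹) : x ^ 2 = 1 := by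
  rw [sq]; nth_rewrite 1 [← h]; rw [h', inv_mul_cancel]

theorem exists_third : ∀ (α : Fin 3) (i : Fin 2),
    ∃ β, ∀ γ, γ = α ∨ γ = α.succAbove i ∨ γ = β := by decide

section omega

variable {W : Matrix (Fin 2) (Fin 3) ℤ} {v : Fin 3 → ℤ}

/-- A point with trivial isotropy group. -/
theorem exists_trivial_isotropy (hv : IsKernelVector W v) :
    ∃ u : zeroLevel 1 W, torusIsotropy u = ⊥ := by
  -- Again `b = 0` in every pair and half an orthonormal basis of `ℝ⁴`, now with `1/2` as single
  -- coordinate. The latter makes stabilizers diagonal with `a = 1`, and the nonzero entries of `c₁`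
  -- give `z = 1`.
  let c₁ : Fin 3 → ℂ := ![⟨0, 1 / 3⟩, ⟨0, -1 / 6⟩, ⟨0, 1 / 3⟩]
  let c₂ : Fin 3 → ℂ := ![⟨1 / 3, 1 / 6⟩, ⟨1 / 3, -1 / 3⟩, ⟨-1 / 6, -1 / 3⟩]
  let u₀ : QVec 1 3 := ofCoords (fun _ => ⟨1 / 2, 0⟩) 0 c₁ c₂ c₁ c₂
  have hP₁ : P₁ u₀ = c₁ := P₁_ofCoords _ _ _ _ _ _
  have hP₂ : P₂ u₀ = c₂ := P₂_ofCoords _ _ _ _ _ _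
  have hQ₁ : Q₁ u₀ = c₁ := Q₁_ofCoords _ _ _ _ _ _
  have hQ₂ : Q₂ u₀ = c₂ := Q₂_ofCoords _ _ _ _ _ _
  have hU₁ : U₁ u₀ = fun _ => ⟨1 / 2, 0⟩ := U₁_ofCoords _ _ _ _ _ _
  have hU₂ : U₂ u₀ = 0 := U₂_ofCoords _ _ _ _ _ _
  have hu₀ : u₀ ∈ zeroLevel 1 W := by
    refine (mem_zeroLevel_iff hv u₀).2 ⟨0, 0, ?_, ?_, ?_, ?_, ?_, ?_, ?_, ?_⟩
    · simp only [hU₁, hP₁, hQ₁]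
      rw [Fin.sum_univ_three]
      simp only [c₁, Matrix.cons_val, normSq_mk, Fin.sum_univ_one]
      norm_num
    · simp only [hU₂, hP₂, hQ₂]
      rw [Fin.sum_univ_three]
      simp only [c₂, Matrix.cons_val, normSq_mk, Fin.sum_univ_one, Pi.zero_apply, map_zero]
      norm_num
    · simp only [hU₂, hP₁, hQ₁, hP₂, hQ₂]
      rw [Fin.sum_univ_three]
      simp only [c₁, c₂, Matrix.cons_val]
      apply Complex.ext <;> simp <;> norm_num
    · simp only [hU₁, hP₁, hQ₁]
      rw [Fin.sum_univ_three]
      simp only [c₁, Matrix.cons_val, Fin.sum_univ_one, sq]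
      apply Complex.ext <;> simp <;> norm_num
    · simp only [hU₂, hP₂, hQ₂]
      rw [Fin.sum_univ_three]
      simp only [c₂, Matrix.cons_val]
      apply Complex.ext <;> simp <;> norm_num
    · simp only [hU₂, hP₁, hQ₁, hP₂, hQ₂]
      rw [Fin.sum_univ_three]
      simp only [c₁, c₂, Matrix.cons_val]
      apply Complex.ext <;> simp <;> norm_num
    · intro α; rw [hP₁, hP₂, hQ₁, hQ₂]; ring
    · intro α; rw [hP₁, hP₂, hQ₁, hQ₂]; ring
  have hc₁ : ∀ α, c₁ α ≠ 0 := by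
    intro α
    fin_cases α <;> simp [c₁, Complex.ext_iff]
  refine ⟨⟨u₀, hu₀⟩, (Subgroup.eq_bot_iff_forall _).2 fun z hz => ?_⟩
  have hne : U₁ u₀ 0 ≠ 0 := by rw [hU₁]; simp [Complex.ext_iff]
  obtain ⟨-, lam, ρ, h⟩ := (mem_torusIsotropy_iff hv _ z).1 hz
  have hlam : cTwo lam = 0 := by
    have := U₂_act z lam ρ u₀ 0
    rw [h, hU₂] at this
    simpa [hne] using this
  obtain ⟨a, b, hd⟩ := exists_diagStab_of_cTwo_eq_zero h hlam
  funext α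
  rw [hd.p₁ α (by rw [hP₁]; exact hc₁ α), hd.u₁ 0 hne]
  rfl

/-- The coordinate `β` of `v` exceeds the sum of the other ones in absolute value. -/
def Dominates (v : Fin 3 → ℤ) (β : Fin 3) : Prop :=
  (v (β.succAbove 0)).natAbs + (v (β.succAbove 1)).natAbs < (v β).natAbs

/-- With only two other pairs the conditions describe a triangle with a side of length `1` and
determine the sizes of the pairs. Domination makes this triangle exist. -/
theorem Dominates.exists_large_isotropy (hv : IsKernelVector W v) {β : Fin 3}
    (h : Dominates v β) : ∃ u : zeroLevel 1 W, (torusIsotropy u : Set (Torus 3)).Finite →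
      2 * (v β).natAbs ≤ (torusIsotropy u : Set (Torus 3)).ncard := by
  let δ : Fin 2 → ℝ := fun i => v (β.succAbove i) / |(v β : ℝ)|
  have hv0 : 0 < |(v β : ℝ)| := abs_pos.2 (hv.cast_ne_zero β)
  have hδ : |δ 0| + |δ 1| < 1 := by
    simp only [δ, abs_div, abs_abs, ← add_div]
    rw [div_lt_one hv0]
    have h2 : (((v (β.succAbove 0)).natAbs + (v (β.succAbove 1)).natAbs : ℕ) : ℝ)
      < ((v β).natAbs : ℝ) := by exact_mod_cast h
    simpa [Nat.cast_natAbs] using h2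
  have h0 := abs_nonneg (δ 0)
  have h1 := abs_nonneg (δ 1)
  have s0 := sq_abs (δ 0)
  have s1 := sq_abs (δ 1)
  -- The two sizes are `X` and `1 - X`. Opposite products `±y` require `X² - δ₀² = (1 - X)² - δ₁²`,
  -- which determines `X`.
  let X : ℝ := (1 + δ 0 ^ 2 - δ 1 ^ 2) / 2
  have hX : |δ 0| ≤ X := by simp only [X]; nlinarith
  have hX' : 0 ≤ 1 - X := by simp only [X]; nlinarith
  have hpos : 0 ≤ X ^ 2 - δ 0 ^ 2 := by nlinarith
  let y := Real.sqrt (X ^ 2 - δ 0 ^ 2) / 2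
  have hy : (2 : ℝ) ^ 2 * y ^ 2 = X ^ 2 - δ 0 ^ 2 := by
    rw [← mul_pow, mul_div_cancel₀ _ two_ne_zero, Real.sq_sqrt hpos]
  obtain ⟨p0, q0, e1, e2, e3⟩ := exists_real_pair (δ 0) y
  obtain ⟨p1, q1, e4, e5, e6⟩ := exists_real_pair (δ 1) (-y)
  rw [show δ 0 ^ 2 + 4 * y ^ 2 = X ^ 2 by linarith, Real.sqrt_sq (h0.trans hX)] at e3
  rw [show δ 1 ^ 2 + 4 * (-y) ^ 2 = (1 - X) ^ 2 by simp only [X] at hy ⊢; linarith,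
    Real.sqrt_sq hX'] at e6
  obtain ⟨u, -, hu⟩ := exists_dominated_point (e := 1) hv two_pos β ![p0, p1] ![q0, q1]
    (fun i => by fin_cases i; exacts [e1, e4])
    (by rw [Fin.sum_univ_two]; simp only [Matrix.cons_val]; linarith)
    (by rw [Fin.sum_univ_two]; simp only [Matrix.cons_val]; linarith)
  exact ⟨u, hu⟩

/-- Every pair has `P = 0` or `Q = 0`, and the single coordinates vanish. -/
structure IsSingleType {e k : ℕ} (u : QVec e k) : Prop where
  u₁ : ∀ i, U₁ u i = 0
  u₂ : ∀ i, U₂ u i = 0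
  p_or_q : ∀ α, (P₁ u α = 0 ∧ P₂ u α = 0) ∨ (Q₁ u α = 0 ∧ Q₂ u α = 0)

/-- The pairs in `S` have only one nonzero complex coordinate, which is a second one, and the
second complex coordinates of all other pairs and of the single coordinates vanish. -/
structure IsRigid {e k : ℕ} (S : Finset (Fin k)) (u : QVec e k) : Prop where
  u₂ : ∀ i, U₂ u i = 0
  mem : ∀ α ∈ S, P₁ u α = 0 ∧ Q₁ u α = 0
  mem' : ∀ α ∈ S, P₂ u α = 0 ∨ Q₂ u α = 0
  notMem : ∀ α ∉ S, P₂ u α = 0 ∧ Q₂ u α = 0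

/-- The points with exceptional isotropy groups: they form finitely many orbits. -/
def IsExceptional (u : QVec 1 3) : Prop :=
  IsSingleType u ∨ ∃ α, IsRigid {α}ᶜ u ∨ (IsRigid {α} u ∧ U₁ u 0 = 0)

/-- The isotropy group at a point with splitting pairs. -/
theorem trichotomy_of_split (hv : IsKernelVector W v) (u : zeroLevel 1 W) (hU₂ : U₂ u.1 0 = 0)
    (hcase : ∀ α, (P₁ u.1 α = 0 ∧ Q₁ u.1 α = 0) ∨ (P₂ u.1 α = 0 ∧ Q₂ u.1 α = 0)) :
    (torusIsotropy u : Set (Torus 3)).ncard ≤ 2 ∨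
      (∃ β, Dominates v β ∧ (torusIsotropy u : Set (Torus 3)).ncard ≤ (v β).natAbs) ∨
      ∃ g : GTilde 2, IsExceptional (g • u : zeroLevel 1 W).1 := by
  obtain ⟨r, d, hL⟩ := (mem_zeroLevel_iff hv u.1).1 u.2
  have halive := fun α => alive (e := 1) (m := 2) rfl hv u.2 α
  -- The number of pairs having second coordinates is one or two: zero is excluded by the second
  -- norm equation, three by the first norm and quadratic equations.
  by_cases hone : ∃ β, (P₁ u.1 β = 0 ∧ Q₁ u.1 β = 0) ∧
      ∀ i, P₂ u.1 (β.succAbove i) = 0 ∧ Q₂ u.1 (β.succAbove i) = 0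
  · obtain ⟨β, hβ, hi⟩ := hone
    have hq := hL.quad₂
    rw [sum_three_succAbove _ β] at hq
    simp only [Fin.sum_univ_one, hU₂, hi] at hq
    have hq' : P₂ u.1 β * Q₂ u.1 β = 0 := by linear_combination hq
    have hnm : ∀ α ∉ ({β} : Finset (Fin 3)), P₂ u.1 α = 0 ∧ Q₂ u.1 α = 0 := fun α hα => by
      rcases Fin.eq_self_or_eq_succAbove β α with rfl | ⟨i, rfl⟩
      · simp at hα
      · exact hi i
    have hrig : IsRigid {β} u.1 :=
      ⟨fun i => by rw [Subsingleton.elim i 0]; exact hU₂,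
        fun α hα => by rw [Finset.mem_singleton.1 hα]; exact hβ,
        fun α hα => by rw [Finset.mem_singleton.1 hα]; exact mul_eq_zero.1 hq', hnm⟩
    by_cases hU₁ : U₁ u.1 0 = 0
    · exact Or.inr (Or.inr ⟨1, by rw [one_smul]; exact Or.inr ⟨β, Or.inr ⟨hrig, hU₁⟩⟩⟩)
    right; left
    have hne : ¬ (P₂ u.1 β = 0 ∧ Q₂ u.1 β = 0) := fun h => halive β ⟨hβ.1, h.1, hβ.2, h.2⟩
    refine ⟨β, ?_, ?_⟩
    -- The second norm equation gives `|v_β r| = 1`, while `|v_α r|` is at most the size of each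
    -- other pair. Those sizes add up to `1 - 2|U₁|² < 1`, so `β` dominates.
    · have h1 := hL.norm₁
      have h2 := hL.norm₂
      rw [sum_three_succAbove _ β] at h1 h2
      simp only [Fin.sum_univ_one, hU₂, hi, hβ, map_zero] at h1 h2
      have t := hL.torus β
      have t0 := hL.torus (β.succAbove 0)
      have t1 := hL.torus (β.succAbove 1)
      simp only [hi, hβ, map_zero] at t t0 t1
      have hUpos : 0 < normSq (U₁ u.1 0) := normSq_pos.2 hU₁
      have n1 := normSq_nonneg (P₁ u.1 (β.succAbove 0))
      have n2 := normSq_nonneg (P₁ u.1 (β.succAbove 1))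
      have n3 := normSq_nonneg (Q₁ u.1 (β.succAbove 0))
      have n4 := normSq_nonneg (Q₁ u.1 (β.succAbove 1))
      have a0 : |v (β.succAbove 0) * r| ≤ normSq (P₁ u.1 (β.succAbove 0))
          + normSq (Q₁ u.1 (β.succAbove 0)) := by rw [← t0, abs_le]; constructor <;> linarith
      have a1 : |v (β.succAbove 1) * r| ≤ normSq (P₁ u.1 (β.succAbove 1))
          + normSq (Q₁ u.1 (β.succAbove 1)) := by rw [← t1, abs_le]; constructor <;> linarith
      have a : |v β * r| = 1 := by
        rw [← t]
        rcases mul_eq_zero.1 hq' with h | h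
        · rw [h, map_zero] at h2 ⊢
          rw [abs_of_nonneg] <;> linarith [normSq_nonneg (Q₂ u.1 β)]
        · rw [h, map_zero] at h2 ⊢
          rw [abs_of_nonpos] <;> linarith [normSq_nonneg (P₂ u.1 β)]
      rw [abs_mul] at a0 a1 a
      have hlt : (|(v (β.succAbove 0) : ℝ)| + |(v (β.succAbove 1) : ℝ)|) * |r| <
          |(v β : ℝ)| * |r| := by linarith
      have hlt' := lt_of_mul_lt_mul_right hlt (abs_nonneg r)
      rw [Dominates, ← Nat.cast_lt (α := ℝ)]
      simpa [Nat.cast_natAbs] using hlt'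
    · have hvβ : 0 < (v β).natAbs := Int.natAbs_pos.2 (hv.ne_zero β)
      have hroots := ncard_circle_pow_eq hvβ 1
      have hsub : (torusIsotropy u : Set (Torus 3)) ⊆
          (fun w : Circle => Function.update (1 : Torus 3) β w) ''
            {w : Circle | w ^ (v β).natAbs = 1} := by
        intro z hz
        have hprod := ((mem_torusIsotropy_iff hv u z).1 hz).1
        obtain ⟨a, b, h⟩ := exists_diagStab_of_second hv hz hβ hne
        have ha : a = 1 := h.u₁ 0 hU₁
        have hz1 : ∀ i, z (β.succAbove i) = 1 := fun i => by
          by_cases hp : P₁ u.1 (β.succAbove i) = 0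
          · have hq : Q₁ u.1 (β.succAbove i) ≠ 0 := fun hq =>
              halive _ ⟨hp, (hi i).1, hq, (hi i).2⟩
            rw [h.q₁ _ hq, ha, inv_one]
          · rw [h.p₁ _ hp, ha]
        rw [Fin.prod_univ_succAbove _ β] at hprod
        -- The nonzero single coordinate fixes `a = 1`, so `z` is trivial off `β` and only `z_β ^
        -- v_β = 1` remains.
        simp only [hz1, one_zpow, Finset.prod_const_one, mul_one] at hprod
        refine ⟨z β, ?_, ?_⟩
        · rcases Int.natAbs_eq (v β) with h' | h'
          · rw [h', zpow_natCast] at hprod; exact hprod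
          · rw [h', zpow_neg, inv_eq_one, zpow_natCast] at hprod; exact hprod
        · funext α
          rcases Fin.eq_self_or_eq_succAbove β α with rfl | ⟨i, rfl⟩
          · simp
          · simp [hz1]
      calc _ ≤ _ := Set.ncard_le_ncard hsub (hroots.1.image _)
        _ ≤ _ := Set.ncard_image_le hroots.1
        _ = _ := hroots.2
  have htwo : ∃ α, (P₂ u.1 α = 0 ∧ Q₂ u.1 α = 0) ∧
      ∀ i, P₁ u.1 (α.succAbove i) = 0 ∧ Q₁ u.1 (α.succAbove i) = 0 := by
    have hex : ∃ α, ¬ (P₁ u.1 α = 0 ∧ Q₁ u.1 α = 0) := by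
      by_contra hne
      push Not at hne
      have h1 := hL.norm₁
      have h2 := hL.quad₁
      have h3 : ∀ α, P₁ u.1 α = 0 ∧ Q₁ u.1 α = 0 := fun α => by
        by_contra h
        exact h ⟨(hne α).1, (hne α).2⟩
      simp only [h3, Fin.sum_univ_one, mul_zero, map_zero, add_zero, Finset.sum_const_zero] at h1 h2
      rw [pow_eq_zero_iff two_ne_zero] at h2
      rw [h2] at h1
      simp at h1
    obtain ⟨α, hα⟩ := hex
    refine ⟨α, (hcase α).resolve_left hα, ?_⟩
    by_contra hne
    push Not at hne
    obtain ⟨i, hi⟩ := hne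
    have hi' := (hcase (α.succAbove i)).resolve_left fun h => hi h.1 h.2
    have hα' := (hcase α).resolve_left hα
    obtain ⟨β, hβ⟩ := exists_third α i
    apply hone
    refine ⟨β, ?_, ?_⟩
    · by_contra hc
      have := (hcase β).resolve_left hc
      have h2 := hL.norm₂
      have h3 : ∀ γ, P₂ u.1 γ = 0 ∧ Q₂ u.1 γ = 0 := fun γ => by
        rcases hβ γ with rfl | rfl | rfl
        exacts [hα', hi', this]
      simp [h3, hU₂] at h2
    · intro j
      rcases hβ (β.succAbove j) with h | h | h
      · rw [h]; exact hα'
      · rw [h]; exact hi'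
      · exact absurd h (Fin.succAbove_ne β j)
  obtain ⟨α, hα, hi⟩ := htwo
  by_cases hU₁ : U₁ u.1 0 = 0
  · right; right
    have hq := hL.quad₁
    rw [sum_three_succAbove _ α] at hq
    simp only [Fin.sum_univ_one, hU₁, hi] at hq
    have hq' : P₁ u.1 α * Q₁ u.1 α = 0 := by linear_combination hq
    refine ⟨(1, jSp1, 1), Or.inr ⟨α, Or.inr ⟨?_, ?_⟩⟩⟩
    · obtain ⟨s1, s2⟩ := swap_coords u
      refine ⟨fun i => ?_, fun β hβ => ?_, fun β hβ => ?_, fun β hβ => ?_⟩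
      · rw [Subsingleton.elim i 0, (s1 0).2, hU₁]
      · rw [Finset.mem_singleton.1 hβ, (s2 α).1, (s2 α).2.2.1, hα.1, hα.2]
        simp
      · rw [Finset.mem_singleton.1 hβ, (s2 α).2.1, (s2 α).2.2.2]
        exact mul_eq_zero.1 hq'
      · rcases Fin.eq_self_or_eq_succAbove α β with rfl | ⟨i, rfl⟩
        · simp at hβ
        · rw [(s2 _).2.1, (s2 _).2.2.2]; exact hi i
    · rw [((swap_coords u).1 0).1, hU₂, neg_zero]
  by_cases hrig : ∀ i, P₂ u.1 (α.succAbove i) = 0 ∨ Q₂ u.1 (α.succAbove i) = 0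
  · right; right
    refine ⟨1, ?_⟩
    rw [one_smul]
    refine Or.inr ⟨α, Or.inl ⟨fun i => ?_, fun β hβ => ?_, fun β hβ => ?_, fun β hβ => ?_⟩⟩
    · rw [Subsingleton.elim i 0]; exact hU₂
    · rcases Fin.eq_self_or_eq_succAbove α β with rfl | ⟨i, rfl⟩
      · simp at hβ
      · exact hi i
    · rcases Fin.eq_self_or_eq_succAbove α β with rfl | ⟨i, rfl⟩
      · simp at hβ
      · exact hrig i
    · rcases Fin.eq_self_or_eq_succAbove α β with rfl | ⟨i, rfl⟩
      · exact hα
      · simp [Fin.succAbove_ne] at hβ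
  · left
    have hq := hL.quad₂
    rw [sum_three_succAbove _ α] at hq
    simp only [Fin.sum_univ_one, hU₂, hα] at hq
    have hq' : P₂ u.1 (α.succAbove 0) * Q₂ u.1 (α.succAbove 0)
        + P₂ u.1 (α.succAbove 1) * Q₂ u.1 (α.succAbove 1) = 0 := by linear_combination hq
    -- The two products in the second quadratic equation are opposite, so if one is nonzero both
    -- are. Consequently `b² = 1`, while `a = 1` because `U₁ ≠ 0`.
    have hboth : ∀ i, P₂ u.1 (α.succAbove i) ≠ 0 ∧ Q₂ u.1 (α.succAbove i) ≠ 0 := by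
      simp only [← mul_eq_zero] at hrig
      simp only [← mul_ne_zero_iff]
      push Not at hrig
      obtain ⟨j, hj⟩ := hrig
      intro i
      fin_cases i <;> fin_cases j <;> simp only [Fin.zero_eta, Fin.mk_one] at hj ⊢
      · exact hj
      · intro h; rw [h, zero_add] at hq'; exact hj hq'
      · intro h; rw [h, add_zero] at hq'; exact hj hq'
      · exact hj
    have hroots := ncard_circle_pow_eq two_pos 1
    have hsub : (torusIsotropy u : Set (Torus 3)) ⊆
        (fun w : Circle => Function.update (fun _ => w : Torus 3) α 1) '' {w : Circle | w ^ 2 = 1} := by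
      intro z hz
      obtain ⟨a, b, h⟩ := exists_diagStab_of_second hv hz (hi 0) fun h => (hboth 0).1 h.1
      have ha : a = 1 := h.u₁ 0 hU₁
      have hzb : ∀ i, z (α.succAbove i) = b := fun i => h.p₂ _ (hboth i).1
      refine ⟨b, circle_sq_eq_one (hzb 0) (h.q₂ _ (hboth 0).2), funext fun β => ?_⟩
      rcases Fin.eq_self_or_eq_succAbove α β with rfl | ⟨i, rfl⟩
      · simp only [Function.update_self]
        by_cases hp : P₁ u.1 β = 0
        · have hq : Q₁ u.1 β ≠ 0 := fun hq => halive _ ⟨hp, hα.1, hq, hα.2⟩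
          rw [h.q₁ _ hq, ha, inv_one]
        · rw [h.p₁ _ hp, ha]
      · simp [hzb]
    calc _ ≤ _ := Set.ncard_le_ncard hsub (hroots.1.image _)
      _ ≤ _ := Set.ncard_image_le hroots.1
      _ = _ := hroots.2

/-- The isotropy groups of the points that are not exceptional. -/
theorem isotropy_trichotomy (hv : IsKernelVector W v) (u : zeroLevel 1 W) :
    (torusIsotropy u : Set (Torus 3)).ncard ≤ 2 ∨
      (∃ β, Dominates v β ∧ (torusIsotropy u : Set (Torus 3)).ncard ≤ (v β).natAbs) ∨
      ∃ g : GTilde 2, IsExceptional (g • u : zeroLevel 1 W).1 := by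
  by_cases hconst : ∀ z ∈ torusIsotropy u, ∃ w : Circle, w ^ 2 = 1 ∧ ∀ α, z α = w
  · left
    have hroots := ncard_circle_pow_eq two_pos 1
    have hsub : (torusIsotropy u : Set (Torus 3)) ⊆
        (fun w : Circle => fun _ => w) '' {w : Circle | w ^ 2 = 1} := fun z hz => by
      obtain ⟨w, hw, h⟩ := hconst z hz
      exact ⟨w, hw, (funext h).symm⟩
    calc _ ≤ _ := Set.ncard_le_ncard hsub (hroots.1.image _)
      _ ≤ _ := Set.ncard_image_le hroots.1
      _ = _ := hroots.2
  push Not at hconst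
  obtain ⟨z, hz, hzne⟩ := hconst
  obtain ⟨ν, a, b, h⟩ := exists_smul_diagStab hv hz
  suffices hsuff : ∀ u' : zeroLevel 1 W, (∃ g : GTilde 2, g • u = u') →
      ((torusIsotropy u' : Set (Torus 3)).ncard ≤ 2 ∨
      (∃ β, Dominates v β ∧ (torusIsotropy u' : Set (Torus 3)).ncard ≤ (v β).natAbs) ∨
      ∃ g : GTilde 2, IsExceptional (g • u' : zeroLevel 1 W).1) →
      ((torusIsotropy u : Set (Torus 3)).ncard ≤ 2 ∨
      (∃ β, Dominates v β ∧ (torusIsotropy u : Set (Torus 3)).ncard ≤ (v β).natAbs) ∨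
      ∃ g : GTilde 2, IsExceptional (g • u : zeroLevel 1 W).1) by
    -- If `ab = 1`, then `a = b = ±1` and all coordinates of `z` equal this sign, contrary to its
    -- choice.
    have hab' : a * b ≠ 1 := fun hab => by
      have := h.eq_of_mul_eq_one rfl hv hab
      subst this
      have ha : a⁻¹ = a := inv_eq_of_mul_eq_one_left hab
      obtain ⟨α, hα⟩ := hzne a (by rw [sq]; exact hab)
      rcases h.apply_cases rfl hv α with h1 | h1 | h1 | h1
      · exact hα h1
      · exact hα (h1.trans ha)
      · exact hα h1
      · exact hα (h1.trans ha)
    by_cases hab : a = b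
    · have hU : a ≠ 1 ∧ b ≠ 1 := by
        constructor
        · intro h1; apply hab'; rw [← hab, h1, one_mul]
        · intro h1; apply hab'; rw [hab, h1, one_mul]
      exact Or.inr (Or.inr ⟨(1, ν, 1), Or.inl ⟨fun i => by_contra fun h1 => hU.1 (h.u₁ i h1),
        fun i => by_contra fun h1 => hU.2 (h.u₂ i h1), h.p_or_q hab hab'⟩⟩)
    -- As `a ≠ b`, they are not both `1`, so one of the two single complex coordinates vanishes; `j`
    -- moves the vanishing one to the second place.
    by_cases hU₂ : U₂ (((1, ν, 1) : GTilde 2) • u : zeroLevel 1 W).1 0 = 0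
    · exact hsuff _ ⟨_, rfl⟩ (trichotomy_of_split hv _ hU₂ (h.first_or_second hab hab'))
    · have hb : b = 1 := h.u₂ 0 hU₂
      refine hsuff _ ⟨(1, jSp1, 1) * (1, ν, 1), rfl⟩ ?_
      rw [mul_smul]
      refine trichotomy_of_split hv _ ?_
        (h.swap.first_or_second (Ne.symm hab) (by rwa [mul_comm]))
      rw [((swap_coords _).1 0).2]
      by_contra h1
      exact hab ((h.u₁ 0 h1).trans hb.symm)
  rintro _ ⟨g, rfl⟩ h'
  rw [torusIsotropy_smul] at h'
  rcases h' with hle | hdom | ⟨g', hexc⟩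
  · exact Or.inl hle
  · exact Or.inr (Or.inl hdom)
  · exact Or.inr (Or.inr ⟨g' * g, by rw [mul_smul]; exact hexc⟩)

end omega

/-! ### The exceptional points form finitely many orbits -/

theorem exists_circle_mul_eq {x y : ℂ} (h : normSq x = normSq y) : ∃ w : Circle, y = w * x := by
  by_cases hx : x = 0
  · rw [hx, map_zero, eq_comm, normSq_eq_zero] at h
    exact ⟨1, by simp [hx, h]⟩
  · obtain ⟨w, hw⟩ := exists_circle_coe_eq (c := y / x) (by
      rw [map_div₀, ← h, div_self (normSq_eq_zero.not.2 hx)])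
    exact ⟨w, by rw [hw, div_mul_cancel₀ _ hx]⟩

theorem exists_sp1 {c₁ c₂ : ℂ} (h : normSq c₁ + normSq c₂ = 1) :
    ∃ lam : Sp1, cOne lam = c₁ ∧ cTwo lam = c₂ := by
  have hn : Quaternion.normSq (ofPair c₁ c₂) = 1 := by
    rw [Quaternion.normSq_eq_norm_mul_self, ← sq, norm_sq_eq, cOne_ofPair, cTwo_ofPair, h]
  refine ⟨⟨ofPair c₁ c₂, ?_⟩, cOne_ofPair _ _, cTwo_ofPair _ _⟩
  rw [Unitary.mem_iff, Quaternion.star_mul_self, Quaternion.self_mul_star, hn]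
  simp

/-- The cross product of two vectors in `ℂ³`. -/
def cross (x y : Fin 3 → ℂ) : Fin 3 → ℂ :=
  ![x 1 * y 2 - x 2 * y 1, x 2 * y 0 - x 0 * y 2, x 0 * y 1 - x 1 * y 0]

/-- Two orthonormal vectors in `ℂ³` and the conjugate of their cross product form a unitary
matrix. -/
theorem gram_add_cross {x y : Fin 3 → ℂ} (hx : ∑ α, normSq (x α) = 1)
    (hy : ∑ α, normSq (y α) = 1) (hxy : ∑ α, x α * conj (y α) = 0) (α β : Fin 3) :
    conj (x α) * x β + conj (y α) * y β + cross x y α * conj (cross x y β)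
      = (1 : Matrix (Fin 3) (Fin 3) ℂ) α β := by
  have hx' : ∑ α, x α * conj (x α) = 1 := by
    simp only [mul_conj, ← ofReal_sum, hx, ofReal_one]
  have hy' : ∑ α, y α * conj (y α) = 1 := by
    simp only [mul_conj, ← ofReal_sum, hy, ofReal_one]
  have hyx : ∑ α, y α * conj (x α) = 0 := by
    have := congrArg conj hxy
    rw [map_sum, map_zero] at this
    rw [← this]
    refine Finset.sum_congr rfl fun α _ => ?_
    rw [map_mul, conj_conj, mul_comm]
  simp only [Fin.sum_univ_three] at hx' hy' hxy hyx
  let M : Matrix (Fin 3) (Fin 3) ℂ := ![x, y, fun α => conj (cross x y α)]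
  have hM : M * M.conjTranspose = 1 := by
    ext i j
    rw [Matrix.mul_apply, Fin.sum_univ_three]
    simp only [Matrix.conjTranspose_apply]
    fin_cases i <;> fin_cases j <;>
      simp only [M, cross, Matrix.cons_val, Fin.zero_eta, Fin.mk_one, Fin.reduceFinMk, star_def,
        conj_conj, map_mul, map_sub, Matrix.one_apply_eq, Fin.isValue, Matrix.one_apply,
        Fin.reduceEq, if_false]
    · linear_combination hx'
    · linear_combination hxy
    · ring
    · linear_combination hyx
    · linear_combination hy'
    · ring
    · ring
    · ring
    · linear_combination (y 0 * conj (y 0) + y 1 * conj (y 1) + y 2 * conj (y 2)) * hx' + hy'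
        - (y 0 * conj (x 0) + y 1 * conj (x 1) + y 2 * conj (x 2)) * hxy
  -- Orthonormal rows of a square matrix imply orthonormal columns; the claim is the latter.
  have hM' : M.conjTranspose * M = 1 := mul_eq_one_comm.1 hM
  rw [← hM', Matrix.mul_apply, Fin.sum_univ_three]
  simp only [Matrix.conjTranspose_apply, star_def]
  have h2 : ∀ γ, M 2 γ = conj (cross x y γ) := fun _ => rfl
  rw [h2, h2, conj_conj]
  rfl

/-- Every element of `U(2)` is the product of an element of `SU(2)` and of a scalar. -/
theorem exists_sp1_circle_of_unitary {g : Matrix (Fin 2) (Fin 2) ℂ}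
    (hg : g.conjTranspose * g = 1) : ∃ (lam : Sp1) (ρ : Circle), g 0 0 = cOne lam * ρ ∧
      g 0 1 = -conj (cTwo lam) * ρ ∧ g 1 0 = cTwo lam * ρ ∧ g 1 1 = conj (cOne lam) * ρ := by
  have hentry : ∀ i j, conj (g 0 i) * g 0 j + conj (g 1 i) * g 1 j
      = (1 : Matrix (Fin 2) (Fin 2) ℂ) i j := fun i j => by
    rw [← hg, Matrix.mul_apply, Fin.sum_univ_two]
    simp only [Matrix.conjTranspose_apply, star_def]
  have h00 := hentry 0 0
  have h01 := hentry 0 1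
  have h11 := hentry 1 1
  simp only [Matrix.one_apply_eq, Matrix.one_apply, zero_ne_one, if_false] at h00 h01 h11
  set δ := g 0 0 * g 1 1 - g 0 1 * g 1 0
  have e1 : g 1 1 = δ * conj (g 0 0) := by
    simp only [δ]; linear_combination -(g 1 1) * h00 + g 1 0 * h01
  have e2 : g 0 1 = -(δ * conj (g 1 0)) := by
    simp only [δ]; linear_combination -(g 0 1) * h00 + g 0 0 * h01
  have n0 : normSq (g 0 0) + normSq (g 1 0) = 1 := by
    rw [← normSq_eq_conj_mul_self, ← normSq_eq_conj_mul_self] at h00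
    exact_mod_cast h00
  have n1 : normSq (g 0 1) + normSq (g 1 1) = 1 := by
    rw [← normSq_eq_conj_mul_self, ← normSq_eq_conj_mul_self] at h11
    exact_mod_cast h11
  have hδ : normSq δ = 1 := by
    rw [e1, e2, normSq_neg, normSq_mul, normSq_mul, normSq_conj, normSq_conj] at n1
    linear_combination n1 - normSq δ * n0
  obtain ⟨D, hD⟩ := exists_circle_coe_eq hδ
  -- Dividing by a square root of the determinant brings the matrix into `SU(2)`.
  obtain ⟨ρ, hρ⟩ := circle_exists_pow_eq D two_ne_zero
  have hρδ : (ρ : ℂ) * ρ = δ := by rw [← hD, ← hρ, Circle.coe_pow, sq]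
  have hinv : ((ρ⁻¹ : Circle) : ℂ) * ρ = 1 := by rw [← Circle.coe_mul, inv_mul_cancel]; simp
  have hconj : conj ((ρ⁻¹ : Circle) : ℂ) = ρ := by rw [← Circle.coe_inv_eq_conj, inv_inv]
  obtain ⟨lam, hl1, hl2⟩ := exists_sp1 (c₁ := g 0 0 * ((ρ⁻¹ : Circle) : ℂ))
    (c₂ := g 1 0 * ((ρ⁻¹ : Circle) : ℂ)) (by simp only [normSq_mul, Circle.normSq_coe]; linarith)
  refine ⟨lam, ρ, ?_, ?_, ?_, ?_⟩
  · rw [hl1]; linear_combination -(g 0 0) * hinv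
  · rw [hl2, map_mul, hconj]; linear_combination e2 + conj (g 1 0) * hρδ
  · rw [hl2]; linear_combination -(g 1 0) * hinv
  · rw [hl1, map_mul, hconj]; linear_combination e1 - conj (g 0 0) * hρδ

/-- Two orthonormal pairs of vectors in `ℂ³` with equal coordinate lengths differ by `U(2)` and by
the phases of the coordinates. -/
theorem exists_unitary_phases {x y x' y' : Fin 3 → ℂ} (hx : ∑ α, normSq (x α) = 1)
    (hy : ∑ α, normSq (y α) = 1) (hxy : ∑ α, x α * conj (y α) = 0)
    (hx' : ∑ α, normSq (x' α) = 1) (hy' : ∑ α, normSq (y' α) = 1)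
    (hxy' : ∑ α, x' α * conj (y' α) = 0)
    (hlen : ∀ α, normSq (x α) + normSq (y α) = normSq (x' α) + normSq (y' α)) :
    ∃ (ζ : Fin 3 → Circle) (lam : Sp1) (ρ : Circle), ∀ α,
      x' α = (cOne lam * x α - conj (cTwo lam) * y α) * ζ α * ρ ∧
      y' α = (cTwo lam * x α + conj (cOne lam) * y α) * ζ α * ρ := by
  have hgram := gram_add_cross hx hy hxy
  have hgram' := gram_add_cross hx' hy' hxy'
  -- Columns of a unitary matrix have length one, so equal lengths in the first two rows give equal
  -- moduli in the third.
  have hcross : ∀ α, normSq (cross x y α) = normSq (cross x' y' α) := fun α => by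
    have h1 := hgram α α
    have h2 := hgram' α α
    rw [← normSq_eq_conj_mul_self, ← normSq_eq_conj_mul_self, mul_conj, Matrix.one_apply_eq] at h1 h2
    have h1' : normSq (x α) + normSq (y α) + normSq (cross x y α) = 1 := by exact_mod_cast h1
    have h2' : normSq (x' α) + normSq (y' α) + normSq (cross x' y' α) = 1 := by exact_mod_cast h2
    have := hlen α
    linarith
  choose ξ hξ using fun α => exists_circle_mul_eq (hcross α)
  have hξinv : ∀ α, (ξ α : ℂ) * ((ξ α)⁻¹ : Circle) = 1 := fun α => by
    rw [← Circle.coe_mul, mul_inv_cancel]; simp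
  have hξconj : ∀ α, conj (ξ α : ℂ) = ((ξ α)⁻¹ : Circle) := fun α => (Circle.coe_inv_eq_conj _).symm
  have hξconj' : ∀ α, conj (((ξ α)⁻¹ : Circle) : ℂ) = ξ α := fun α => by
    rw [← Circle.coe_inv_eq_conj, inv_inv]
  -- Multiplying the columns by `ξ⁻¹` makes the third rows of the two unitary matrices agree. The
  -- first two rows then have the same Gram matrix of columns, and `A' A*` is the required element
  -- of `U(2)`.
  let A : Matrix (Fin 2) (Fin 3) ℂ :=
    Matrix.of ![fun α => x α * ((ξ α)⁻¹ : Circle), fun α => y α * ((ξ α)⁻¹ : Circle)]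
  let A' : Matrix (Fin 2) (Fin 3) ℂ := Matrix.of ![x', y']
  have horth : ∀ {s t : Fin 3 → ℂ}, ∑ α, normSq (s α) = 1 → ∑ α, normSq (t α) = 1 →
      ∑ α, s α * conj (t α) = 0 →
      Matrix.of ![s, t] * (Matrix.of ![s, t]).conjTranspose = 1 := fun {s t} hs ht hst => by
    ext i j
    rw [Matrix.mul_apply]
    simp only [Matrix.conjTranspose_apply, star_def]
    fin_cases i <;> fin_cases j <;> simp only [Matrix.of_apply, Matrix.cons_val, Fin.zero_eta,
      Fin.mk_one]
    · simp only [mul_conj, ← ofReal_sum, hs, ofReal_one]; rfl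
    · rw [hst]; rfl
    · have := congrArg conj hst
      rw [map_sum, map_zero] at this
      refine Eq.trans (Finset.sum_congr rfl fun α _ => ?_) this
      rw [map_mul, conj_conj, mul_comm]
    · simp only [mul_conj, ← ofReal_sum, ht, ofReal_one]; rfl
  have hA : A * A.conjTranspose = 1 := by
    refine horth ?_ ?_ ?_
    · simpa only [normSq_mul, Circle.normSq_coe, mul_one] using hx
    · simpa only [normSq_mul, Circle.normSq_coe, mul_one] using hy
    · rw [← hxy]
      refine Finset.sum_congr rfl fun α _ => ?_
      rw [map_mul, hξconj']
      linear_combination (x α * conj (y α)) * hξinv α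
  have hA' : A' * A'.conjTranspose = 1 := horth hx' hy' hxy'
  have hAA : A.conjTranspose * A = A'.conjTranspose * A' := by
    ext α β
    rw [Matrix.mul_apply, Matrix.mul_apply, Fin.sum_univ_two, Fin.sum_univ_two]
    simp only [Matrix.conjTranspose_apply, star_def, A, A', Matrix.of_apply, Matrix.cons_val, map_mul, hξconj']
    have h1 := hgram α β
    have h2 := hgram' α β
    rw [hξ, hξ, map_mul, hξconj] at h2
    by_cases hαβ : α = β
    · subst hαβ
      linear_combination h1 - h2 + (conj (x α) * x α + conj (y α) * y α
        + cross x y α * conj (cross x y α)) * hξinv α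
    · rw [Matrix.one_apply_ne hαβ] at h1 h2
      linear_combination (ξ α : ℂ) * ((ξ β)⁻¹ : Circle) * h1 - h2
  have hg : (A' * A.conjTranspose).conjTranspose * (A' * A.conjTranspose) = 1 := by
    rw [Matrix.conjTranspose_mul, Matrix.conjTranspose_conjTranspose, Matrix.mul_assoc,
      ← Matrix.mul_assoc _ A', ← hAA, Matrix.mul_assoc, hA, Matrix.mul_one, hA]
  have hgA : A' * A.conjTranspose * A = A' := by
    rw [Matrix.mul_assoc, hAA, ← Matrix.mul_assoc, hA', Matrix.one_mul]
  obtain ⟨lam, ρ, g1, g2, g3, g4⟩ := exists_sp1_circle_of_unitary hg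
  refine ⟨fun α => (ξ α)⁻¹, lam, ρ, fun α => ?_⟩
  have h0 := congrFun (congrFun hgA 0) α
  have h1 := congrFun (congrFun hgA 1) α
  rw [Matrix.mul_apply, Fin.sum_univ_two] at h0 h1
  rw [g1, g2] at h0
  rw [g3, g4] at h1
  simp only [A, A', Matrix.of_apply, Matrix.cons_val] at h0 h1
  exact ⟨by rw [← h0]; ring, by rw [← h1]; ring⟩

/-! ### From orbits of the full torus to orbits of the subtorus -/

section orbits

variable {e m : ℕ} {W : Matrix (Fin m) (Fin (m + 1)) ℤ} {v : Fin (m + 1) → ℤ}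

/-- Points that differ by the action of the full torus lie in one orbit if the stabilizer in the
full torus is large enough. -/
theorem exists_smul_eq_of_act (hv : IsKernelVector W v) {u u' : zeroLevel e W}
    {z : Torus (m + 1)} {lam : Sp1} {ρ : Circle} (h : u'.1 = act z lam (circleToSp1 ρ) u.1)
    (hstab : ∀ c : Circle, ∃ z₀ a b, DiagStab z₀ a b u.1 ∧ ∏ α, z₀ α ^ v α = c) :
    ∃ g : GTilde m, g • u = u' := by
  -- Multiplying `z` by an element of the stabilizer with the inverse value of `∏ z_α ^ v_α` brings
  -- it into the image of the torus.
  obtain ⟨z₀, a, b, h₀, hz₀⟩ := hstab (∏ α, z α ^ v α)⁻¹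
  obtain ⟨l, ρ₀, hl⟩ := h₀.exists_act
  obtain ⟨τ, hτ⟩ := (hv.range_rotor (z * z₀)).2 (by
    simp only [Pi.mul_apply, mul_zpow, Finset.prod_mul_distrib, hz₀, mul_inv_cancel])
  refine ⟨(τ, lam * circleToSp1 l, ρ₀ * ρ), Subtype.ext ?_⟩
  rw [coe_smul_eq_act, h]
  conv_rhs => rw [← hl]
  rw [act_act, hτ, map_mul]

theorem Level.pair_ne {r : ℝ} {d : ℂ} {u : QVec e (m + 1)} (hL : Level v r d u) {α : Fin (m + 1)}
    (h : (P₁ u α = 0 ∧ P₂ u α = 0) ∨ (Q₁ u α = 0 ∧ Q₂ u α = 0)) :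
    normSq (P₁ u α) + normSq (P₂ u α) + (normSq (Q₁ u α) + normSq (Q₂ u α)) = |v α * r| ∧
    (v α * r ≤ 0 → Q₁ u α = 0 ∧ Q₂ u α = 0) ∧ (0 ≤ v α * r → P₁ u α = 0 ∧ P₂ u α = 0) := by
  have ht := hL.torus α
  have n1 := normSq_nonneg (P₁ u α)
  have n2 := normSq_nonneg (P₂ u α)
  have n3 := normSq_nonneg (Q₁ u α)
  have n4 := normSq_nonneg (Q₂ u α)
  rcases h with ⟨h1, h2⟩ | ⟨h1, h2⟩
  · rw [h1, h2, map_zero] at ht ⊢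
    refine ⟨?_, fun h => normSq_eq_zero_of_sum_eq_zero (by linarith), fun _ => ⟨rfl, rfl⟩⟩
    rw [← ht, abs_of_nonneg] <;> linarith
  · rw [h1, h2, map_zero] at ht ⊢
    refine ⟨?_, fun _ => ⟨rfl, rfl⟩, fun h => normSq_eq_zero_of_sum_eq_zero (by linarith)⟩
    rw [← ht, abs_of_nonpos] <;> linarith

theorem eq_of_abs_mul_eq {r r' c c' : ℝ} (hrr : 0 < r * r') (hc : c' ≠ 0) (h : |r| * c' = c)
    (h' : |r'| * c' = c) : r = r' := by
  have h1 : |r| = |r'| := mul_right_cancel₀ hc (h.trans h'.symm)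
  rcases abs_eq_abs.1 h1 with h2 | h2
  · exact h2
  · rw [h2] at hrr; nlinarith [sq_nonneg r']

theorem cast_partialSum (S : Finset (Fin (m + 1))) :
    ∑ α ∈ S, |(v α : ℝ)| = partialSum v S := by
  simp [partialSum, Nat.cast_natAbs]

/-- At a rigid point the second norm equation determines `|r|`. -/
theorem IsRigid.abs_mul {S : Finset (Fin (m + 1))} {u : QVec e (m + 1)} (h : IsRigid S u) {r : ℝ}
    {d : ℂ} (hL : Level v r d u) : |r| * partialSum v S = 1 := by
  have h1 := hL.norm₂
  simp only [h.u₂, map_zero, mul_zero, Finset.sum_const_zero, zero_add] at h1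
  rw [← h1, ← cast_partialSum, Finset.mul_sum]
  symm
  rw [← Finset.sum_subset (Finset.subset_univ S)
    (fun α _ hα => by rw [(h.notMem α hα).1, (h.notMem α hα).2]; simp)]
  refine Finset.sum_congr rfl fun α hα => ?_
  have h2 := h.mem α hα
  have := (hL.pair_ne (α := α) (by
    rcases h.mem' α hα with h3 | h3
    · exact Or.inl ⟨h2.1, h3⟩
    · exact Or.inr ⟨h2.2, h3⟩)).1
  rw [h2.1, h2.2, map_zero, zero_add, zero_add, _root_.abs_mul, mul_comm] at this
  exact this

/-- The pairs in `S` can be rotated by `w ^ sign v_α`, compensated by `b`; this changes `∏ z_α ^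
v_α` by `w ^ partialSum v S`, which takes every value. -/
theorem IsRigid.exists_diagStab (hv : IsKernelVector W v) {S : Finset (Fin (m + 1))}
    (hS : S.Nonempty) {u : QVec e (m + 1)} (h : IsRigid S u) {r : ℝ} {d : ℂ} (hL : Level v r d u)
    (c : Circle) : ∃ z₀ a b, DiagStab z₀ a b u ∧ ∏ α, z₀ α ^ v α = c := by
  have hr : r ≠ 0 := by
    rintro rfl
    have := h.abs_mul hL
    simp at this
  obtain ⟨w, hw⟩ := circle_exists_pow_eq c (hv.partialSum_pos hS).ne'
  obtain ⟨ε, -, hε⟩ := exists_orientation hr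
  refine ⟨mixedElement v S (1, w), 1, w ^ ε, ⟨fun _ _ => rfl, fun i hi => absurd (h.u₂ i) hi,
    fun α hα => ?_, fun α hα => ?_, fun α hα => ?_, fun α hα => ?_⟩, ?_⟩
  · rw [mixedElement, if_neg fun hS => hα (h.mem α hS).1]
  · have hαS : α ∈ S := by_contra fun hS => hα (h.notMem α hS).1
    have hp := hL.pair_ne (α := α) (Or.inr ⟨(h.mem α hαS).2, (h.mem' α hαS).resolve_left hα⟩)
    rw [mixedElement, if_pos hαS, (hε (v α)).1 (by
      by_contra hc
      exact hα (hp.2.2 (not_lt.1 hc)).2)]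
  · rw [mixedElement, if_neg fun hS => hα (h.mem α hS).2, inv_one]
  · have hαS : α ∈ S := by_contra fun hS => hα (h.notMem α hS).2
    have hp := hL.pair_ne (α := α) (Or.inl ⟨(h.mem α hαS).1, (h.mem' α hαS).resolve_right hα⟩)
    rw [mixedElement, if_pos hαS, (hε (v α)).2 (by
      by_contra hc
      exact hα (hp.2.1 (not_lt.1 hc)).2), zpow_neg]
  · rw [prod_mixedElement, one_zpow, one_mul, hw]

theorem IsSingleType.abs_mul {u : QVec e (m + 1)} (h : IsSingleType u) {r : ℝ}
    {d : ℂ} (hL : Level v r d u) : |r| * weightSum v = 2 := by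
  have h1 := hL.norm₁
  have h2 := hL.norm₂
  simp only [h.u₁, h.u₂, map_zero, mul_zero, Finset.sum_const_zero, zero_add] at h1 h2
  rw [show (2 : ℝ) = 1 + 1 by norm_num]
  nth_rewrite 1 [← h1]
  rw [← h2, ← Finset.sum_add_distrib]
  change _ * (partialSum v Finset.univ : ℝ) = _
  rw [← cast_partialSum, Finset.mul_sum]
  refine Finset.sum_congr rfl fun α _ => ?_
  have := (hL.pair_ne (h.p_or_q α)).1
  rw [_root_.abs_mul] at this
  linarith

/-- All pairs can be rotated by `w ^ sign v_α` with `a = b` as compensation, and `w ^ weightSum v`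
takes every value. -/
theorem IsSingleType.exists_diagStab (hv : IsKernelVector W v) {u : QVec e (m + 1)}
    (h : IsSingleType u) {r : ℝ} {d : ℂ} (hL : Level v r d u)
    (c : Circle) : ∃ z₀ a b, DiagStab z₀ a b u ∧ ∏ α, z₀ α ^ v α = c := by
  have hr : r ≠ 0 := by
    rintro rfl
    have := h.abs_mul hL
    simp at this
  obtain ⟨w, hw⟩ := circle_exists_pow_eq c hv.weightSum_pos.ne'
  obtain ⟨ε, -, hε⟩ := exists_orientation hr
  have hp : ∀ α, ¬ (P₁ u α = 0 ∧ P₂ u α = 0) → (v α).sign = ε := fun α hα =>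
    (hε (v α)).1 (by
      by_contra hc
      exact hα ((hL.pair_ne (h.p_or_q α)).2.2 (not_lt.1 hc)))
  have hq : ∀ α, ¬ (Q₁ u α = 0 ∧ Q₂ u α = 0) → (v α).sign = -ε := fun α hα =>
    (hε (v α)).2 (by
      by_contra hc
      exact hα ((hL.pair_ne (h.p_or_q α)).2.1 (not_lt.1 hc)))
  refine ⟨fun α => w ^ (v α).sign, w ^ ε, w ^ ε, ⟨fun i hi => absurd (h.u₁ i) hi,
    fun i hi => absurd (h.u₂ i) hi, fun α hα => ?_, fun α hα => ?_, fun α hα => ?_,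
    fun α hα => ?_⟩, ?_⟩
  · rw [hp α fun h' => hα h'.1]
  · rw [hp α fun h' => hα h'.2]
  · rw [hq α fun h' => hα h'.1, zpow_neg]
  · rw [hq α fun h' => hα h'.2, zpow_neg]
  · simp only [zpow_sign_mul]
    rw [Finset.prod_pow_eq_pow_sum]
    exact hw

/-- Coordinates with the same moduli and with quadratic expressions that differ by one phase. -/
theorem exists_phases {k : ℕ} {x x' : ℂ} {p q p' q' : Fin k → ℂ} {κ : Circle}
    (hx : x' ^ 2 = κ * x ^ 2) (hpq : ∀ α, p' α * q' α = κ * (p α * q α))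
    (hp : ∀ α, normSq (p α) = normSq (p' α)) (hq : ∀ α, normSq (q α) = normSq (q' α)) :
    ∃ (a : Circle) (z : Fin k → Circle), x' = a * x ∧ ∀ α,
      p' α = ((a * (z α)⁻¹ : Circle) : ℂ) * p α ∧ q' α = ((a * z α : Circle) : ℂ) * q α := by
  -- A square root of `κ` maps `x` to `x'` up to sign, and the sign is absorbed into the root.
  obtain ⟨a, ha, hax⟩ : ∃ a : Circle, a ^ 2 = κ ∧ x' = a * x := by
    obtain ⟨a, ha⟩ := circle_exists_pow_eq κ two_ne_zero
    have : x' ^ 2 = (a * x) ^ 2 := by rw [hx, ← ha, mul_pow, Circle.coe_pow]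
    rcases sq_eq_sq_iff_eq_or_eq_neg.1 this with h | h
    · exact ⟨a, ha, h⟩
    · obtain ⟨s, hs⟩ := exists_circle_coe_eq (c := -1) (by simp)
      refine ⟨s * a, ?_, by rw [h, Circle.coe_mul, hs]; ring⟩
      have : s ^ 2 = 1 := Circle.ext (by rw [Circle.coe_pow, hs]; simp)
      rw [mul_pow, this, one_mul, ha]
  -- If `p α ≠ 0`, its phase determines `z`, and the relation between the products gives the phase
  -- of `q α`.
  have hz : ∀ α, ∃ z : Circle, p' α = ((a * z⁻¹ : Circle) : ℂ) * p α ∧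
      q' α = ((a * z : Circle) : ℂ) * q α := fun α => by
    by_cases h0 : p α = 0
    · have h0' : p' α = 0 := by rw [← normSq_eq_zero, ← hp, h0, map_zero]
      obtain ⟨w, hw⟩ := exists_circle_mul_eq (hq α)
      exact ⟨a⁻¹ * w, by rw [h0, h0', mul_zero], by rw [mul_inv_cancel_left, hw]⟩
    · obtain ⟨w, hw⟩ := exists_circle_mul_eq (hp α)
      refine ⟨a * w⁻¹, by rw [mul_inv_rev, inv_inv, mul_left_comm, mul_inv_cancel, mul_one, hw], ?_⟩
      have hne : p' α ≠ 0 := by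
        rw [hw]; exact mul_ne_zero (Circle.coe_ne_zero w) h0
      apply mul_left_cancel₀ hne
      rw [hpq, ← mul_assoc a, ← sq, ha, hw, Circle.coe_mul]
      have : (w : ℂ) * ((w⁻¹ : Circle) : ℂ) = 1 := by rw [← Circle.coe_mul, mul_inv_cancel]; simp
      linear_combination -(κ * p α * q α : ℂ) * this
  choose z hz using hz
  exact ⟨a, z, hax, hz⟩

end orbits

/-! ### Uniqueness of exceptional points up to the sign of `r` -/

section omega

variable {W : Matrix (Fin 2) (Fin 3) ℤ} {v : Fin 3 → ℤ}

/-- Rigid points with the same moduli of the first complex coordinates lie in one orbit. -/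
theorem IsRigid.exists_smul_eq (hv : IsKernelVector W v) {S : Finset (Fin 3)} (hS : S.Nonempty)
    {u u' : zeroLevel 1 W} (h : IsRigid S u.1) (h' : IsRigid S u'.1) {r : ℝ} {d d' : ℂ}
    (hL : Level v r d u.1) (hL' : Level v r d' u'.1) {κ : Circle}
    (hU : U₁ u'.1 0 ^ 2 = κ * U₁ u.1 0 ^ 2)
    (hpq : ∀ α, P₁ u'.1 α * Q₁ u'.1 α = κ * (P₁ u.1 α * Q₁ u.1 α))
    (hp : ∀ α, normSq (P₁ u.1 α) = normSq (P₁ u'.1 α))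
    (hq : ∀ α, normSq (Q₁ u.1 α) = normSq (Q₁ u'.1 α)) : ∃ g : GTilde 2, g • u = u' := by
  classical
  obtain ⟨a, z, hU', hz⟩ := exists_phases hU hpq hp hq
  have hw : ∀ α, ∃ w : Circle, α ∈ S →
      P₂ u'.1 α = ((w⁻¹ : Circle) : ℂ) * P₂ u.1 α ∧ Q₂ u'.1 α = w * Q₂ u.1 α := fun α => by
    by_cases hα : α ∈ S
    · have hd : ∀ {y : QVec 1 3}, IsRigid S y →
          (P₁ y α = 0 ∧ P₂ y α = 0) ∨ (Q₁ y α = 0 ∧ Q₂ y α = 0) := fun hy => by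
        rcases hy.mem' α hα with h3 | h3
        · exact Or.inl ⟨(hy.mem α hα).1, h3⟩
        · exact Or.inr ⟨(hy.mem α hα).2, h3⟩
      obtain ⟨e1, e2, e3⟩ := hL.pair_ne (hd h)
      obtain ⟨e1', e2', e3'⟩ := hL'.pair_ne (hd h')
      have hm := h.mem α hα
      have hm' := h'.mem α hα
      have heq := e1.trans e1'.symm
      rw [hm.1, hm.2, hm'.1, hm'.2] at heq
      rcases le_total (v α * r) 0 with hle | hle
      · rw [(e2 hle).2, (e2' hle).2] at heq ⊢
        obtain ⟨w, hw⟩ := exists_circle_mul_eq (x := P₂ u.1 α) (y := P₂ u'.1 α) (by simpa using heq)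
        exact ⟨w⁻¹, fun _ => ⟨by rw [inv_inv, hw], by simp⟩⟩
      · rw [(e3 hle).2, (e3' hle).2] at heq ⊢
        obtain ⟨w, hw⟩ := exists_circle_mul_eq (x := Q₂ u.1 α) (y := Q₂ u'.1 α) (by simpa using heq)
        exact ⟨w, fun _ => ⟨by simp, hw⟩⟩
    · exact ⟨1, fun hα' => absurd hα' hα⟩
  choose w hw using hw
  obtain ⟨l, ρ, hl, hl'⟩ := exists_mul_and_inv_mul a 1
  refine exists_smul_eq_of_act hv (z := fun α => if α ∈ S then w α else z α)
    (lam := circleToSp1 l) (ρ := ρ) ?_ (h.exists_diagStab hv hS hL)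
  refine qvec_ext (fun i => ?_) (fun i => ?_) (fun α => ?_) (fun α => ?_) (fun α => ?_)
    (fun α => ?_)
  · rw [U₁_act_circle, hl, Subsingleton.elim i 0, hU']
  · rw [U₂_act_circle, h.u₂, h'.u₂, mul_zero]
  · rw [P₁_act_circle, hl]
    by_cases hα : α ∈ S
    · rw [(h.mem α hα).1, (h'.mem α hα).1, mul_zero]
    · rw [if_neg hα, (hz α).1]
  · rw [P₂_act_circle, hl', one_mul]
    by_cases hα : α ∈ S
    · rw [if_pos hα, (hw α hα).1]
    · rw [(h.notMem α hα).1, (h'.notMem α hα).1, mul_zero]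
  · rw [Q₁_act_circle, hl]
    by_cases hα : α ∈ S
    · rw [(h.mem α hα).2, (h'.mem α hα).2, mul_zero]
    · rw [if_neg hα, (hz α).2]
  · rw [Q₂_act_circle, hl', one_mul]
    by_cases hα : α ∈ S
    · rw [if_pos hα, (hw α hα).2]
    · rw [(h.notMem α hα).2, (h'.notMem α hα).2, mul_zero]

theorem IsRigid.level_eq (hv : IsKernelVector W v) {S : Finset (Fin 3)} (hS : S.Nonempty)
    {u u' : zeroLevel 1 W} (h : IsRigid S u.1) (h' : IsRigid S u'.1) {r r' : ℝ} {d d' : ℂ}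
    (hL : Level v r d u.1) (hL' : Level v r' d' u'.1) (hrr : 0 < r * r') : r = r' :=
  eq_of_abs_mul_eq hrr (by exact_mod_cast (hv.partialSum_pos hS).ne') (h.abs_mul hL)
    (h'.abs_mul hL')

/-- The equations at the two pairs off `α` are those of a triangle and determine all moduli; the two
products `P₁ Q₁` are opposite, so one phase `κ` relates both. -/
theorem IsRigid.exists_smul_eq_singleton (hv : IsKernelVector W v) {α : Fin 3}
    {u u' : zeroLevel 1 W} (h : IsRigid {α} u.1) (h' : IsRigid {α} u'.1) (hU : U₁ u.1 0 = 0)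
    (hU' : U₁ u'.1 0 = 0) {r r' : ℝ} {d d' : ℂ}
    (hL : Level v r d u.1) (hL' : Level v r' d' u'.1) (hrr : 0 < r * r') :
    ∃ g : GTilde 2, g • u = u' := by
  have hS : ({α} : Finset (Fin 3)).Nonempty := Finset.singleton_nonempty _
  have hr := h.level_eq hv hS h' hL hL' hrr
  subst hr
  have key : ∀ {y : QVec 1 3} {d : ℂ}, IsRigid {α} y → U₁ y 0 = 0 → Level v r d y →
      P₁ y (α.succAbove 0) * Q₁ y (α.succAbove 0) = -(P₁ y (α.succAbove 1) * Q₁ y (α.succAbove 1)) ∧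
      normSq (Q₁ y (α.succAbove 0)) - normSq (P₁ y (α.succAbove 0)) = v (α.succAbove 0) * r ∧
      normSq (Q₁ y (α.succAbove 1)) - normSq (P₁ y (α.succAbove 1)) = v (α.succAbove 1) * r ∧
      normSq (P₁ y (α.succAbove 0)) + normSq (Q₁ y (α.succAbove 0))
        = (1 + (v (α.succAbove 0) * r) ^ 2 - (v (α.succAbove 1) * r) ^ 2) / 2 ∧
      normSq (P₁ y (α.succAbove 1)) + normSq (Q₁ y (α.succAbove 1))
        = (1 - (v (α.succAbove 0) * r) ^ 2 + (v (α.succAbove 1) * r) ^ 2) / 2 := by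
    intro y d h hU hL
    have hm := h.mem α (Finset.mem_singleton_self α)
    have hn : ∀ i, P₂ y (α.succAbove i) = 0 ∧ Q₂ y (α.succAbove i) = 0 := fun i =>
      h.notMem _ (by simp)
    have q1 := hL.quad₁
    have n1 := hL.norm₁
    rw [sum_three_succAbove _ α] at q1 n1
    simp only [Fin.sum_univ_one, hU, hm, map_zero] at q1 n1
    have t0 := hL.torus (α.succAbove 0)
    have t1 := hL.torus (α.succAbove 1)
    simp only [hn, map_zero] at t0 t1
    have hmul : P₁ y (α.succAbove 0) * Q₁ y (α.succAbove 0)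
        = -(P₁ y (α.succAbove 1) * Q₁ y (α.succAbove 1)) := by linear_combination q1
    have hns := congrArg normSq hmul
    rw [normSq_neg, normSq_mul, normSq_mul] at hns
    have t0' : normSq (Q₁ y (α.succAbove 0)) - normSq (P₁ y (α.succAbove 0))
      = v (α.succAbove 0) * r := by linarith
    have t1' : normSq (Q₁ y (α.succAbove 1)) - normSq (P₁ y (α.succAbove 1))
      = v (α.succAbove 1) * r := by linarith
    rw [← t0', ← t1']
    generalize normSq (P₁ y (α.succAbove 0)) = A at *
    generalize normSq (P₁ y (α.succAbove 1)) = B at *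
    generalize normSq (Q₁ y (α.succAbove 0)) = C at *
    generalize normSq (Q₁ y (α.succAbove 1)) = D at *
    have hsum : A + C + (B + D) = 1 := by linarith
    refine ⟨hmul, rfl, rfl, ?_, ?_⟩
    -- Both sides are four times the equal products `AC = BD`. With the sum of the four moduli equal
    -- to one, this becomes linear in `A + C`.
    · have : (A + C) ^ 2 - (C - A) ^ 2 = (B + D) ^ 2 - (D - B) ^ 2 := by linear_combination 4 * hns
      linear_combination (1 - (A + C) + (B + D)) / 2 * hsum + this / 2
    · have : (A + C) ^ 2 - (C - A) ^ 2 = (B + D) ^ 2 - (D - B) ^ 2 := by linear_combination 4 * hns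
      linear_combination (1 + (A + C) - (B + D)) / 2 * hsum - this / 2
  obtain ⟨k1, k2, k3, k4, k5⟩ := key h hU hL
  obtain ⟨l1, l2, l3, l4, l5⟩ := key h' hU' hL'
  have hp : ∀ i, normSq (P₁ u.1 (α.succAbove i)) = normSq (P₁ u'.1 (α.succAbove i)) := by
    intro i
    fin_cases i <;> simp only [Fin.zero_eta, Fin.mk_one] <;> linarith
  have hq : ∀ i, normSq (Q₁ u.1 (α.succAbove i)) = normSq (Q₁ u'.1 (α.succAbove i)) := by
    intro i
    fin_cases i <;> simp only [Fin.zero_eta, Fin.mk_one] <;> linarith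
  obtain ⟨κ, hκ⟩ := exists_circle_mul_eq (x := P₁ u.1 (α.succAbove 0) * Q₁ u.1 (α.succAbove 0))
    (y := P₁ u'.1 (α.succAbove 0) * Q₁ u'.1 (α.succAbove 0)) (by rw [map_mul, map_mul, hp, hq])
  have hm := h.mem α (Finset.mem_singleton_self α)
  have hm' := h'.mem α (Finset.mem_singleton_self α)
  refine h.exists_smul_eq hv hS h' hL hL' (κ := κ) (by rw [hU, hU']; ring) (fun β => ?_)
    (fun β => ?_) (fun β => ?_)
  · rcases Fin.eq_self_or_eq_succAbove α β with rfl | ⟨i, rfl⟩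
    · rw [hm.1, hm'.1]; ring
    · fin_cases i
      · exact hκ
      · rw [k1, l1] at hκ
        simp only [Fin.mk_one]
        linear_combination -hκ
  · rcases Fin.eq_self_or_eq_succAbove α β with rfl | ⟨i, rfl⟩
    · rw [hm.1, hm'.1]
    · exact hp i
  · rcases Fin.eq_self_or_eq_succAbove α β with rfl | ⟨i, rfl⟩
    · rw [hm.2, hm'.2]
    · exact hq i

/-- The pair `α` and the single coordinate satisfy `P₁ Q₁ = -U₁²`, which with the norm and torus
equations determines their moduli. The common phase is that of `U₁²`. -/
theorem IsRigid.exists_smul_eq_compl (hv : IsKernelVector W v) {α : Fin 3}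
    {u u' : zeroLevel 1 W} (h : IsRigid {α}ᶜ u.1) (h' : IsRigid {α}ᶜ u'.1) {r r' : ℝ} {d d' : ℂ}
    (hL : Level v r d u.1) (hL' : Level v r' d' u'.1) (hrr : 0 < r * r') :
    ∃ g : GTilde 2, g • u = u' := by
  have hmem : ∀ i, α.succAbove i ∈ ({α}ᶜ : Finset (Fin 3)) := fun i => by simp
  have hS : ({α}ᶜ : Finset (Fin 3)).Nonempty := ⟨_, hmem 0⟩
  have hr := h.level_eq hv hS h' hL hL' hrr
  subst hr
  have key : ∀ {y : QVec 1 3} {d : ℂ}, IsRigid {α}ᶜ y → Level v r d y →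
      P₁ y α * Q₁ y α = -U₁ y 0 ^ 2 ∧
      normSq (P₁ y α) = (1 + (v α * r) ^ 2) / 4 - v α * r / 2 ∧
      normSq (Q₁ y α) = (1 + (v α * r) ^ 2) / 4 + v α * r / 2 ∧
      normSq (U₁ y 0) = (1 - (v α * r) ^ 2) / 4 := by
    intro y d h hL
    have hm := fun i => h.mem _ (hmem i)
    have hn := h.notMem α (by simp)
    have q1 := hL.quad₁
    have n1 := hL.norm₁
    rw [sum_three_succAbove _ α] at q1 n1
    simp only [Fin.sum_univ_one, hm, map_zero] at q1 n1
    have t := hL.torus α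
    simp only [hn, map_zero] at t
    have hmul : P₁ y α * Q₁ y α = -U₁ y 0 ^ 2 := by linear_combination q1
    have hns := congrArg normSq hmul
    rw [normSq_neg, normSq_mul, sq, normSq_mul] at hns
    refine ⟨hmul, ?_⟩
    rw [← t]
    generalize normSq (P₁ y α) = A at *
    generalize normSq (Q₁ y α) = C at *
    generalize normSq (U₁ y 0) = D at *
    have hD : D = (1 - (A + C)) / 2 := by linarith
    rw [hD] at hns ⊢
    refine ⟨?_, ?_, ?_⟩
    · linear_combination hns
    · linear_combination hns
    · linear_combination -hns
  obtain ⟨k1, k2, k3, k4⟩ := key h hL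
  obtain ⟨l1, l2, l3, l4⟩ := key h' hL'
  obtain ⟨κ, hκ⟩ := exists_circle_mul_eq (x := U₁ u.1 0 ^ 2) (y := U₁ u'.1 0 ^ 2)
    (by rw [map_pow, map_pow, k4, l4])
  have hm := fun i => h.mem _ (hmem i)
  have hm' := fun i => h'.mem _ (hmem i)
  refine h.exists_smul_eq hv hS h' hL hL' hκ (fun β => ?_) (fun β => ?_) (fun β => ?_)
  · rcases Fin.eq_self_or_eq_succAbove α β with rfl | ⟨i, rfl⟩
    · rw [k1, l1, hκ]; ring
    · rw [(hm i).1, (hm' i).1]; ring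
  · rcases Fin.eq_self_or_eq_succAbove α β with rfl | ⟨i, rfl⟩
    · rw [k2, l2]
    · rw [(hm i).1, (hm' i).1]
  · rcases Fin.eq_self_or_eq_succAbove α β with rfl | ⟨i, rfl⟩
    · rw [k3, l3]
    · rw [(hm i).2, (hm' i).2]

/-- The vectors `P + Q` form orthonormal pairs in `ℂ³` with column lengths given by `|v_α r|`, so
`exists_unitary_phases` applies. This is the rigidity of triangles. -/
theorem IsSingleType.exists_smul_eq (hv : IsKernelVector W v)
    {u u' : zeroLevel 1 W} (h : IsSingleType u.1) (h' : IsSingleType u'.1) {r r' : ℝ} {d d' : ℂ}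
    (hL : Level v r d u.1) (hL' : Level v r' d' u'.1) (hrr : 0 < r * r') :
    ∃ g : GTilde 2, g • u = u' := by
  classical
  have hr : r = r' := eq_of_abs_mul_eq hrr (by exact_mod_cast hv.weightSum_pos.ne')
    (h.abs_mul hL) (h'.abs_mul hL')
  subst hr
  have key : ∀ {y : QVec 1 3} {d : ℂ}, IsSingleType y → Level v r d y →
      ∑ α, normSq (P₁ y α + Q₁ y α) = 1 ∧ ∑ α, normSq (P₂ y α + Q₂ y α) = 1 ∧
      ∑ α, (P₁ y α + Q₁ y α) * conj (P₂ y α + Q₂ y α) = 0 ∧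
      ∀ α, normSq (P₁ y α + Q₁ y α) + normSq (P₂ y α + Q₂ y α) = |v α * r| := by
    intro y d h hL
    have n1 := hL.norm₁
    have n2 := hL.norm₂
    have n3 := hL.herm
    simp only [h.u₁, h.u₂, map_zero, mul_zero, Finset.sum_const_zero, zero_add] at n1 n2 n3
    refine ⟨?_, ?_, ?_, fun α => ?_⟩
    · rw [← n1]
      refine Finset.sum_congr rfl fun α _ => ?_
      rcases h.p_or_q α with h1 | h1 <;> simp [h1]
    · rw [← n2]
      refine Finset.sum_congr rfl fun α _ => ?_
      rcases h.p_or_q α with h1 | h1 <;> simp [h1]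
    · rw [← n3]
      refine Finset.sum_congr rfl fun α _ => ?_
      rcases h.p_or_q α with h1 | h1 <;> simp [h1]
    · rw [← (hL.pair_ne (h.p_or_q α)).1]
      rcases h.p_or_q α with h1 | h1 <;> simp [h1]
  obtain ⟨k1, k2, k3, k4⟩ := key h hL
  obtain ⟨l1, l2, l3, l4⟩ := key h' hL'
  obtain ⟨ζ, lam, ρ, hζ⟩ := exists_unitary_phases k1 k2 k3 l1 l2 l3 fun α => by rw [k4, l4]
  -- The torus acts on `P` by `z⁻¹` and on `Q` by `z`, so the phase is inverted where `P` survives.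
  refine exists_smul_eq_of_act hv (z := fun α => if v α * r ≤ 0 then (ζ α)⁻¹ else ζ α)
    (lam := lam) (ρ := ρ) ?_ (h.exists_diagStab hv hL)
  have hneg : ∀ α, v α * r ≤ 0 → (Q₁ u.1 α = 0 ∧ Q₂ u.1 α = 0) ∧ (Q₁ u'.1 α = 0 ∧ Q₂ u'.1 α = 0) :=
    fun α hα => ⟨(hL.pair_ne (h.p_or_q α)).2.1 hα, (hL'.pair_ne (h'.p_or_q α)).2.1 hα⟩
  have hpos : ∀ α, ¬ v α * r ≤ 0 →
      (P₁ u.1 α = 0 ∧ P₂ u.1 α = 0) ∧ (P₁ u'.1 α = 0 ∧ P₂ u'.1 α = 0) := fun α hα =>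
    ⟨(hL.pair_ne (h.p_or_q α)).2.2 (not_le.1 hα).le,
      (hL'.pair_ne (h'.p_or_q α)).2.2 (not_le.1 hα).le⟩
  refine qvec_ext (fun i => ?_) (fun i => ?_) (fun α => ?_) (fun α => ?_) (fun α => ?_)
    (fun α => ?_)
  · rw [U₁_act, h.u₁, h.u₂, h'.u₁]; ring
  · rw [U₂_act, h.u₁, h.u₂, h'.u₂]; ring
  all_goals
    have hζα := hζ α
    by_cases hα : v α * r ≤ 0
    · obtain ⟨⟨h1, h2⟩, h3, h4⟩ := hneg α hα
      simp only [P₁_act, P₂_act, Q₁_act, Q₂_act, if_pos hα, inv_inv]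
      simp only [h1, h2, h3, h4, add_zero] at hζα ⊢
      first | exact hζα.1 | exact hζα.2 | simp
    · obtain ⟨⟨h1, h2⟩, h3, h4⟩ := hpos α hα
      simp only [P₁_act, P₂_act, Q₁_act, Q₂_act, if_neg hα]
      simp only [h1, h2, h3, h4, zero_add] at hζα ⊢
      first | exact hζα.1 | exact hζα.2 | simp

/-- There are at most two orbits, one for each sign of `r`. -/
theorem finite_orbits (hv : IsKernelVector W v) {C : QVec 1 3 → Prop}
    (hC : ∀ {u r d}, C u → Level v r d u → r ≠ 0)
    (h : ∀ {u u' : zeroLevel 1 W} {r r' : ℝ} {d d' : ℂ}, C u.1 → C u'.1 → Level v r d u.1 →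
      Level v r' d' u'.1 → 0 < r * r' → ∃ g : GTilde 2, g • u = u') :
    ((fun u : zeroLevel 1 W => (Quotient.mk _ u : Twistor 1 W)) '' {u | C u.1}).Finite := by
  have hsub : ∀ ε : ℝ, ((fun u : zeroLevel 1 W => (Quotient.mk _ u : Twistor 1 W)) ''
      {u | C u.1 ∧ ∃ r d, Level v r d u.1 ∧ 0 < ε * r}).Subsingleton := by
    rintro ε _ ⟨u, ⟨hu, r, d, hL, hr⟩, rfl⟩ _ ⟨u', ⟨hu', r', d', hL', hr'⟩, rfl⟩
    obtain ⟨g, hg⟩ := h hu' hu hL' hL (by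
      have h1 := mul_pos hr hr'
      by_contra hc
      nlinarith [mul_nonneg (sq_nonneg ε) (neg_nonneg.2 (not_lt.1 hc))])
    exact Quotient.sound ⟨g, hg⟩
  refine ((hsub 1).finite.union (hsub (-1)).finite).subset ?_
  rintro _ ⟨u, hu, rfl⟩
  obtain ⟨r, d, hL⟩ := (mem_zeroLevel_iff hv u.1).1 u.2
  rcases lt_or_gt_of_ne (hC hu hL) with hr | hr
  · exact Or.inr ⟨u, ⟨hu, r, d, hL, by linarith⟩, rfl⟩
  · exact Or.inl ⟨u, ⟨hu, r, d, hL, by linarith⟩, rfl⟩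

theorem finite_exceptional (hv : IsKernelVector W v) :
    ((fun u : zeroLevel 1 W => (Quotient.mk _ u : Twistor 1 W)) ''
      {u | IsExceptional u.1}).Finite := by
  have hA := finite_orbits hv (C := IsSingleType)
    (fun h hL hr => by have := h.abs_mul hL; simp [hr] at this)
    (fun h h' hL hL' hrr => h.exists_smul_eq hv h' hL hL' hrr)
  have hF := fun α => finite_orbits hv (C := IsRigid {α}ᶜ)
    (fun h hL hr => by have := h.abs_mul hL; simp [hr] at this)
    (fun h h' hL hL' hrr => h.exists_smul_eq_compl hv h' hL hL' hrr)
  have hD := fun α => finite_orbits hv (C := fun u => IsRigid {α} u ∧ U₁ u 0 = 0)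
    (fun h hL hr => by have := h.1.abs_mul hL; simp [hr] at this)
    (fun h h' hL hL' hrr => h.1.exists_smul_eq_singleton hv h'.1 h.2 h'.2 hL hL' hrr)
  refine (hA.union (Set.finite_iUnion fun α => (hF α).union (hD α))).subset ?_
  rintro _ ⟨u, hu | ⟨α, hu | hu⟩, rfl⟩
  · exact Or.inl ⟨u, hu, rfl⟩
  · exact Or.inr (Set.mem_iUnion.2 ⟨α, Or.inl ⟨u, hu, rfl⟩⟩)
  · exact Or.inr (Set.mem_iUnion.2 ⟨α, Or.inr ⟨u, hu, rfl⟩⟩)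

end omega

/-! ### Orders of the isotropy groups -/

section orders

variable {e m : ℕ} {W : Matrix (Fin m) (Fin (m + 1)) ℤ} {v : Fin (m + 1) → ℤ}

/-- An element with trivial rotor that fixes a point is trivial, up to a common sign of the left
and of the right factor. -/
theorem eq_one_or_neg_one_of_smul_eq (hv : IsKernelVector W v) {u : zeroLevel e W} {g : GTilde m}
    (hg : rotorHom W g = 1) (hu : g • u = u) :
    (g.2.1 = 1 ∧ g.2.2 = 1) ∨ ((g.2.1 : ℍ[ℝ]) = -1 ∧ (g.2.2 : ℂ) = -1) := by
  obtain ⟨τ, lam, ρ⟩ := g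
  change rotor W τ = 1 at hg
  obtain ⟨ν, l, hν⟩ := exists_conj_circle lam
  have hact : act 1 lam (circleToSp1 ρ) u.1 = u.1 := by
    rw [← hg]; exact (coe_smul_eq_act (τ, lam, ρ) u).symm.trans (congrArg _ hu)
  set u' := (((1, ν, 1) : GTilde m) • u : zeroLevel e W)
  have hu' : u'.1 = act 1 ν 1 u.1 := by
    have h1 : rotor W (1 : Torus m) = 1 := funext fun α => rotor_one W α
    have := coe_smul_eq_act ((1, ν, 1) : GTilde m) u
    simp only [h1, map_one] at this
    exact this
  have hd : DiagStab 1 (l * ρ) (l⁻¹ * ρ) u'.1 := by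
    rw [← diagStab_iff, hu']
    conv_rhs => rw [← hact]
    rw [act_act, act_act, hν, one_mul, mul_one, one_mul]
  obtain ⟨r, d, hL⟩ := (mem_zeroLevel_iff hv u'.1).1 u'.2
  -- Otherwise all first coordinates would vanish, against the first norm equation; likewise for the
  -- second ones.
  have ha : l * ρ = 1 := by
    by_contra hne
    have h1 : ∀ i, U₁ u'.1 i = 0 := fun i => by_contra fun h => hne (hd.u₁ i h)
    have h2 : ∀ α, P₁ u'.1 α = 0 := fun α => by_contra fun h => hne (hd.p₁ α h).symm
    have h3 : ∀ α, Q₁ u'.1 α = 0 := fun α => by_contra fun h => hne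
      (inv_eq_one.1 (hd.q₁ α h).symm)
    have := hL.norm₁
    simp [h1, h2, h3] at this
  have hb : l⁻¹ * ρ = 1 := by
    by_contra hne
    have h1 : ∀ i, U₂ u'.1 i = 0 := fun i => by_contra fun h => hne (hd.u₂ i h)
    have h2 : ∀ α, P₂ u'.1 α = 0 := fun α => by_contra fun h => hne (hd.p₂ α h).symm
    have h3 : ∀ α, Q₂ u'.1 α = 0 := fun α => by_contra fun h => hne
      (inv_eq_one.1 (hd.q₂ α h).symm)
    have := hL.norm₂
    simp [h1, h2, h3] at this
  have hl : l = ρ := inv_mul_eq_one.1 hb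
  subst hl
  have hsq : (l : ℂ) * l = 1 := by rw [← Circle.coe_mul, ha, Circle.coe_one]
  rcases mul_self_eq_one_iff.1 hsq with h | h
  · left
    have h1 : l = 1 := Circle.ext (by simpa using h)
    rw [h1, map_one, one_mul] at hν
    exact ⟨mul_eq_left.1 hν, h1⟩
  · right
    refine ⟨?_, h⟩
    have h1 := congrArg (fun x : Sp1 => (x : ℍ[ℝ])) hν
    simp only [Submonoid.coe_mul, coe_circleToSp1, h] at h1
    have h2 := congrArg (fun x => star (ν : ℍ[ℝ]) * x) h1
    simp only [← mul_assoc, Sp1.star_mul_self, one_mul] at h2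
    rw [h2]
    have h3 : ((-1 : ℂ) : ℍ[ℝ]) = -1 := by ext <;> simp
    rw [h3, mul_neg, mul_one, neg_mul, Sp1.star_mul_self]

theorem smul_eq_of_smul_eq (hv : IsKernelVector W v) {u : zeroLevel e W} {g : GTilde m}
    (hg : rotorHom W g = 1) (hu : g • u = u) (u' : zeroLevel e W) : g • u' = u' := by
  have h := eq_one_or_neg_one_of_smul_eq hv hg hu
  obtain ⟨τ, lam, ρ⟩ := g
  change rotor W τ = 1 at hg
  refine Subtype.ext ((coe_smul_eq_act _ _).trans ?_)
  simp only [hg]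
  rcases h with ⟨h1, h2⟩ | ⟨h1, h2⟩
  · simp only at h1 h2
    rw [h1, h2, map_one, act_one]
  · simp only at h1 h2
    have h3 : ((-1 : ℂ) : ℍ[ℝ]) = -1 := by ext <;> simp
    refine Prod.ext (funext fun i => ?_) (funext fun α => Prod.ext ?_ ?_) <;>
      simp [act, transform, rotor_one_matrix, h1, h2, h3]

/-- The elements with trivial rotor that fix the zero level. -/
def rotorKernel (e : ℕ) (W : Matrix (Fin m) (Fin (m + 1)) ℤ) : Subgroup (GTilde m) :=
  (rotorHom W).ker ⊓ (MulAction.toPermHom (GTilde m) (zeroLevel e W)).ker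

theorem ker_toPermHom_le {Γ X : Type*} [Group Γ] [MulAction Γ X] (x : X) :
    (MulAction.toPermHom Γ X).ker ≤ MulAction.stabilizer Γ x := fun _ hg =>
  Equiv.congr_fun (MonoidHom.mem_ker.1 hg) x

/-- The part of a stabilizer lost in passing to rotors does not depend on the point, so orders of
isotropy groups become indices of fixed subgroups. -/
theorem ker_rotorHom_inf_stabilizer (hv : IsKernelVector W v) (u : zeroLevel e W) :
    (rotorHom W).ker ⊓ MulAction.stabilizer (GTilde m) u = rotorKernel e W := by
  refine le_antisymm (fun g hg => ⟨hg.1, ?_⟩) (inf_le_inf_left _ (ker_toPermHom_le u))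
  exact MonoidHom.mem_ker.2 (Equiv.ext fun u' => smul_eq_of_smul_eq hv hg.1 hg.2 u')

theorem card_torusIsotropy_eq_relIndex (hv : IsKernelVector W v) (u : zeroLevel e W) :
    Nat.card (torusIsotropy u)
      = (rotorKernel e W).relIndex (MulAction.stabilizer (GTilde m) u) := by
  rw [← ker_rotorHom_inf_stabilizer hv u, Subgroup.inf_relIndex_right, Subgroup.relIndex_ker]
  rfl

theorem card_effIsotropy {Γ X : Type*} [Group Γ] [MulAction Γ X] (x : X) :
    Nat.card (effIsotropy Γ x)
      = (MulAction.toPermHom Γ X).ker.relIndex (MulAction.stabilizer Γ x) :=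
  (Subgroup.relIndex_ker _ _).symm

/-- The isotropy groups of the twistor space and of the torus have proportional orders. -/
theorem card_torusIsotropy_twistor (hv : IsKernelVector W v) :
    ∃ c : ℕ, ∀ u : zeroLevel e W,
      Nat.card (torusIsotropy u) = c * Nat.card (effIsotropy (GTilde m) u) := by
  refine ⟨(rotorKernel e W).relIndex (MulAction.toPermHom (GTilde m) (zeroLevel e W)).ker,
    fun u => ?_⟩
  rw [card_torusIsotropy_eq_relIndex hv, card_effIsotropy]
  exact (Subgroup.relIndex_mul_relIndex _ _ _ inf_le_right (ker_toPermHom_le u)).symm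

/-- The inclusion of `G` into `G̃`. -/
def inclG (m : ℕ) : G m →* GTilde m where
  toFun g := (g.1, g.2, 1)
  map_one' := rfl
  map_mul' g h := by simp

/-- The projection of `G̃` to the right factor. -/
def rightFactor (m : ℕ) : GTilde m →* Circle where
  toFun g := g.2.2
  map_one' := rfl
  map_mul' _ _ := rfl

theorem inclG_injective (m : ℕ) : Function.Injective (inclG m) := fun _ _ hgh =>
  Prod.ext (congrArg (fun x : GTilde m => x.1) hgh) (congrArg (fun x : GTilde m => x.2.1) hgh)

theorem inclG_smul (g : G m) (u : zeroLevel e W) : inclG m g • u = g • u := by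
  refine Subtype.ext ?_
  change transform W g.1 g.2 (circleToSp1 1) u.1 = transform W g.1 g.2 1 u.1
  rw [map_one]

/-- The stabilizer in `G` is the kernel of the right factor on the stabilizer in `G̃`, so the index
of the former in the latter is the order of `rightIsotropy`. -/
theorem map_inclG_stabilizer (u : zeroLevel e W) :
    (MulAction.stabilizer (G m) u).map (inclG m)
      = (rightFactor m).ker ⊓ MulAction.stabilizer (GTilde m) u := by
  ext g
  constructor
  · rintro ⟨g, hg, rfl⟩
    exact ⟨rfl, (inclG_smul g u).trans hg⟩
  · rintro ⟨h1, h2⟩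
    have hg : inclG m (g.1, g.2.1) = g := Prod.ext rfl (Prod.ext rfl (Eq.symm h1))
    refine ⟨(g.1, g.2.1), ?_, hg⟩
    rw [← hg] at h2
    exact (inclG_smul _ u).symm.trans h2

/-- The right factors of the elements of `G̃` that fix `u`. -/
def rightIsotropy (u : zeroLevel e W) : Subgroup Circle :=
  (MulAction.stabilizer (GTilde m) u).map (rightFactor m)

/-- The isotropy groups of the 3-Sasakian orbifold and of the torus. -/
theorem card_torusIsotropy_sasakian (hv : IsKernelVector W v) [Nonempty (zeroLevel e W)] :
    ∃ c₀ c₁ : ℕ, c₀ ≠ 0 ∧ ∀ u : zeroLevel e W, c₀ * Nat.card (torusIsotropy u)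
      = c₁ * (Nat.card (effIsotropy (G m) u) * Nat.card (rightIsotropy u)) := by
  let N : Subgroup (GTilde m) :=
    (MulAction.toPermHom (G m) (zeroLevel e W)).ker.map (inclG m)
  let N' : Subgroup (GTilde m) := (rightFactor m).ker ⊓ rotorKernel e W
  have hN' : N' ≤ N := by
    rintro g ⟨h1, -, h2⟩
    have hg : inclG m (g.1, g.2.1) = g := Prod.ext rfl (Prod.ext rfl (Eq.symm h1))
    refine ⟨(g.1, g.2.1), ?_, hg⟩
    refine MonoidHom.mem_ker.2 (Equiv.ext fun u => ?_)
    rw [← hg] at h2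
    exact (inclG_smul _ u).symm.trans (Equiv.congr_fun (MonoidHom.mem_ker.1 h2) u)
  -- Both sides will equal the index of `N'` in the stabilizer in `G̃`, computed through
  -- `rotorKernel` and through `N` and the stabilizer in `G`. The first constant is nonzero because
  -- right factors in `rotorKernel` are `±1`.
  refine ⟨N'.relIndex (rotorKernel e W), N'.relIndex N, ?_, fun u => ?_⟩
  · rw [Subgroup.inf_relIndex_right, Subgroup.relIndex_ker]
    have hsub : (((rotorKernel e W).map (rightFactor m) : Subgroup Circle) : Set Circle) ⊆
        {w : Circle | w ^ 2 = 1} := by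
      rintro _ ⟨g, ⟨h1, h2⟩, rfl⟩
      obtain ⟨u⟩ := ‹Nonempty (zeroLevel e W)›
      rcases eq_one_or_neg_one_of_smul_eq hv (MonoidHom.mem_ker.1 h1) (ker_toPermHom_le u h2) with
        ⟨-, h⟩ | ⟨-, h⟩
      · change g.2.2 ^ 2 = 1
        rw [h, one_pow]
      · change g.2.2 ^ 2 = 1
        exact Circle.ext (by rw [Circle.coe_pow, h]; simp)
    have hfin : Finite ((rotorKernel e W).map (rightFactor m)) :=
      ((ncard_circle_pow_eq two_pos 1).1.subset hsub).to_subtype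
    exact Nat.card_pos.ne'
  · have hNS : N ≤ MulAction.stabilizer (GTilde m) u := by
      rintro _ ⟨g, hg, rfl⟩
      exact (inclG_smul g u).trans (ker_toPermHom_le u hg)
    have hK : rotorKernel e W ≤ MulAction.stabilizer (GTilde m) u :=
      inf_le_right.trans (ker_toPermHom_le u)
    have h1 : Nat.card (rightIsotropy u) = ((MulAction.stabilizer (G m) u).map (inclG m)).relIndex
        (MulAction.stabilizer (GTilde m) u) := by
      rw [map_inclG_stabilizer, Subgroup.inf_relIndex_right, Subgroup.relIndex_ker]
      rfl
    have h2 : Nat.card (effIsotropy (G m) u)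
        = N.relIndex ((MulAction.stabilizer (G m) u).map (inclG m)) := by
      rw [card_effIsotropy, Subgroup.relIndex_map_map_of_injective _ _ (inclG_injective m)]
    rw [card_torusIsotropy_eq_relIndex hv, h1, h2,
      Subgroup.relIndex_mul_relIndex _ _ _ inf_le_right hK,
      Subgroup.relIndex_mul_relIndex _ _ _ (Subgroup.map_mono (ker_toPermHom_le u))
        (by rw [map_inclG_stabilizer]; exact inf_le_right),
      Subgroup.relIndex_mul_relIndex _ _ _ hN' hNS]

end orders

/-! ### Comparison of the two cases -/

section comparison

variable {Θ : Matrix (Fin 3) (Fin 4) ℤ} {Ω : Matrix (Fin 2) (Fin 3) ℤ} {v : Fin 4 → ℤ}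
  {w : Fin 3 → ℤ}

theorem card_torusIsotropy_ne_zero (hv : IsKernelVector Θ v) (u : zeroLevel 0 Θ) :
    Nat.card (torusIsotropy u) ≠ 0 := by
  have : Finite (torusIsotropy u) := (ncard_torusIsotropy_lt hv u).1.to_subtype
  exact Nat.card_pos.ne'

/-- There is no correspondence between the orbits of the two zero levels under which the isotropy
groups have proportional orders. -/
theorem not_proportional (hv : IsKernelVector Θ v) (hw : IsKernelVector Ω w)
    {R : zeroLevel 0 Θ → zeroLevel 1 Ω → Prop} (hR : ∀ u, ∃ y, R u y) (hR' : ∀ y, ∃ u, R u y)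
    (hinj : ∀ {u u' y y'}, R u y → R u' y' →
      (Quotient.mk _ y : Twistor 1 Ω) = Quotient.mk _ y' →
      (Quotient.mk _ u : Twistor 0 Θ) = Quotient.mk _ u')
    {A B : ℕ} (hA : A ≠ 0)
    (hAB : ∀ {u y}, R u y → A * Nat.card (torusIsotropy u) = B * Nat.card (torusIsotropy y)) :
    False := by
  have h5 := five_le_weightSum hv
  have hBA : B ≤ 2 * A := by
    obtain ⟨u, hu⟩ := exists_small_isotropy hv
    obtain ⟨y, hy⟩ := hR u
    have h1 := hAB hy
    -- An infinite group would have `Nat.card` equal to zero; proportionality to a positive finite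
    -- order excludes this.
    have h2 : Nat.card (torusIsotropy y) ≠ 0 := fun h => by
      rw [h, mul_zero] at h1
      exact mul_ne_zero hA (card_torusIsotropy_ne_zero hv u) h1
    calc B ≤ B * Nat.card (torusIsotropy y) := Nat.le_mul_of_pos_right _ (Nat.pos_of_ne_zero h2)
      _ = A * Nat.card (torusIsotropy u) := h1.symm
      _ ≤ A * 2 := Nat.mul_le_mul_left _ hu
      _ = 2 * A := mul_comm _ _
  -- Infinitely many orbits have order at least `weightSum v`, and distinct ones correspond to
  -- distinct orbits, so not all of them can be exceptional.
  obtain ⟨u, y, hu, hR₁, hy⟩ : ∃ u y, weightSum v ≤ Nat.card (torusIsotropy u) ∧ R u y ∧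
      (Quotient.mk _ y : Twistor 1 Ω) ∉ (fun u : zeroLevel 1 Ω => (Quotient.mk _ u : Twistor 1 Ω)) ''
        {u | IsExceptional u.1} := by
    by_contra hne
    push Not at hne
    choose Y hY using hR
    have : Nonempty (zeroLevel 0 Θ) := ⟨(exists_small_isotropy hv).choose⟩
    choose! rep hrep using fun (x : Twistor 0 Θ)
      (hx : x ∈ (fun u => (Quotient.mk _ u : Twistor 0 Θ)) ''
        {u | weightSum v ≤ (torusIsotropy u : Set (Torus 4)).ncard}) => hx
    refine infinite_large_isotropy hv (Set.Finite.of_injOn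
      (f := fun x => (Quotient.mk _ (Y (rep x)) : Twistor 1 Ω)) (fun x hx => ?_)
      (fun x hx x' hx' hxx => ?_) (finite_exceptional hw))
    · exact hne _ _ (hrep x hx).1 (hY _)
    · rw [← (hrep x hx).2, ← (hrep x' hx').2]
      exact hinj (hY _) (hY _) hxx
  have h1 := hAB hR₁
  have h2 : A * weightSum v ≤ B * Nat.card (torusIsotropy y) := by
    rw [← h1]; exact Nat.mul_le_mul_left _ hu
  have hA' := Nat.pos_of_ne_zero hA
  rcases isotropy_trichotomy hw y with h3 | ⟨β, hβ, h3⟩ | ⟨g, hg⟩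
  · have h4 : B * Nat.card (torusIsotropy y) ≤ 2 * A * 2 := Nat.mul_le_mul hBA h3
    nlinarith
  -- Doubling the order at `y` would produce a point `u'` of order at least `2 * weightSum v`.
  · obtain ⟨y', hy'⟩ := hβ.exists_large_isotropy hw
    obtain ⟨u', hu'⟩ := hR' y'
    have h4 := hAB hu'
    have h5 : Nat.card (torusIsotropy y') ≠ 0 := fun h => by
      rw [h, mul_zero] at h4
      exact mul_ne_zero hA (card_torusIsotropy_ne_zero hv u') h4
    have h6 : 2 * (w β).natAbs ≤ Nat.card (torusIsotropy y') := by
      have := Nat.finite_of_card_ne_zero h5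
      exact hy' (Set.toFinite _)
    have h7 : Nat.card (torusIsotropy u') < 2 * weightSum v := (ncard_torusIsotropy_lt hv u').2
    have h8 : B * Nat.card (torusIsotropy y) ≤ B * (w β).natAbs := Nat.mul_le_mul_left _ h3
    have h9 : B * (2 * (w β).natAbs) ≤ B * Nat.card (torusIsotropy y') := Nat.mul_le_mul_left _ h6
    have h10 : A * Nat.card (torusIsotropy u') < A * (2 * weightSum v) :=
      Nat.mul_lt_mul_of_pos_left h7 hA'
    have h11 : A * (2 * weightSum v) = 2 * (A * weightSum v) := by ring
    have h12 : B * (2 * (w β).natAbs) = 2 * (B * (w β).natAbs) := by ring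
    omega
  · refine hy ⟨g • y, hg, Quotient.sound ⟨g, rfl⟩⟩

/-- The constants of proportionality are positive. -/
theorem not_proportional' (hv : IsKernelVector Θ v) (hw : IsKernelVector Ω w)
    {R : zeroLevel 0 Θ → zeroLevel 1 Ω → Prop} (hR : ∀ u, ∃ y, R u y) (hR' : ∀ y, ∃ u, R u y)
    (hinj : ∀ {u u' y y'}, R u y → R u' y' →
      (Quotient.mk _ y : Twistor 1 Ω) = Quotient.mk _ y' →
      (Quotient.mk _ u : Twistor 0 Θ) = Quotient.mk _ u')
    {F : zeroLevel 0 Θ → ℕ} {F' : zeroLevel 1 Ω → ℕ} (hF : ∀ {u y}, R u y → F u = F' y)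
    {c c₁ c' c₁' : ℕ} (hc : c ≠ 0) (hc' : c' ≠ 0)
    (h : ∀ u, c * Nat.card (torusIsotropy u) = c₁ * F u)
    (h' : ∀ y, c' * Nat.card (torusIsotropy y) = c₁' * F' y) : False := by
  -- The point with trivial isotropy has order one, which cannot be cancelled by a zero constant.
  have hc₁' : c₁' ≠ 0 := by
    rintro rfl
    obtain ⟨y, hy⟩ := exists_trivial_isotropy hw
    have := h' y
    rw [hy, Subgroup.card_bot] at this
    omega
  refine not_proportional hv hw hR hR' hinj (A := c₁' * c) (B := c₁ * c')
    (mul_ne_zero hc₁' hc) fun {u y} huy => ?_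
  rw [mul_assoc, mul_assoc, h, h', hF huy]
  ring

theorem not_twistorEquivalent (hv : IsKernelVector Θ v) (hw : IsKernelVector Ω w) :
    ¬ TwistorEquivalent 0 Θ 1 Ω := by
  rintro ⟨f, hf⟩
  obtain ⟨c, hc⟩ := card_torusIsotropy_twistor (e := 0) hv
  obtain ⟨c', hc'⟩ := card_torusIsotropy_twistor (e := 1) hw
  refine not_proportional' hv hw
    (R := fun u y => f (Quotient.mk _ u) = Quotient.mk _ y) (fun u => ?_) (fun y => ?_)
    (fun h h' hy => f.injective (by rw [h, h', hy]))
    (F := fun u => Nat.card (effIsotropy (GTilde 3) u))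
    (F' := fun y => Nat.card (effIsotropy (GTilde 2) y))
    (fun {u y} h => ?_) one_ne_zero one_ne_zero (fun u => by rw [one_mul]; exact hc u)
    (fun y => by rw [one_mul]; exact hc' y)
  · obtain ⟨y, hy⟩ := Quotient.exists_rep (f (Quotient.mk _ u))
    exact ⟨y, hy.symm⟩
  · obtain ⟨u, hu⟩ := Quotient.exists_rep (f.symm (Quotient.mk _ y))
    exact ⟨u, by rw [hu, f.apply_symm_apply]⟩
  · obtain ⟨φ⟩ := hf u y h
    exact Nat.card_congr φ.toEquiv

end comparison

/-! ### The right action on the 3-Sasakian orbifold -/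

section sasakian

variable {e m k : ℕ} {W : Matrix (Fin m) (Fin k) ℤ}

/-- Right multiplication on the zero level. -/
def rightMulLevel (p : Sp1) (u : zeroLevel e W) : zeroLevel e W :=
  ⟨transform W 1 1 p u, transform_mem W _ _ _ u.2⟩

theorem rightMul_mk (p : Sp1) (u : zeroLevel e W) :
    Sasakian.rightMul p (Quotient.mk _ u : Sasakian e W) = Quotient.mk _ (rightMulLevel p u) := rfl

theorem rightMul_rightMul (p p' : Sp1) (x : Sasakian e W) :
    Sasakian.rightMul p (Sasakian.rightMul p' x) = Sasakian.rightMul (p' * p) x := by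
  induction x using Quotient.inductionOn with | _ u => ?_
  rw [rightMul_mk, rightMul_mk, rightMul_mk]
  congr 1
  refine Subtype.ext ?_
  change transform W 1 1 p (transform W 1 1 p' u.1) = _
  rw [transform_transform, one_mul, one_mul]
  rfl

theorem rightMul_one (x : Sasakian e W) : Sasakian.rightMul 1 x = x := by
  induction x using Quotient.inductionOn with | _ u => ?_
  rw [rightMul_mk]
  congr 1
  exact Subtype.ext (transform_one W u.1)

theorem smul_rightMulLevel (g : G m) (p : Sp1) (u : zeroLevel e W) :
    g • rightMulLevel p u = rightMulLevel p (g • u) := by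
  refine Subtype.ext ?_
  change transform W g.1 g.2 1 (transform W 1 1 p u.1)
    = transform W 1 1 p (transform W g.1 g.2 1 u.1)
  rw [transform_transform, transform_transform]
  simp

theorem rightMulLevel_injective (p : Sp1) :
    Function.Injective (rightMulLevel p : zeroLevel e W → zeroLevel e W) := by
  intro u u' h
  have h1 := congrArg (fun x : zeroLevel e W => transform W 1 1 p⁻¹ x.1) h
  simp only [rightMulLevel, transform_transform, one_mul, mul_inv_cancel, transform_one] at h1
  exact Subtype.ext h1

theorem effIsotropy_rightMulLevel (p : Sp1) (u : zeroLevel e W) :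
    effIsotropy (G m) (rightMulLevel p u) = effIsotropy (G m) u := by
  have : MulAction.stabilizer (G m) (rightMulLevel p u) = MulAction.stabilizer (G m) u := by
    ext g
    rw [MulAction.mem_stabilizer_iff, MulAction.mem_stabilizer_iff, smul_rightMulLevel,
      (rightMulLevel_injective p).eq_iff]
  rw [effIsotropy, effIsotropy, this]

/-- An element of `G̃` is an element of `G` together with a right multiplication, so `G̃`-orbits and
right isotropy can be read off from the action of `U(1)` on the 3-Sasakian orbifold. -/
theorem exists_smul_eq_iff (ρ : Circle) (u u' : zeroLevel e W) :
    (∃ g : GTilde m, g.2.2 = ρ ∧ g • u = u') ↔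
      Sasakian.rightMul (circleToSp1 ρ) (Quotient.mk _ u : Sasakian e W) = Quotient.mk _ u' := by
  have key : ∀ g : GTilde m, ((g.1, g.2.1) : G m) • rightMulLevel (circleToSp1 g.2.2) u = g • u :=
    fun g => Subtype.ext (by
      change transform W g.1 g.2.1 1 (transform W 1 1 (circleToSp1 g.2.2) u.1) = _
      rw [transform_transform, mul_one, mul_one, mul_one]
      rfl)
  rw [rightMul_mk]
  constructor
  · rintro ⟨g, rfl, rfl⟩
    symm
    exact Quotient.sound ⟨(g.1, g.2.1), key g⟩
  · intro h
    obtain ⟨g, hg⟩ := Quotient.exact h.symm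
    exact ⟨(g.1, g.2, ρ), rfl, by rw [← key]; exact hg⟩

theorem mk_eq_mk_iff (u u' : zeroLevel e W) :
    (Quotient.mk _ u : Twistor e W) = Quotient.mk _ u' ↔
      ∃ ρ, Sasakian.rightMul (circleToSp1 ρ) (Quotient.mk _ u : Sasakian e W)
        = Quotient.mk _ u' := by
  constructor
  · intro h
    obtain ⟨g, hg⟩ := Quotient.exact h.symm
    exact ⟨g.2.2, (exists_smul_eq_iff _ _ _).1 ⟨g, rfl, hg⟩⟩
  · rintro ⟨ρ, h⟩
    obtain ⟨g, -, hg⟩ := (exists_smul_eq_iff _ _ _).2 h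
    symm
    exact Quotient.sound ⟨g, hg⟩

end sasakian

section comparison

variable {Θ : Matrix (Fin 3) (Fin 4) ℤ} {Ω : Matrix (Fin 2) (Fin 3) ℤ} {v : Fin 4 → ℤ}
  {w : Fin 3 → ℤ}

theorem mem_rightIsotropy_iff {e m : ℕ} {W : Matrix (Fin m) (Fin (m + 1)) ℤ} (u : zeroLevel e W)
    (ρ : Circle) : ρ ∈ rightIsotropy u ↔
      Sasakian.rightMul (circleToSp1 ρ) (Quotient.mk _ u : Sasakian e W) = Quotient.mk _ u := by
  rw [← exists_smul_eq_iff]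
  constructor
  · rintro ⟨g, hg, rfl⟩
    exact ⟨g, rfl, hg⟩
  · rintro ⟨g, rfl, hg⟩
    exact ⟨g, hg, rfl⟩

theorem not_sasakianEquivalent (hv : IsKernelVector Θ v) (hw : IsKernelVector Ω w) :
    ¬ SasakianEquivalent 0 Θ 1 Ω := by
  rintro ⟨f, hf, q, hq⟩
  have : Nonempty (zeroLevel 0 Θ) := ⟨(exists_small_isotropy hv).choose⟩
  have : Nonempty (zeroLevel 1 Ω) := ⟨(exists_trivial_isotropy hw).choose⟩
  obtain ⟨c, c₁, hc, h⟩ := card_torusIsotropy_sasakian (e := 0) hv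
  obtain ⟨c', c₁', hc', h'⟩ := card_torusIsotropy_sasakian (e := 1) hw
  -- Composing `f` with right multiplication by `q⁻¹` removes the conjugation and gives a strictly
  -- equivariant bijection, which therefore respects twistor fibres and right isotropy groups.
  have hequiv : ∀ (p : Sp1) (x : Sasakian 0 Θ),
      Sasakian.rightMul q⁻¹ (f (Sasakian.rightMul p x))
        = Sasakian.rightMul p (Sasakian.rightMul q⁻¹ (f x)) := fun p x => by
    rw [hq, rightMul_rightMul, rightMul_rightMul, mul_inv_cancel_right]
  have hinj : Function.Injective fun x => Sasakian.rightMul q⁻¹ (f x) := fun x x' hx => by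
    have h1 := congrArg (Sasakian.rightMul q) hx
    simp only [rightMul_rightMul, inv_mul_cancel, rightMul_one] at h1
    exact f.injective h1
  refine not_proportional' hv hw
    (R := fun u y => Sasakian.rightMul q⁻¹ (f (Quotient.mk _ u)) = Quotient.mk _ y)
    (fun u => ?_) (fun y => ?_) (fun {u u' y y'} hy hy' hyy => ?_) (fun {u y} huy => ?_) hc hc' h h'
  · obtain ⟨y, hy⟩ := Quotient.exists_rep (Sasakian.rightMul q⁻¹ (f (Quotient.mk _ u)))
    exact ⟨y, hy.symm⟩
  · obtain ⟨u, hu⟩ := Quotient.exists_rep (f.symm (Sasakian.rightMul q (Quotient.mk _ y)))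
    exact ⟨u, by rw [hu, f.apply_symm_apply, rightMul_rightMul, mul_inv_cancel, rightMul_one]⟩
  · obtain ⟨ρ, hρ⟩ := (mk_eq_mk_iff y y').1 hyy
    refine (mk_eq_mk_iff u u').2 ⟨ρ, hinj ?_⟩
    simp only
    rw [hequiv, hy, hy', hρ]
  · have h1 : Nat.card (effIsotropy (G 3) u) = Nat.card (effIsotropy (G 2) y) := by
      -- The isotropy hypothesis concerns `f` itself, so the twist is undone; right multiplication
      -- commutes with `G` and does not change its stabilizers.
      obtain ⟨φ⟩ := hf u (rightMulLevel q y) (by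
        rw [← rightMul_mk, ← huy, rightMul_rightMul, inv_mul_cancel, rightMul_one])
      rw [effIsotropy_rightMulLevel] at φ
      exact Nat.card_congr φ.toEquiv
    have h2 : rightIsotropy u = rightIsotropy y := by
      ext ρ
      rw [mem_rightIsotropy_iff, mem_rightIsotropy_iff, ← huy, ← hequiv]
      exact hinj.eq_iff.symm
    rw [h1, h2]

end comparison

end SDE

end

theorem theorem3p3
    (Θ : Matrix (Fin 3) (Fin 4) ℤ) (hΘ : SDE.Admissible Θ)
    (Ω : Matrix (Fin 2) (Fin 3) ℤ) (hΩ : SDE.Admissible Ω) :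
    ¬ SDE.TwistorEquivalent 0 Θ 1 Ω ∧ ¬ SDE.SasakianEquivalent 0 Θ 1 Ω := by
  obtain ⟨v, hv⟩ := hΘ.exists_kernelVector
  obtain ⟨w, hw⟩ := hΩ.exists_kernelVector
  exact ⟨SDE.not_twistorEquivalent hv hw, SDE.not_sasakianEquivalent hv hw⟩
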